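/- Let $\mathcal F g(\xi)=(2\pi)^{-d/2}\int_{\mathbb R^d}e^{-ix\cdot\xi}g(x)\,dx$, extended to the tempered distributions $\mathcal S'(\mathbb R^d)$. Fix a non-negative $\phi_0\in\mathcal S(\mathbb R^d)$ with $\phi_0(x)=1$ for $|x|\le 1$ and $\phi_0(x)=0$ for $|x|\ge \frac32$ ($|\cdot|$ the Euclidean norm), and put $\phi_j(x)=\phi_0(2^{-j}x)-\phi_0(2^{-j+1}x)$ for $j\ge 1$. Fix $\varphi_0\in C_0^\infty(\mathbb R)$ with $\varphi_0=1$ on $[-1,1]$ and $\operatorname{supp}\varphi_0\subset[-\frac32,\frac32]$, put $\varphi_j(\xi)=\varphi_0(2^{-j}\xi)-\varphi_0(2^{-j+1}\xi)$ for $j\ge 1$, and $\varphi_{\bar k}(x)=\varphi_{k_1}(x_1)\cdots\varphi_{k_d}(x_d)$, $|\bar k|_1=k_1+\dots+k_d$ for $\bar k\in\mathbb N_0^d$. For $t\in\mathbb R$, $0<p<\infty$ and $0<q\le\infty$ let $F^t_{p,q}(\mathbb R^d)$ and $S^t_{p,q}F(\mathbb R^d)$ be the spaces of all $f\in\mathcal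 S'(\mathbb R^d)$ for which, respectively, $$\|f\,|F^t_{p,q}\|=\Big\|\Big(\sum_{j=0}^\infty 2^{jtq}\,|\mathcal F^{-1}[\phi_j\mathcal F f](\cdot)|^q\Big)^{1/q}\Big|L_p(\mathbb R^d)\Big\|,\qquad \|f\,|S^t_{p,q}F\|=\Big\|\Big(\sum_{\bar k\in\mathbb N_0^d} 2^{|\bar k|_1tq}\,|\mathcal F^{-1}[\varphi_{\bar k}\mathcal F f](\cdot)|^q\Big)^{1/q}\Big|L_p(\mathbb R^d)\Big\|$$ is finite (with suprema in place of the sums if $q=\infty$). Let $d\ge 2$ and $t<0$. (i) If $1<p<\infty$ and $1\le q\le\infty$, then $F^t_{p,q}(\mathbb R^d)\hookrightarrow S^t_{p,q}F(\mathbb R^d)$, that is, $F^t_{p,q}(\mathbb R^d)\subset S^t_{p,q}F(\mathbb R^d)$ and there is a constant $C$ with $\|f\,|S^t_{p,q}F\|\le C\,\|f\,|F^t_{p,q}\|$ for all $f\in F^t_{p,q}(\mathbb R^d)$. (ii) If $0<p<1$ and $0<q\le\infty$, then $F^t_{p,q}(\mathbb R^d)$ and $S^t_{p,q}F(\mathbb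 R^d)$ are not comparable: neither of the two spaces is contained in the other (in particular, neither embeds continuously into the other). -/

import Mathlib

open MeasureTheory Set
open scoped ENNReal NNReal SchwartzMap FourierTransform ContDiff

noncomputable section

namespace LizorkinTriebel

/-- `ℝ^d` with the Euclidean norm. -/
abbrev Rd (d : ℕ) : Type := EuclideanSpace ℝ (Fin d)

/-- The dyadic functions generated by `φ₀`:
`φ_j(x) = φ₀(2^{-j} x) - φ₀(2^{-j+1} x)` for `j ≥ 1`. -/
def dyadic {V : Type*} [AddCommGroup V] [Module ℝ V] (φ₀ : V → ℂ) : ℕ → V → ℂ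
  | 0 => φ₀
  | j + 1 => fun x => φ₀ (((2 : ℝ) ^ (j + 1))⁻¹ • x) - φ₀ (((2 : ℝ) ^ j)⁻¹ • x)

lemma contDiff_dyadic {V : Type*} [NormedAddCommGroup V] [NormedSpace ℝ V] {φ₀ : V → ℂ}
    (h : ContDiff ℝ ∞ φ₀) (j : ℕ) : ContDiff ℝ ∞ (dyadic φ₀ j) := by
  cases j with
  | zero => exact h
  | succ j => exact (h.comp (contDiff_const_smul _)).sub (h.comp (contDiff_const_smul _))

lemma hasCompactSupport_dyadic {V : Type*} [NormedAddCommGroup V] [NormedSpace ℝ V] {φ₀ : V → ℂ}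
    (h : HasCompactSupport φ₀) (j : ℕ) : HasCompactSupport (dyadic φ₀ j) := by
  cases j with
  | zero => exact h
  | succ j =>
    have h1 : HasCompactSupport fun x : V => φ₀ (((2 : ℝ) ^ (j + 1))⁻¹ • x) :=
      h.comp_smul (by positivity)
    have h2 : HasCompactSupport fun x : V => φ₀ (((2 : ℝ) ^ j)⁻¹ • x) :=
      h.comp_smul (by positivity)
    exact h1.sub h2

/-- A smooth compactly supported function on `ℝ^d`, used as a symbol of a Fourier multiplier. -/
structure Symbol (d : ℕ) where
  toFun : Rd d → ℂ
  smooth : ContDiff ℝ ∞ toFun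
  compactSupport : HasCompactSupport toFun

/-- The Schwartz function `η ↦ exp(2πi⟨x,η⟩) m(2πη)`. -/
def Symbol.wave {d : ℕ} (m : Symbol d) (x : Rd d) : 𝓢(Rd d, ℂ) :=
  HasCompactSupport.toSchwartzMap
    (f := fun η : Rd d =>
      Complex.exp (((2 * Real.pi * inner ℝ x η : ℝ) : ℂ) * Complex.I) *
        m.toFun ((2 * Real.pi) • η))
    ((m.compactSupport.comp_smul (by positivity)).mul_left)
    (by
      refine ContDiff.mul ?_ (m.smooth.comp (contDiff_const_smul _))
      refine ContDiff.cexp (ContDiff.mul ?_ contDiff_const)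
      refine Complex.ofRealCLM.contDiff.comp ?_
      exact contDiff_const.mul (contDiff_const.inner ℝ contDiff_id))

/-- The function `F⁻¹[m F f]`, where `F g(ξ) = (2π)^{-d/2} ∫ e^{-i x·ξ} g(x) dx`.
As `m F f` has compact support, it is the smooth function
`x ↦ (2π)^{-d/2} ⟨F f, m e^{i x·ξ}⟩`. Mathlib's Fourier transform has the phase `e^{-2πi x·η}`;
substituting `ξ = 2πη`, the value is the pairing of Mathlib's `𝓕 f` with
`η ↦ e^{2πi x·η} m(2πη)`, without further factors. -/
def multiplier {d : ℕ} (m : Symbol d) (f : 𝓢'(Rd d, ℂ)) (x : Rd d) : ℂ :=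
  (𝓕 f) (m.wave x)

/-- The `ℓ_q` quasi-norm of a family of complex numbers, `0 < q ≤ ∞`. -/
def lqNorm {ι : Type*} (q : ℝ≥0∞) (a : ι → ℂ) : ℝ≥0∞ :=
  if q = ⊤ then ⨆ i, ‖a i‖ₑ else (∑' i, ‖a i‖ₑ ^ q.toReal) ^ (1 / q.toReal)

/-- The `L_p(ℓ_q)` quasi-norm of a family of functions on `ℝ^d`. -/
def LpLqNorm {d : ℕ} {ι : Type*} (p q : ℝ≥0∞) (g : ι → Rd d → ℂ) : ℝ≥0∞ :=
  eLpNorm (fun x => lqNorm q fun i => g i x) p volume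

/-- Generators of the isotropic smooth dyadic decompositions of unity. -/
structure IsoGenerator (d : ℕ) where
  φ₀ : 𝓢(Rd d, ℝ)
  nonneg : ∀ x, 0 ≤ φ₀ x
  eq_one : ∀ x, ‖x‖ ≤ 1 → φ₀ x = 1
  eq_zero : ∀ x, 3 / 2 ≤ ‖x‖ → φ₀ x = 0

lemma IsoGenerator.smooth {d : ℕ} (Φ : IsoGenerator d) :
    ContDiff ℝ ∞ (fun x => (Φ.φ₀ x : ℂ)) :=
  Complex.ofRealCLM.contDiff.comp (Φ.φ₀.smooth ⊤)

lemma IsoGenerator.compactSupport {d : ℕ} (Φ : IsoGenerator d) :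
    HasCompactSupport (fun x => (Φ.φ₀ x : ℂ)) := by
  refine HasCompactSupport.intro (isCompact_closedBall (0 : Rd d) (3 / 2)) fun x hx => ?_
  have h : 3 / 2 ≤ ‖x‖ := by
    rw [mem_closedBall_zero_iff, not_le] at hx
    exact hx.le
  simp [Φ.eq_zero x h]

/-- The symbol `φ_j` of the isotropic decomposition. -/
def IsoGenerator.symbol {d : ℕ} (Φ : IsoGenerator d) (j : ℕ) : Symbol d where
  toFun := dyadic (fun x => (Φ.φ₀ x : ℂ)) j
  smooth := contDiff_dyadic Φ.smooth j
  compactSupport := hasCompactSupport_dyadic Φ.compactSupport j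

/-- Generators of the univariate smooth dyadic decompositions of unity. -/
structure MixedGenerator where
  φ₀ : ℝ → ℂ
  smooth : ContDiff ℝ ∞ φ₀
  eq_one : ∀ ξ ∈ Icc (-1 : ℝ) 1, φ₀ ξ = 1
  tsupport_subset : tsupport φ₀ ⊆ Icc (-(3 / 2)) (3 / 2)

lemma MixedGenerator.compactSupport (Φ : MixedGenerator) : HasCompactSupport Φ.φ₀ :=
  isCompact_Icc.of_isClosed_subset (isClosed_tsupport _) Φ.tsupport_subset

/-- The tensor product symbol `φ_k(x) = φ_{k_1}(x_1) ⋯ φ_{k_d}(x_d)`. -/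
def MixedGenerator.symbol {d : ℕ} (Φ : MixedGenerator) (k : Fin d → ℕ) : Symbol d where
  toFun x := ∏ i, dyadic Φ.φ₀ (k i) (x i)
  smooth := by
    refine contDiff_prod fun i _ => (contDiff_dyadic Φ.smooth (k i)).comp ?_
    exact (EuclideanSpace.proj (𝕜 := ℝ) i).contDiff
  compactSupport := by
    have hK : IsCompact (Set.pi univ fun i => tsupport (dyadic Φ.φ₀ (k i))) :=
      isCompact_univ_pi fun i => hasCompactSupport_dyadic Φ.compactSupport (k i)
    refine HasCompactSupport.intro
      (hK.image (EuclideanSpace.equiv (Fin d) ℝ).symm.continuous) fun x hx => ?_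
    by_contra hne
    refine hx ⟨EuclideanSpace.equiv (Fin d) ℝ x, fun i _ => ?_, by simp⟩
    exact subset_tsupport _ (Finset.prod_ne_zero_iff.mp hne i (Finset.mem_univ i))

/-- The quasi-norm of `F^t_{p,q}(ℝ^d)`, as an extended number for every tempered distribution. -/
def isoNorm {d : ℕ} (Φ : IsoGenerator d) (t : ℝ) (p q : ℝ≥0∞) (f : 𝓢'(Rd d, ℂ)) : ℝ≥0∞ :=
  LpLqNorm p q fun (j : ℕ) x => (((2 : ℝ) ^ ((j : ℝ) * t) : ℝ) : ℂ) * multiplier (Φ.symbol j) f x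

/-- The quasi-norm of `S^t_{p,q}F(ℝ^d)`, as an extended number for every tempered distribution. -/
def mixedNorm {d : ℕ} (Φ : MixedGenerator) (t : ℝ) (p q : ℝ≥0∞) (f : 𝓢'(Rd d, ℂ)) : ℝ≥0∞ :=
  LpLqNorm p q fun (k : Fin d → ℕ) x =>
    (((2 : ℝ) ^ (((∑ i, k i : ℕ) : ℝ) * t) : ℝ) : ℂ) * multiplier (Φ.symbol k) f x

/-- The space of all `f` for which an extended quasi-norm is finite: with `isoNorm` this is
`F^t_{p,q}(ℝ^d)`, with `mixedNorm` it is `S^t_{p,q}F(ℝ^d)`. -/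
def finiteSpace {X : Type*} (N : X → ℝ≥0∞) : Set X := {f | N f < ⊤}

/-- The continuous embedding `↪` of the space of `N₁` into the space of `N₂`: it is contained
in it and the inclusion is bounded. -/
def Embeds {X : Type*} (N₁ N₂ : X → ℝ≥0∞) : Prop :=
  finiteSpace N₁ ⊆ finiteSpace N₂ ∧ ∃ C : ℝ≥0, ∀ f ∈ finiteSpace N₁, N₂ f ≤ C * N₁ f

/-- Neither space is contained in the other, so in particular neither embeds into the other. -/
def NotComparable {X : Type*} (N₁ N₂ : X → ℝ≥0∞) : Prop :=
  ¬ finiteSpace N₁ ⊆ finiteSpace N₂ ∧ ¬ finiteSpace N₂ ⊆ finiteSpace N₁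

end LizorkinTriebel

end

namespace LizorkinTriebel

/-! ### The one-dimensional maximal inequality -/

/-- The points at which some centred average of `h` exceeds `c`. -/
def largeAverage (h : ℝ → ℝ≥0∞) (c : ℝ≥0∞) : Set ℝ :=
  {x | ∃ r : ℝ, 0 < r ∧ c * volume (Metric.closedBall x r) < ∫⁻ z in Metric.closedBall x r, h z}

lemma volume_largeAverage_le {h : ℝ → ℝ≥0∞} (c : ℝ≥0∞) (hc : c ≠ 0) (hc' : c ≠ ⊤) :
    c * volume (largeAverage h c) ≤ 5 * ∫⁻ z, h z := by
  by_cases hfin : ∫⁻ z, h z = ⊤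
  · simp [hfin]
  choose! r hr0 hr using fun x (hx : x ∈ largeAverage h c) => hx
  have hbound : ∀ x ∈ largeAverage h c, r x ≤ ((∫⁻ z, h z) / c).toReal := by
    intro x hx
    have h1 : c * ENNReal.ofReal (2 * r x) ≤ ∫⁻ z, h z := by
      rw [← Real.volume_closedBall x]
      exact (hr x hx).le.trans (setLIntegral_le_lintegral _ _)
    have h2 : ENNReal.ofReal (2 * r x) ≤ (∫⁻ z, h z) / c := by
      rw [ENNReal.le_div_iff_mul_le (Or.inl hc) (Or.inl hc'), mul_comm]
      exact h1
    have h3 : 2 * r x ≤ ((∫⁻ z, h z) / c).toReal :=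
      (ENNReal.ofReal_le_iff_le_toReal (ENNReal.div_ne_top hfin hc)).1 h2
    linarith [hr0 x hx]
  obtain ⟨u, hu, hdisj, hcov⟩ := Vitali.exists_disjoint_subfamily_covering_enlargement_closedBall
    (largeAverage h c) (fun x => x) r _ hbound 5 (by norm_num)
  have hcount : u.Countable := by
    refine hdisj.countable_of_nonempty_interior fun x hx => ?_
    exact ⟨x, Metric.ball_subset_interior_closedBall (Metric.mem_ball_self (hr0 x (hu hx)))⟩
  have hsub : largeAverage h c ⊆ ⋃ b ∈ u, Metric.closedBall b (5 * r b) := by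
    intro x hx
    obtain ⟨b, hb, hxb⟩ := hcov x hx
    exact mem_biUnion hb (hxb (Metric.mem_closedBall_self (hr0 x hx).le))
  have hvol : ∀ b, volume (Metric.closedBall b (5 * r b)) =
      5 * volume (Metric.closedBall b (r b)) := by
    intro b
    rw [Real.volume_closedBall, Real.volume_closedBall, show 2 * (5 * r b) = 5 * (2 * r b) by ring,
      ENNReal.ofReal_mul (by norm_num)]
    norm_num
  have := hcount.to_subtype
  calc c * volume (largeAverage h c)
      ≤ c * ∑' b : u, volume (Metric.closedBall (b : ℝ) (5 * r b)) := by
        gcongr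
        refine (measure_mono hsub).trans ?_
        rw [biUnion_eq_iUnion]
        exact measure_iUnion_le _
    _ = 5 * ∑' b : u, c * volume (Metric.closedBall (b : ℝ) (r b)) := by
        simp_rw [hvol, ENNReal.tsum_mul_left]
        ring
    _ ≤ 5 * ∑' b : u, ∫⁻ z in Metric.closedBall (b : ℝ) (r b), h z := by
        gcongr with b
        exact (hr b (hu b.2)).le
    _ = 5 * ∫⁻ z in ⋃ b ∈ u, Metric.closedBall b (r b), h z := by
        rw [lintegral_biUnion hcount (fun b _ => Metric.isClosed_closedBall.measurableSet) hdisj]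
    _ ≤ 5 * ∫⁻ z, h z := by
        gcongr
        exact Measure.restrict_le_self

/-- The dyadic dilates `2^k (1 + (2^k s)²)⁻¹` of an integrable kernel. -/
noncomputable def bellKernel (k : ℕ) (s : ℝ) : ℝ≥0∞ :=
  ENNReal.ofReal (2 ^ k / (1 + (2 ^ k * s) ^ 2))

lemma measurable_bellKernel (k : ℕ) : Measurable (bellKernel k) := by
  unfold bellKernel
  fun_prop

lemma bellKernel_neg (k : ℕ) (s : ℝ) : bellKernel k (-s) = bellKernel k s := by
  simp [bellKernel]

lemma bellKernel_le_tsum (k : ℕ) (x z : ℝ) :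
    bellKernel k (x - z) ≤ ∑' l : ℕ, ENNReal.ofReal (4 * 2 ^ k / 4 ^ l) *
      (Metric.closedBall x (2 ^ l / 2 ^ k)).indicator 1 z := by
  have hex : ∃ l : ℕ, 2 ^ k * |x - z| ≤ 2 ^ l := by
    obtain ⟨l, hl⟩ := pow_unbounded_of_one_lt (2 ^ k * |x - z|) (one_lt_two : (1 : ℝ) < 2)
    exact ⟨l, hl.le⟩
  classical
  let l := Nat.find hex
  have hl : 2 ^ k * |x - z| ≤ 2 ^ l := Nat.find_spec hex
  refine le_trans ?_ (ENNReal.le_tsum l)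
  have hz : z ∈ Metric.closedBall x (2 ^ l / 2 ^ k) := by
    rw [Metric.mem_closedBall, dist_comm, Real.dist_eq, le_div_iff₀ (by positivity)]
    linarith
  rw [indicator_of_mem hz, Pi.one_apply, mul_one]
  refine ENNReal.ofReal_le_ofReal ?_
  rw [div_le_div_iff₀ (by positivity) (by positivity)]
  have hk : (0 : ℝ) < 2 ^ k := by positivity
  have key : (4 : ℝ) ^ l ≤ 4 * (1 + (2 ^ k * (x - z)) ^ 2) := by
    rcases Nat.eq_zero_or_pos l with h0 | h0
    · rw [h0]
      nlinarith [sq_nonneg (2 ^ k * (x - z))]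
    · have hlt : (2 : ℝ) ^ (l - 1) < 2 ^ k * |x - z| :=
        not_le.1 (Nat.find_min hex (Nat.sub_lt h0 one_pos))
      have h4 : (4 : ℝ) ^ l = 4 * (2 ^ (l - 1)) ^ 2 := by
        obtain ⟨n, hn⟩ := Nat.exists_eq_add_of_lt h0
        rw [hn]
        simp only [zero_add, Nat.add_sub_cancel]
        rw [← pow_mul, mul_comm n 2, pow_mul, pow_succ]
        norm_num
        ring
      have hsq : ((2 : ℝ) ^ (l - 1)) ^ 2 ≤ (2 ^ k * |x - z|) ^ 2 := by gcongr
      rw [mul_pow, sq_abs, ← mul_pow] at hsq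
      rw [h4]
      linarith
  nlinarith

lemma lintegral_bellKernel_mul_le {h : ℝ → ℝ≥0∞} (hh : Measurable h) {c : ℝ≥0∞} {x : ℝ}
    (hx : x ∉ largeAverage h c) (k : ℕ) :
    ∫⁻ z, bellKernel k (x - z) * h z ≤ 16 * c := by
  have havg : ∀ r : ℝ, 0 < r → ∫⁻ z in Metric.closedBall x r, h z ≤ c * ENNReal.ofReal (2 * r) := by
    intro r hr
    rw [← Real.volume_closedBall x]
    exact not_lt.1 fun hlt => hx ⟨r, hr, hlt⟩
  calc ∫⁻ z, bellKernel k (x - z) * h z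
      ≤ ∫⁻ z, ∑' l : ℕ, ENNReal.ofReal (4 * 2 ^ k / 4 ^ l) *
          (Metric.closedBall x (2 ^ l / 2 ^ k)).indicator h z := by
        refine lintegral_mono fun z => ?_
        refine (mul_le_mul_left (bellKernel_le_tsum k x z) (h z)).trans_eq ?_
        rw [← ENNReal.tsum_mul_right]
        refine tsum_congr fun l => ?_
        rw [mul_assoc]
        congr 1
        by_cases hz : z ∈ Metric.closedBall x (2 ^ l / 2 ^ k) <;> simp [hz]
    _ = ∑' l : ℕ, ENNReal.ofReal (4 * 2 ^ k / 4 ^ l) *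
          ∫⁻ z in Metric.closedBall x (2 ^ l / 2 ^ k), h z := by
        rw [lintegral_tsum fun l =>
          ((hh.indicator Metric.isClosed_closedBall.measurableSet).const_mul _).aemeasurable]
        refine tsum_congr fun l => ?_
        rw [lintegral_const_mul _ (hh.indicator Metric.isClosed_closedBall.measurableSet),
          lintegral_indicator Metric.isClosed_closedBall.measurableSet]
    _ ≤ ∑' l : ℕ, ENNReal.ofReal (4 * 2 ^ k / 4 ^ l) *
          (c * ENNReal.ofReal (2 * (2 ^ l / 2 ^ k))) := by
        gcongr with l
        exact havg _ (by positivity)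
    _ = ∑' l : ℕ, (8 * c) * (2⁻¹ : ℝ≥0∞) ^ l := by
        refine tsum_congr fun l => ?_
        have : ENNReal.ofReal (4 * 2 ^ k / 4 ^ l) * ENNReal.ofReal (2 * (2 ^ l / 2 ^ k)) =
            8 * (2⁻¹ : ℝ≥0∞) ^ l := by
          rw [← ENNReal.ofReal_mul (by positivity)]
          have h2 : (4 * 2 ^ k / 4 ^ l * (2 * (2 ^ l / 2 ^ k)) : ℝ) = 8 * (2⁻¹) ^ l := by
            have : (4 : ℝ) ^ l = 2 ^ l * 2 ^ l := by rw [← mul_pow]; norm_num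
            rw [this, inv_pow]
            field_simp
            norm_num
          rw [h2, ENNReal.ofReal_mul (by norm_num), ENNReal.ofReal_pow (by norm_num),
            ENNReal.ofReal_inv_of_pos (by norm_num)]
          norm_num
        rw [mul_left_comm, this]
        ring
    _ = 16 * c := by
        rw [ENNReal.tsum_mul_left, ENNReal.tsum_geometric, ENNReal.one_sub_inv_two, inv_inv]
        ring

/-- The maximal operator attached to the kernels `bellKernel`. -/
noncomputable def bellMax (h : ℝ → ℝ≥0∞) (x : ℝ) : ℝ≥0∞ :=
  ⨆ k, ∫⁻ z, bellKernel k (x - z) * h z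

lemma volume_lt_bellMax_le {h : ℝ → ℝ≥0∞} (hh : Measurable h) (c : ℝ≥0∞) (hc : c ≠ 0)
    (hc' : c ≠ ⊤) :
    c * volume {x | 32 * c < bellMax h x} ≤ 5 * ∫⁻ z in {z | c < h z}, h z := by
  have hms : MeasurableSet {z | c < h z} := measurableSet_lt measurable_const hh
  rw [← lintegral_indicator hms]
  refine le_trans ?_ (volume_largeAverage_le c hc hc')
  gcongr
  intro x hx
  have hx1 : x ∈ largeAverage h (2 * c) := by
    by_contra hcon
    have : bellMax h x ≤ 32 * c := by
      refine iSup_le fun k => (lintegral_bellKernel_mul_le hh hcon k).trans_eq ?_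
      rw [← mul_assoc]
      norm_num
    exact absurd hx (not_lt.2 this)
  obtain ⟨r, hr0, hr⟩ := hx1
  refine ⟨r, hr0, ?_⟩
  by_contra hcon
  rw [not_lt] at hcon
  have hle : ∀ z, h z ≤ {z | c < h z}.indicator h z + c := by
    intro z
    by_cases hz : c < h z
    · have hz' : z ∈ {z | c < h z} := hz
      rw [indicator_of_mem hz']
      exact le_self_add
    · exact (not_lt.1 hz).trans le_add_self
  have : ∫⁻ z in Metric.closedBall x r, h z ≤ 2 * c * volume (Metric.closedBall x r) := by
    calc ∫⁻ z in Metric.closedBall x r, h z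
        ≤ ∫⁻ z in Metric.closedBall x r, ({z | c < h z}.indicator h z + c) :=
          lintegral_mono fun z => hle z
      _ ≤ c * volume (Metric.closedBall x r) + c * volume (Metric.closedBall x r) := by
          rw [lintegral_add_right _ measurable_const, setLIntegral_const]
          gcongr
      _ = _ := by ring
  exact absurd hr (not_lt.2 this)

lemma measurable_bellMax {h : ℝ → ℝ≥0∞} (hh : Measurable h) : Measurable (bellMax h) := by
  refine Measurable.iSup fun k => ?_
  refine Measurable.lintegral_prod_right' (f := fun p : ℝ × ℝ => bellKernel k (p.1 - p.2) * h p.2) ?_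
  exact ((measurable_bellKernel k).comp (measurable_fst.sub measurable_snd)).mul
    (hh.comp measurable_snd)

/-- The layer cake formula for a power of an extended nonnegative number. -/
lemma lintegral_rpow_sub_one_eq {s : ℝ} (hs : 0 < s) (u : ℝ≥0∞) :
    ∫⁻ l in Ioi (0 : ℝ), {l : ℝ | ENNReal.ofReal l < u}.indicator
      (fun l => ENNReal.ofReal (l ^ (s - 1))) l = u ^ s / ENNReal.ofReal s := by
  have hfin : ∀ v : ℝ, 0 ≤ v → ∫⁻ l in Ioi (0 : ℝ), {l : ℝ | l < v}.indicator
      (fun l => ENNReal.ofReal (l ^ (s - 1))) l = ENNReal.ofReal v ^ s / ENNReal.ofReal s := by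
    intro v hv
    have hms : MeasurableSet {l : ℝ | l < v} := measurableSet_Iio
    rw [lintegral_indicator hms, Measure.restrict_restrict hms]
    have hset : {l : ℝ | l < v} ∩ Ioi 0 = Ioo 0 v := by
      ext l; simp [and_comm]
    rw [hset, Measure.restrict_congr_set Ioo_ae_eq_Ioc, ENNReal.ofReal_rpow_of_nonneg hv hs.le,
      ← ENNReal.ofReal_div_of_pos hs]
    have hInteg : IntervalIntegrable (fun l : ℝ => l ^ (s - 1)) volume 0 v :=
      intervalIntegral.intervalIntegrable_rpow' (by linarith)
    rw [intervalIntegrable_iff_integrableOn_Ioc_of_le hv] at hInteg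
    rw [← ofReal_integral_eq_lintegral_ofReal hInteg]
    · rw [← intervalIntegral.integral_of_le hv, integral_rpow (Or.inl (by linarith))]
      simp [Real.zero_rpow hs.ne']
    · filter_upwards [ae_restrict_mem measurableSet_Ioc] with l hl
      exact Real.rpow_nonneg hl.1.le _
  by_cases hu : u = ⊤
  · subst hu
    rw [ENNReal.top_rpow_of_pos hs, ENNReal.top_div_of_ne_top ENNReal.ofReal_ne_top]
    refine ENNReal.eq_top_of_forall_nnreal_le fun r => ?_
    have hv := hfin ((r * s) ^ s⁻¹) (by positivity)
    rw [ENNReal.ofReal_rpow_of_nonneg (by positivity) hs.le, ← Real.rpow_mul (by positivity),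
      inv_mul_cancel₀ hs.ne', Real.rpow_one, ← ENNReal.ofReal_div_of_pos hs,
      mul_div_cancel_right₀ _ hs.ne', ENNReal.ofReal_coe_nnreal] at hv
    rw [← hv]
    refine lintegral_mono fun l => ?_
    refine indicator_le_indicator_of_subset (fun l _ => ?_) (fun _ => zero_le) l
    exact ENNReal.ofReal_lt_top
  · have h1 := hfin u.toReal ENNReal.toReal_nonneg
    rw [ENNReal.ofReal_toReal hu] at h1
    rw [← h1]
    refine setLIntegral_congr_fun measurableSet_Ioi fun l hl => ?_
    have : ENNReal.ofReal l < u ↔ l < u.toReal := ENNReal.ofReal_lt_iff_lt_toReal (le_of_lt hl) hu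
    simp only [indicator, mem_ofPred_eq, this]

lemma lintegral_rpow_eq_layer {α : Type*} [MeasurableSpace α] {μ : Measure α} [SFinite μ]
    {s : ℝ} (hs : 0 < s) {g w : α → ℝ≥0∞} (hg : Measurable g) (hw : Measurable w) :
    ∫⁻ x, w x * g x ^ s ∂μ = ENNReal.ofReal s * ∫⁻ l in Ioi (0 : ℝ),
      ENNReal.ofReal (l ^ (s - 1)) * ∫⁻ x in {x | ENNReal.ofReal l < g x}, w x ∂μ := by
  have hs0 : ENNReal.ofReal s ≠ 0 := by simpa using hs
  have hset : MeasurableSet {p : α × ℝ | ENNReal.ofReal p.2 < g p.1} :=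
    measurableSet_lt (ENNReal.measurable_ofReal.comp measurable_snd) (hg.comp measurable_fst)
  have hmeas : Measurable fun p : α × ℝ => w p.1 * {p : α × ℝ | ENNReal.ofReal p.2 < g p.1}.indicator
      (fun p => ENNReal.ofReal (p.2 ^ (s - 1))) p := by
    refine (hw.comp measurable_fst).mul (Measurable.indicator ?_ hset)
    fun_prop
  have h1 : ∀ x, w x * g x ^ s = ENNReal.ofReal s * ∫⁻ l in Ioi (0 : ℝ),
      w x * {l : ℝ | ENNReal.ofReal l < g x}.indicator (fun l => ENNReal.ofReal (l ^ (s - 1))) l := by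
    intro x
    rw [lintegral_const_mul _ (Measurable.indicator (by fun_prop)
      (measurableSet_lt ENNReal.measurable_ofReal measurable_const)), lintegral_rpow_sub_one_eq hs,
      mul_left_comm, ENNReal.mul_div_cancel hs0 ENNReal.ofReal_ne_top]
  simp_rw [h1]
  rw [lintegral_const_mul]
  · congr 1
    rw [lintegral_lintegral_swap]
    · refine lintegral_congr fun l => ?_
      rw [← lintegral_const_mul _ hw, ← lintegral_indicator (measurableSet_lt measurable_const hg)]
      refine lintegral_congr fun x => ?_
      by_cases hx : ENNReal.ofReal l < g x
      · simp [indicator, hx, mul_comm]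
      · simp [indicator, hx]
    · exact hmeas.aemeasurable
  · exact Measurable.lintegral_prod_right' hmeas

/-- The constant of the one-dimensional maximal inequality. -/
noncomputable def bellMaxConst (p : ℝ) : ℝ≥0∞ :=
  ENNReal.ofReal p * (160 * (ENNReal.ofReal (p - 1))⁻¹ * 32 ^ (p - 1))

lemma bellMaxConst_ne_top {p : ℝ} (hp : 1 < p) : bellMaxConst p ≠ ⊤ := by
  unfold bellMaxConst
  have : (ENNReal.ofReal (p - 1))⁻¹ ≠ ⊤ := by simpa using hp
  have h2 : (32 : ℝ≥0∞) ^ (p - 1) ≠ ⊤ := ENNReal.rpow_ne_top_of_nonneg (by linarith) (by norm_num)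
  exact ENNReal.mul_ne_top ENNReal.ofReal_ne_top
    (ENNReal.mul_ne_top (ENNReal.mul_ne_top (by norm_num) this) h2)

theorem lintegral_bellMax_rpow_le {p : ℝ} (hp : 1 < p) {h : ℝ → ℝ≥0∞} (hh : Measurable h) :
    ∫⁻ x, bellMax h x ^ p ≤ bellMaxConst p * ∫⁻ x, h x ^ p := by
  have hp0 : 0 < p := by linarith
  have hp1 : 0 < p - 1 := by linarith
  have hL := lintegral_rpow_eq_layer (μ := (volume : Measure ℝ)) hp0 (measurable_bellMax hh)
    (measurable_const (a := (1 : ℝ≥0∞)))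
  simp only [one_mul, setLIntegral_one] at hL
  have hR := lintegral_rpow_eq_layer (μ := (volume : Measure ℝ)) hp1 (hh.const_mul 32) hh
  rw [hL, bellMaxConst, mul_assoc]
  gcongr
  have hpt : ∀ l ∈ Ioi (0 : ℝ), ENNReal.ofReal (l ^ (p - 1)) *
      volume {x | ENNReal.ofReal l < bellMax h x} ≤
      160 * (ENNReal.ofReal (l ^ (p - 1 - 1)) * ∫⁻ x in {x | ENNReal.ofReal l < 32 * h x}, h x) := by
    intro l hl
    have hl0 : (0 : ℝ) < l := hl
    have hc : ENNReal.ofReal (l / 32) ≠ 0 := by simpa using hl0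
    have hl32 : (32 : ℝ≥0∞) * ENNReal.ofReal (l / 32) = ENNReal.ofReal l := by
      rw [show l = 32 * (l / 32) by ring, ENNReal.ofReal_mul (by norm_num)]
      norm_num
    have hweak := volume_lt_bellMax_le hh (ENNReal.ofReal (l / 32)) hc ENNReal.ofReal_ne_top
    rw [hl32] at hweak
    have hset : {z | ENNReal.ofReal (l / 32) < h z} = {z | ENNReal.ofReal l < 32 * h z} := by
      ext z
      simp only [mem_ofPred_eq]
      rw [← hl32, ENNReal.mul_lt_mul_iff_right (by norm_num) (by norm_num)]
    rw [hset] at hweak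
    have hpow : ENNReal.ofReal (l ^ (p - 1)) =
        ENNReal.ofReal (l ^ (p - 1 - 1)) * (32 * ENNReal.ofReal (l / 32)) := by
      rw [hl32, ← ENNReal.ofReal_mul (by positivity), Real.rpow_sub_one hl0.ne' (p - 1)]
      congr 1
      field_simp
    calc _ = ENNReal.ofReal (l ^ (p - 1 - 1)) * 32 * (ENNReal.ofReal (l / 32) *
          volume {x | ENNReal.ofReal l < bellMax h x}) := by rw [hpow]; ring
      _ ≤ ENNReal.ofReal (l ^ (p - 1 - 1)) * 32 *
          (5 * ∫⁻ x in {x | ENNReal.ofReal l < 32 * h x}, h x) := by gcongr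
      _ = _ := by ring
  calc ∫⁻ l in Ioi (0 : ℝ), ENNReal.ofReal (l ^ (p - 1)) *
        volume {x | ENNReal.ofReal l < bellMax h x}
      ≤ ∫⁻ l in Ioi (0 : ℝ), 160 * (ENNReal.ofReal (l ^ (p - 1 - 1)) *
          ∫⁻ x in {x | ENNReal.ofReal l < 32 * h x}, h x) :=
        setLIntegral_mono' measurableSet_Ioi hpt
    _ = 160 * ∫⁻ l in Ioi (0 : ℝ), (ENNReal.ofReal (l ^ (p - 1 - 1)) *
          ∫⁻ x in {x | ENNReal.ofReal l < 32 * h x}, h x) :=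
        lintegral_const_mul' _ _ (by norm_num)
    _ = 160 * ((ENNReal.ofReal (p - 1))⁻¹ * ∫⁻ x, h x * (32 * h x) ^ (p - 1)) := by
        rw [hR, ← mul_assoc (ENNReal.ofReal (p - 1))⁻¹, ENNReal.inv_mul_cancel (by simpa using hp)
          ENNReal.ofReal_ne_top, one_mul]
    _ = 160 * ((ENNReal.ofReal (p - 1))⁻¹ * ∫⁻ x, 32 ^ (p - 1) * h x ^ p) := by
        congr 2
        refine lintegral_congr fun x => ?_
        rw [ENNReal.mul_rpow_of_nonneg _ _ hp1.le, mul_left_comm]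
        congr 1
        nth_rewrite 1 [← ENNReal.rpow_one (h x)]
        rw [← ENNReal.rpow_add_of_nonneg _ _ (by norm_num) hp1.le]
        congr 1
        ring
    _ = _ := by
        rw [lintegral_const_mul _ (hh.pow_const p)]
        ring

end LizorkinTriebel


namespace LizorkinTriebel

/-! ### The strong maximal inequality -/

section StrongMaximal

variable {ι : Type*} [DecidableEq ι]

/-- The maximal operator `bellMax` in the direction of a coordinate. -/
noncomputable def dirMax (i : ι) (h : (ι → ℝ) → ℝ≥0∞) (x : ι → ℝ) : ℝ≥0∞ :=
  bellMax (fun z => h (Function.update x i z)) (x i)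

lemma measurable_dirMax (i : ι) {h : (ι → ℝ) → ℝ≥0∞} (hh : Measurable h) :
    Measurable (dirMax i h) := by
  refine Measurable.iSup fun k => ?_
  refine Measurable.lintegral_prod_right'
    (f := fun p : (ι → ℝ) × ℝ => bellKernel k (p.1 i - p.2) * h (Function.update p.1 i p.2)) ?_
  refine ((measurable_bellKernel k).comp ?_).mul (hh.comp measurable_update')
  exact ((measurable_pi_apply i).comp measurable_fst).sub measurable_snd

lemma lintegral_dirMax_rpow_le [Fintype ι] {p : ℝ} (hp : 1 < p) (i : ι) {h : (ι → ℝ) → ℝ≥0∞}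
    (hh : Measurable h) : ∫⁻ x, dirMax i h x ^ p ≤ bellMaxConst p * ∫⁻ x, h x ^ p := by
  rw [← lintegral_const_mul _ (hh.pow_const p)]
  refine lintegral_le_of_lmarginal_le (μ := fun _ : ι => (volume : Measure ℝ)) {i}
    ((measurable_dirMax i hh).pow_const p) ((hh.pow_const p).const_mul _) fun x => ?_
  rw [lmarginal_singleton, lmarginal_singleton]
  simp only [dirMax, Function.update_idem, Function.update_self]
  have hm : Measurable fun z => h (Function.update x i z) := hh.comp (measurable_update x)
  rw [lintegral_const_mul _ (hm.pow_const p)]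
  exact lintegral_bellMax_rpow_le hp hm

/-- For every finite set of coordinates there is a maximal operator, bounded on `L_p` for
`1 < p < ∞`, which dominates all averages against products of the kernels `bellKernel`. -/
lemma exists_strongMax [Fintype ι] (s : Finset ι) :
    ∃ N : ((ι → ℝ) → ℝ≥0∞) → (ι → ℝ) → ℝ≥0∞,
      (∀ h, Measurable h → Measurable (N h)) ∧
      (∀ p : ℝ, 1 < p → ∀ h, Measurable h →
        ∫⁻ x, N h x ^ p ≤ bellMaxConst p ^ s.card * ∫⁻ x, h x ^ p) ∧
      ∀ (k : ι → ℕ) h, Measurable h → ∀ x,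
        lmarginal (fun _ : ι => (volume : Measure ℝ)) s
          (fun z => (∏ i ∈ s, bellKernel (k i) (x i - z i)) * h z) x ≤ N h x := by
  induction s using Finset.induction_on with
  | empty => exact ⟨id, fun h hh => hh, fun p _ h _ => by simp, fun k h _ x => by simp⟩
  | insert i s hi ih =>
    obtain ⟨N, hNm, hNp, hNk⟩ := ih
    refine ⟨fun h => dirMax i (N h), fun h hh => measurable_dirMax i (hNm h hh), ?_, ?_⟩
    · intro p hp h hh
      refine (lintegral_dirMax_rpow_le hp i (hNm h hh)).trans ?_
      rw [Finset.card_insert_of_notMem hi, pow_succ', mul_assoc]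
      gcongr
      exact hNp p hp h hh
    · intro k h hh x
      have hm : ∀ (t : Finset ι) (y : ι → ℝ),
          Measurable fun z : ι → ℝ => ∏ l ∈ t, bellKernel (k l) (y l - z l) := fun t y =>
        Finset.measurable_prod _ fun l _ => (measurable_bellKernel _).comp
          (measurable_const.sub (measurable_pi_apply l))
      have hm' : Measurable fun z : ι → ℝ =>
          (∏ l ∈ insert i s, bellKernel (k l) (x l - z l)) * h z := (hm _ x).mul hh
      rw [lmarginal_insert _ hm' hi]
      refine le_trans (lintegral_mono fun t => ?_) (le_iSup (fun n => ∫⁻ z, bellKernel n (x i - z) *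
        N h (Function.update x i z)) (k i))
      refine le_trans (le_of_eq ?_) (mul_le_mul_right (hNk k h hh (Function.update x i t)) _)
      unfold lmarginal
      rw [← lintegral_const_mul]
      · refine lintegral_congr fun y => ?_
        have h1 : Function.updateFinset (Function.update x i t) s y i = t := by
          simp [Function.updateFinset, hi]
        beta_reduce
        rw [Finset.prod_insert hi, h1, mul_assoc]
        congr 2
        refine Finset.prod_congr rfl fun l hl => ?_
        rw [Function.update_of_ne (ne_of_mem_of_not_mem hl hi)]
      · exact ((hm s _).mul hh).comp measurable_updateFinset

end StrongMaximal

/-! ### Vector-valued inequalities for positive integral operators -/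

section VectorValued

variable {X : Type*} [MeasurableSpace X] {μ : Measure X} {I : Type*}

lemma le_rpow_of_le_mul_rpow {p p' : ℝ} (hpp : p.HolderConjugate p') {x a : ℝ≥0∞} (hx : x ≠ ⊤)
    (h : x ≤ a * x ^ (1 / p')) : x ≤ a ^ p := by
  rcases eq_or_ne x 0 with rfl | hx0
  · exact zero_le
  have h1 : x ^ (1 / p) * x ^ (1 / p') = x := by
    rw [← ENNReal.rpow_add _ _ hx0 hx, one_div, one_div, hpp.inv_add_inv_eq_one, ENNReal.rpow_one]
  have h2 : x ^ (1 / p) ≤ a := by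
    have h3 : x ^ (1 / p) * x ^ (1 / p') ≤ a * x ^ (1 / p') := h1.trans_le h
    have h4 : 0 < x ^ (1 / p') := ENNReal.rpow_pos (pos_iff_ne_zero.2 hx0) hx
    exact (ENNReal.mul_le_mul_iff_left h4.ne'
      (ENNReal.rpow_ne_top_of_nonneg (by have := hpp.symm.pos; positivity) hx)).1 h3
  calc x = (x ^ (1 / p)) ^ p := by
        rw [← ENNReal.rpow_mul, one_div, inv_mul_cancel₀ hpp.ne_zero, ENNReal.rpow_one]
    _ ≤ a ^ p := ENNReal.rpow_le_rpow h2 hpp.nonneg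

/-- The operator with kernel `κ`. -/
noncomputable def kernelOp (μ : Measure X) (κ : X → X → ℝ≥0∞) (h : X → ℝ≥0∞) (x : X) : ℝ≥0∞ :=
  ∫⁻ z, κ x z * h z ∂μ

lemma measurable_kernelOp [SFinite μ] {κ : X → X → ℝ≥0∞} (hκ : Measurable (Function.uncurry κ))
    {h : X → ℝ≥0∞} (hh : Measurable h) : Measurable (kernelOp μ κ h) :=
  Measurable.lintegral_prod_right' (f := fun p : X × X => κ p.1 p.2 * h p.2)
    (hκ.mul (hh.comp measurable_snd))

lemma lintegral_kernelOp_mul [SFinite μ] {κ : X → X → ℝ≥0∞} (hκ : Measurable (Function.uncurry κ))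
    (hsym : ∀ x z, κ x z = κ z x) {a h : X → ℝ≥0∞} (ha : Measurable a) (hh : Measurable h) :
    ∫⁻ x, kernelOp μ κ a x * h x ∂μ = ∫⁻ x, a x * kernelOp μ κ h x ∂μ := by
  have hκ1 : ∀ x, Measurable (κ x) := fun x => hκ.comp measurable_prodMk_left
  have h1 : ∀ x, kernelOp μ κ a x * h x = ∫⁻ z, κ x z * a z * h x ∂μ := fun x =>
    (lintegral_mul_const _ ((hκ1 x).mul ha)).symm
  have h2 : ∀ x, a x * kernelOp μ κ h x = ∫⁻ z, a x * (κ x z * h z) ∂μ := fun x =>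
    (lintegral_const_mul _ ((hκ1 x).mul hh)).symm
  simp_rw [h1, h2]
  rw [lintegral_lintegral_swap]
  · refine lintegral_congr fun x => lintegral_congr fun z => ?_
    rw [hsym z x]
    ring
  · exact ((hκ.mul (ha.comp measurable_snd)).mul (hh.comp measurable_fst)).aemeasurable

/-- A family of symmetric kernels dominated by an operator that is bounded on `L_p` for all
`1 < p < ∞`. -/
structure IsDominated (μ : Measure X) (κ : I → X → X → ℝ≥0∞) (N : (X → ℝ≥0∞) → X → ℝ≥0∞)
    (C : ℝ → ℝ≥0∞) : Prop where
  measurable_kernel : ∀ j, Measurable (Function.uncurry (κ j))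
  symm : ∀ j x z, κ j x z = κ j z x
  measurable_op : ∀ h, Measurable h → Measurable (N h)
  le_op : ∀ j h, Measurable h → ∀ x, kernelOp μ (κ j) h x ≤ N h x
  bound : ∀ p : ℝ, 1 < p → ∀ h, Measurable h → ∫⁻ x, N h x ^ p ∂μ ≤ C p * ∫⁻ x, h x ^ p ∂μ

variable {κ : I → X → X → ℝ≥0∞} {N : (X → ℝ≥0∞) → X → ℝ≥0∞} {C : ℝ → ℝ≥0∞}

lemma IsDominated.lintegral_tsum_rpow_le [SigmaFinite μ] [Countable I] (H : IsDominated μ κ N C)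
    {p p' : ℝ} (hpp : p.HolderConjugate p') {a : I → X → ℝ≥0∞} (ha : ∀ j, Measurable (a j)) :
    ∫⁻ x, (∑' j, kernelOp μ (κ j) (a j) x) ^ p ∂μ ≤
      C p' ^ (p - 1) * ∫⁻ x, (∑' j, a j x) ^ p ∂μ := by
  have hp := hpp.lt
  set S : X → ℝ≥0∞ := fun x => ∑' j, kernelOp μ (κ j) (a j) x with hS
  set B : X → ℝ≥0∞ := fun x => ∑' j, a j x with hB
  have hAm : ∀ j, Measurable (kernelOp μ (κ j) (a j)) := fun j =>
    measurable_kernelOp (H.measurable_kernel j) (ha j)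
  have hSm : Measurable S := Measurable.tsum hAm
  have hBm : Measurable B := Measurable.tsum ha
  set T : ℕ → X → ℝ≥0∞ := fun n => (spanningSets μ n).indicator fun x => min (S x) n with hT
  have hTm : ∀ n, Measurable (T n) := fun n =>
    (hSm.min measurable_const).indicator (measurableSet_spanningSets μ n)
  have hTle : ∀ n x, T n x ≤ S x := fun n x =>
    (indicator_le_self _ _ x).trans (min_le_left _ _)
  have hmono : Monotone T := by
    intro n m hnm x
    refine (indicator_le_indicator_of_subset (monotone_spanningSets μ hnm)
      (fun _ => zero_le) x).trans ?_
    refine indicator_le_indicator ?_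
    exact min_le_min le_rfl (by exact_mod_cast hnm)
  have hsup : ∀ x, ⨆ n, T n x ^ p = S x ^ p := by
    intro x
    refine le_antisymm (iSup_le fun n => ENNReal.rpow_le_rpow (hTle n x) hpp.nonneg) ?_
    refine le_of_forall_lt fun c hc => ?_
    have hc1 : c ^ (1 / p) < S x := by
      rw [one_div, ENNReal.rpow_inv_lt_iff hpp.pos]
      exact hc
    obtain ⟨n, hn⟩ := ENNReal.exists_nat_gt hc1.ne_top
    have hmem : x ∈ spanningSets μ (max n (spanningSetsIndex μ x)) :=
      monotone_spanningSets μ (le_max_right _ _) (mem_spanningSetsIndex μ x)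
    refine lt_of_lt_of_le ?_ (le_iSup _ (max n (spanningSetsIndex μ x)))
    rw [← ENNReal.rpow_inv_lt_iff hpp.pos, ← one_div]
    simp only [hT, indicator_of_mem hmem]
    refine lt_min hc1 (hn.trans_le ?_)
    exact_mod_cast le_max_left _ _
  have hlim : ∫⁻ x, S x ^ p ∂μ = ⨆ n, ∫⁻ x, T n x ^ p ∂μ := by
    rw [← lintegral_iSup (fun n => (hTm n).pow_const p)
      (fun n m hnm x => ENNReal.rpow_le_rpow (hmono hnm x) hpp.nonneg)]
    simp_rw [hsup]
  rw [hlim]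
  refine iSup_le fun n => ?_
  have hfin : ∫⁻ x, T n x ^ p ∂μ ≠ ⊤ := by
    have hle : ∀ x, T n x ^ p ≤ (spanningSets μ n).indicator (fun _ => (n : ℝ≥0∞) ^ p) x := by
      intro x
      by_cases hx : x ∈ spanningSets μ n
      · simp only [hT, indicator_of_mem hx]
        exact ENNReal.rpow_le_rpow (min_le_right _ _) hpp.nonneg
      · simp [hT, indicator_of_notMem hx, hpp.pos]
    refine ne_top_of_le_ne_top ?_ (lintegral_mono hle)
    rw [lintegral_indicator_const (measurableSet_spanningSets μ n)]
    exact ENNReal.mul_ne_top (ENNReal.rpow_ne_top_of_nonneg hpp.nonneg (by simp))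
      (measure_spanningSets_lt_top μ n).ne
  have hhm : Measurable fun x => T n x ^ (p - 1) := (hTm n).pow_const _
  have key : ∫⁻ x, T n x ^ p ∂μ ≤
      (∫⁻ x, B x ^ p ∂μ) ^ (1 / p) * C p' ^ (1 / p') * (∫⁻ x, T n x ^ p ∂μ) ^ (1 / p') := by
    calc ∫⁻ x, T n x ^ p ∂μ ≤ ∫⁻ x, S x * T n x ^ (p - 1) ∂μ := by
          refine lintegral_mono fun x => ?_
          calc T n x ^ p = T n x ^ (1 : ℝ) * T n x ^ (p - 1) := by
                rw [← ENNReal.rpow_add_of_nonneg _ _ zero_le_one (by linarith)]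
                congr 1
                ring
            _ ≤ S x * T n x ^ (p - 1) := by
                rw [ENNReal.rpow_one]
                gcongr
                exact hTle n x
      _ = ∑' j, ∫⁻ x, kernelOp μ (κ j) (a j) x * T n x ^ (p - 1) ∂μ := by
          simp_rw [hS, ← ENNReal.tsum_mul_right]
          exact lintegral_tsum fun j => ((hAm j).mul hhm).aemeasurable
      _ = ∑' j, ∫⁻ x, a j x * kernelOp μ (κ j) (fun x => T n x ^ (p - 1)) x ∂μ :=
          tsum_congr fun j => lintegral_kernelOp_mul (H.measurable_kernel j) (H.symm j) (ha j) hhm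
      _ ≤ ∑' j, ∫⁻ x, a j x * N (fun x => T n x ^ (p - 1)) x ∂μ := by
          gcongr with j x
          exact H.le_op j _ hhm x
      _ = ∫⁻ x, B x * N (fun x => T n x ^ (p - 1)) x ∂μ := by
          simp_rw [hB, ← ENNReal.tsum_mul_right]
          exact (lintegral_tsum fun j => ((ha j).mul (H.measurable_op _ hhm)).aemeasurable).symm
      _ ≤ (∫⁻ x, B x ^ p ∂μ) ^ (1 / p) *
          (∫⁻ x, N (fun x => T n x ^ (p - 1)) x ^ p' ∂μ) ^ (1 / p') :=
          ENNReal.lintegral_mul_le_Lp_mul_Lq μ hpp hBm.aemeasurable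
            (H.measurable_op _ hhm).aemeasurable
      _ ≤ (∫⁻ x, B x ^ p ∂μ) ^ (1 / p) * (C p' * ∫⁻ x, T n x ^ p ∂μ) ^ (1 / p') := by
          have hbd := H.bound p' hpp.symm.lt _ hhm
          simp_rw [← ENNReal.rpow_mul, hpp.sub_one_mul_conj] at hbd
          have h0 : 0 ≤ 1 / p' := by have := hpp.symm.pos; positivity
          gcongr
      _ = _ := by
          rw [ENNReal.mul_rpow_of_nonneg _ _ (by have := hpp.symm.pos; positivity), mul_assoc]
  refine (le_rpow_of_le_mul_rpow hpp hfin key).trans_eq ?_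
  rw [ENNReal.mul_rpow_of_nonneg _ _ hpp.nonneg, ← ENNReal.rpow_mul, ← ENNReal.rpow_mul,
    one_div, inv_mul_cancel₀ hpp.ne_zero, ENNReal.rpow_one, mul_comm]
  congr 2
  have h1 := hpp.sub_one_mul_conj
  have h2 := hpp.symm.ne_zero
  field_simp
  linarith

/-- The vector-valued inequality in `L_p(ℓ_q)` for `1 < q < ∞`. -/
lemma IsDominated.lintegral_tsum_rpow_rpow_le [SigmaFinite μ] [Countable I]
    (H : IsDominated μ κ N C) {p p' q q' : ℝ} (hpp : p.HolderConjugate p')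
    (hqq : q.HolderConjugate q') {G : I → X → ℝ≥0∞} (hG : ∀ j, Measurable (G j))
    (hfin : ∫⁻ x, (∑' j, G j x ^ q) ^ (p / q) ∂μ ≠ ⊤) :
    ∫⁻ x, (∑' j, kernelOp μ (κ j) (G j) x ^ q) ^ (p / q) ∂μ ≤
      C p ^ (1 / q') * (C p' ^ (p - 1)) ^ (1 / q) *
        ∫⁻ x, (∑' j, G j x ^ q) ^ (p / q) ∂μ := by
  have hp := hpp.pos
  have hq := hqq.pos
  have hq' := hqq.symm.pos
  set b : X → ℝ≥0∞ := fun x => (∑' j, G j x ^ q) ^ (1 / q) with hb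
  have hbm : Measurable b := (Measurable.tsum fun j => (hG j).pow_const q).pow_const _
  have hbp : ∀ x, b x ^ p = (∑' j, G j x ^ q) ^ (p / q) := fun x => by
    rw [hb, ← ENNReal.rpow_mul]; congr 1; ring
  have hbq : ∀ x, b x ^ q = ∑' j, G j x ^ q := fun x => by
    simp only [hb]
    rw [← ENNReal.rpow_mul, one_div, inv_mul_cancel₀ hq.ne', ENNReal.rpow_one]
  simp_rw [← hbp] at hfin ⊢
  set J := ∫⁻ x, b x ^ p ∂μ with hJ
  set D := C p ^ (1 / q') * (C p' ^ (p - 1)) ^ (1 / q) with hD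
  have hbfin : ∀ᵐ x ∂μ, b x < ⊤ := by
    filter_upwards [ae_lt_top (hbm.pow_const p) hfin] with x hx
    exact lt_top_iff_ne_top.2 fun h => by simp [h, hp] at hx
  set a : I → X → ℝ≥0∞ := fun j x => G j x ^ q / b x ^ (q - 1) with ha
  have ham : ∀ j, Measurable (a j) := fun j => ((hG j).pow_const q).div (hbm.pow_const _)
  have hGle : ∀ j, ∀ᵐ x ∂μ, G j x = a j x ^ (1 / q) * b x ^ (1 / q') := by
    intro j
    filter_upwards [hbfin] with x hx
    rcases eq_or_ne (b x) 0 with h0 | h0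
    · have hz : ∑' j, G j x ^ q = 0 := by rw [← hbq, h0, ENNReal.zero_rpow_of_pos hq]
      have hGz : G j x = 0 :=
        (ENNReal.rpow_eq_zero_iff_of_pos hq).1 (ENNReal.tsum_eq_zero.1 hz j)
      rw [hGz, h0, ENNReal.zero_rpow_of_pos (by positivity), mul_zero]
    · simp only [ha]
      rw [ENNReal.div_rpow_of_nonneg _ _ (by positivity), ← ENNReal.rpow_mul, ← ENNReal.rpow_mul,
        mul_one_div_cancel hq.ne', ENNReal.rpow_one]
      have hex : (q - 1) * (1 / q) = 1 / q' := by
        have := hqq.sub_one_mul_conj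
        field_simp
        linarith
      rw [hex, ENNReal.div_mul_cancel (ENNReal.rpow_pos (pos_iff_ne_zero.2 h0) hx.ne).ne'
        (ENNReal.rpow_ne_top_of_nonneg (by positivity) hx.ne)]
  have hsum : ∀ x, ∑' j, a j x ≤ b x := by
    intro x
    simp only [ha, ENNReal.div_eq_inv_mul]
    rw [ENNReal.tsum_mul_left, ← hbq, ← ENNReal.div_eq_inv_mul]
    refine ENNReal.div_le_of_le_mul ?_
    nth_rewrite 2 [← ENNReal.rpow_one (b x)]
    rw [← ENNReal.rpow_add_of_nonneg _ _ zero_le_one (by linarith [hqq.lt])]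
    exact le_of_eq (by congr 1; ring)
  have hop : ∀ j x, kernelOp μ (κ j) (G j) x ^ q ≤
      N b x ^ (q - 1) * kernelOp μ (κ j) (a j) x := by
    intro j x
    have hκx : Measurable (κ j x) := (H.measurable_kernel j).comp measurable_prodMk_left
    have hle : kernelOp μ (κ j) (G j) x ≤
        kernelOp μ (κ j) (a j) x ^ (1 / q) * N b x ^ (1 / q') := by
      calc kernelOp μ (κ j) (G j) x
          = ∫⁻ z, (κ j x z * a j z) ^ (1 / q) * (κ j x z * b z) ^ (1 / q') ∂μ := by
            refine lintegral_congr_ae ?_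
            filter_upwards [hGle j] with z hz
            rw [hz, ENNReal.mul_rpow_of_nonneg _ _ (by positivity),
              ENNReal.mul_rpow_of_nonneg _ _ (by positivity), mul_mul_mul_comm,
              ← ENNReal.rpow_add_of_nonneg _ _ (by positivity) (by positivity),
              one_div, one_div, hqq.inv_add_inv_eq_one, ENNReal.rpow_one]
        _ ≤ (∫⁻ z, ((κ j x z * a j z) ^ (1 / q)) ^ q ∂μ) ^ (1 / q) *
            (∫⁻ z, ((κ j x z * b z) ^ (1 / q')) ^ q' ∂μ) ^ (1 / q') :=
            ENNReal.lintegral_mul_le_Lp_mul_Lq μ hqq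
              ((hκx.mul (ham j)).pow_const _).aemeasurable
              ((hκx.mul hbm).pow_const _).aemeasurable
        _ = kernelOp μ (κ j) (a j) x ^ (1 / q) * kernelOp μ (κ j) b x ^ (1 / q') := by
            simp_rw [← ENNReal.rpow_mul, one_div, inv_mul_cancel₀ hq.ne', inv_mul_cancel₀ hq'.ne',
              ENNReal.rpow_one]
            rfl
        _ ≤ _ := by
            have h0 : 0 ≤ 1 / q' := by positivity
            gcongr
            exact H.le_op j b hbm x
    calc kernelOp μ (κ j) (G j) x ^ q
        ≤ (kernelOp μ (κ j) (a j) x ^ (1 / q) * N b x ^ (1 / q')) ^ q :=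
          ENNReal.rpow_le_rpow hle hq.le
      _ = _ := by
          rw [ENNReal.mul_rpow_of_nonneg _ _ hq.le, ← ENNReal.rpow_mul, ← ENNReal.rpow_mul,
            one_div_mul_cancel hq.ne', ENNReal.rpow_one, mul_comm]
          congr 2
          have := hqq.sub_one_mul_conj
          field_simp
          linarith
  set S : X → ℝ≥0∞ := fun x => ∑' j, kernelOp μ (κ j) (a j) x with hS
  have hSm : Measurable S := Measurable.tsum fun j =>
    measurable_kernelOp (H.measurable_kernel j) (ham j)
  have hSp : ∫⁻ x, S x ^ p ∂μ ≤ C p' ^ (p - 1) * J := by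
    refine (H.lintegral_tsum_rpow_le hpp ham).trans ?_
    rw [hJ]
    gcongr with x
    exact hsum x
  have hNb := H.bound p hpp.lt b hbm
  have hNbm := H.measurable_op b hbm
  calc ∫⁻ x, (∑' j, kernelOp μ (κ j) (G j) x ^ q) ^ (p / q) ∂μ
      ≤ ∫⁻ x, N b x ^ (p / q') * S x ^ (p / q) ∂μ := by
        refine lintegral_mono fun x => ?_
        refine (ENNReal.rpow_le_rpow (ENNReal.tsum_le_tsum fun j => hop j x)
          (by positivity)).trans_eq ?_
        rw [ENNReal.tsum_mul_left, ENNReal.mul_rpow_of_nonneg _ _ (by positivity),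
          ← ENNReal.rpow_mul]
        congr 2
        have := hqq.sub_one_mul_conj
        field_simp
        linarith
    _ ≤ (∫⁻ x, (N b x ^ (p / q')) ^ q' ∂μ) ^ (1 / q') *
        (∫⁻ x, (S x ^ (p / q)) ^ q ∂μ) ^ (1 / q) :=
        ENNReal.lintegral_mul_le_Lp_mul_Lq μ hqq.symm (hNbm.pow_const _).aemeasurable
          (hSm.pow_const _).aemeasurable
    _ = (∫⁻ x, N b x ^ p ∂μ) ^ (1 / q') * (∫⁻ x, S x ^ p ∂μ) ^ (1 / q) := by
        simp_rw [← ENNReal.rpow_mul, div_mul_cancel₀ p hq.ne', div_mul_cancel₀ p hq'.ne']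
    _ ≤ (C p * J) ^ (1 / q') * (C p' ^ (p - 1) * J) ^ (1 / q) := by
        have h0 : 0 ≤ 1 / q' := by positivity
        have h1 : 0 ≤ 1 / q := by positivity
        gcongr
    _ = D * J := by
        rw [ENNReal.mul_rpow_of_nonneg _ _ (by positivity),
          ENNReal.mul_rpow_of_nonneg _ _ (by positivity), mul_mul_mul_comm,
          ← ENNReal.rpow_add_of_nonneg _ _ (by positivity) (by positivity), one_div, one_div,
          hqq.symm.inv_add_inv_eq_one, ENNReal.rpow_one, hD, one_div, one_div]

end VectorValued

end LizorkinTriebel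


namespace LizorkinTriebel

/-! ### Translations of Schwartz functions -/

section Translation

lemma one_add_norm_pow_le {V : Type} [NormedAddCommGroup V] (k : ℕ) (x c : V) :
    (1 + ‖x‖) ^ k ≤ (1 + ‖x - c‖) ^ k * (1 + ‖c‖) ^ k := by
  rw [← mul_pow]
  gcongr
  have : ‖x‖ ≤ ‖x - c‖ + ‖c‖ := by simpa using norm_add_le (x - c) c
  nlinarith [norm_nonneg (x - c), norm_nonneg c]

variable {V F : Type} [NormedAddCommGroup V] [NormedSpace ℝ V] [NormedAddCommGroup F]
  [NormedSpace ℝ F]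

lemma iteratedFDeriv_compSubConstCLM [NormedSpace ℂ F] (ψ : 𝓢(V, F)) (a : V) (n : ℕ) (x : V) :
    iteratedFDeriv ℝ n (SchwartzMap.compSubConstCLM ℂ a ψ) x = iteratedFDeriv ℝ n ψ (x - a) := by
  have : (SchwartzMap.compSubConstCLM ℂ a ψ : V → F) = fun y => ψ (y - a) := by
    ext y; simp
  rw [this, iteratedFDeriv_comp_sub]

lemma exists_one_add_pow_mul_le (ψ : 𝓢(V, F)) (k n : ℕ) :
    ∃ M : ℝ, 0 ≤ M ∧ ∀ x, (1 + ‖x‖) ^ k * ‖iteratedFDeriv ℝ n ψ x‖ ≤ M :=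
  ⟨_, by positivity, fun x => SchwartzMap.one_add_le_sup_seminorm_apply (𝕜 := ℝ) (m := (k, n))
    le_rfl le_rfl ψ x⟩

lemma continuous_compSubConstCLM [NormedSpace ℂ F] [SMulCommClass ℝ ℂ F] (ψ : 𝓢(V, F)) :
    Continuous fun a => SchwartzMap.compSubConstCLM ℂ a ψ := by
  refine continuous_iff_continuousAt.2 fun b => ?_
  refine ((schwartz_withSeminorms ℝ V F).tendsto_nhds _ _).2 fun ⟨k, n⟩ ε hε => ?_
  obtain ⟨M, hM0, hM⟩ := exists_one_add_pow_mul_le ψ k (n + 1)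
  set R : ℝ := ‖b‖ + 1 with hR
  have hR0 : 0 ≤ R := by positivity
  have hlim : Filter.Tendsto (fun a => (1 + R) ^ k * M * ‖a - b‖) (nhds b) (nhds 0) := by
    have : Continuous fun a : V => (1 + R) ^ k * M * ‖a - b‖ := by fun_prop
    simpa using this.tendsto b
  filter_upwards [hlim.eventually (gt_mem_nhds hε), Metric.ball_mem_nhds b one_pos] with a ha hab
  refine lt_of_le_of_lt ?_ ha
  refine SchwartzMap.seminorm_le_bound ℝ k n _ (by positivity) fun x => ?_
  have hd : iteratedFDeriv ℝ n (SchwartzMap.compSubConstCLM ℂ a ψ -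
      SchwartzMap.compSubConstCLM ℂ b ψ : 𝓢(V, F)) x =
      iteratedFDeriv ℝ n ψ (x - a) - iteratedFDeriv ℝ n ψ (x - b) := by
    rw [← iteratedFDeriv_compSubConstCLM, ← iteratedFDeriv_compSubConstCLM]
    exact iteratedFDeriv_sub_apply ((SchwartzMap.smooth _ n).contDiffAt)
      ((SchwartzMap.smooth _ n).contDiffAt)
  rw [hd]
  have hle : ∀ c ∈ Metric.closedBall x R, ‖x‖ ^ k * ‖iteratedFDeriv ℝ (n + 1) ψ c‖ ≤
      (1 + R) ^ k * M := by
    intro c hc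
    have h1 : ‖x - c‖ ≤ R := by rwa [← dist_eq_norm, dist_comm]
    calc ‖x‖ ^ k * ‖iteratedFDeriv ℝ (n + 1) ψ c‖
        ≤ ((1 + ‖x - c‖) ^ k * (1 + ‖c‖) ^ k) * ‖iteratedFDeriv ℝ (n + 1) ψ c‖ := by
          gcongr
          exact le_trans (by gcongr; linarith) (one_add_norm_pow_le k x c)
      _ ≤ (1 + R) ^ k * ((1 + ‖c‖) ^ k * ‖iteratedFDeriv ℝ (n + 1) ψ c‖) := by
          rw [mul_assoc]
          gcongr
      _ ≤ _ := by gcongr; exact hM c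
  rcases (pow_nonneg (norm_nonneg x) k).eq_or_lt with h0 | h0
  · rw [← h0, zero_mul]
    positivity
  have hmv := (convex_closedBall x R).norm_image_sub_le_of_norm_fderiv_le (𝕜 := ℝ)
    (f := iteratedFDeriv ℝ n ψ) (C := (1 + R) ^ k * M / ‖x‖ ^ k) (x := x - b) (y := x - a)
    (fun c _ => ((ψ.smooth (n + 1 : ℕ)).differentiable_iteratedFDeriv
      (by exact_mod_cast Nat.lt_succ_self n)) c)
    (fun c hc => by
      rw [norm_fderiv_iteratedFDeriv, le_div_iff₀ h0, mul_comm]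
      exact hle c hc)
    (by simp [hR])
    (by
      rw [Metric.mem_closedBall, dist_eq_norm]
      have : ‖a‖ ≤ ‖b‖ + ‖a - b‖ := by simpa using norm_add_le b (a - b)
      rw [Metric.mem_ball, dist_eq_norm] at hab
      simp only [sub_sub_cancel_left, norm_neg, hR]
      linarith)
  rw [show x - a - (x - b) = -(a - b) by abel, norm_neg] at hmv
  calc ‖x‖ ^ k * ‖iteratedFDeriv ℝ n ψ (x - a) - iteratedFDeriv ℝ n ψ (x - b)‖
      ≤ ‖x‖ ^ k * ((1 + R) ^ k * M / ‖x‖ ^ k * ‖a - b‖) := by gcongr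
    _ = _ := by field_simp

end Translation

/-! ### Integrals of translates under a tempered distribution -/

section WeakIntegral

variable {V : Type} [NormedAddCommGroup V] [NormedSpace ℝ V]

/-- The weighted derivative `x ↦ (1 + |x|)^k D^n ψ(x)` as a bounded continuous function. -/
noncomputable def weightedDeriv (k n : ℕ) :
    𝓢(V, ℂ) →L[ℂ] BoundedContinuousFunction V (V [×n]→L[ℝ] ℂ) :=
  SchwartzMap.mkCLMtoNormedSpace (𝕜 := ℂ) (𝕜' := ℂ) (σ := RingHom.id ℂ)
    (fun ψ : 𝓢(V, ℂ) => BoundedContinuousFunction.ofNormedAddCommGroup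
      (fun x => ((1 + ‖x‖) ^ k) • iteratedFDeriv ℝ n ψ x)
      (((continuous_const.add continuous_norm).pow k).smul
        ((ψ.smooth n).continuous_iteratedFDeriv le_rfl))
      (exists_one_add_pow_mul_le ψ k n).choose
      (fun x => by
        rw [norm_smul, Real.norm_of_nonneg (by positivity)]
        exact (exists_one_add_pow_mul_le ψ k n).choose_spec.2 x))
    (fun f g => by
      ext1 x
      have : iteratedFDeriv ℝ n (f + g : 𝓢(V, ℂ)) x =
          iteratedFDeriv ℝ n f x + iteratedFDeriv ℝ n g x :=
        iteratedFDeriv_add_apply ((SchwartzMap.smooth _ n).contDiffAt)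
          ((SchwartzMap.smooth _ n).contDiffAt)
      change ((1 + ‖x‖) ^ k) • iteratedFDeriv ℝ n (f + g : 𝓢(V, ℂ)) x =
        ((1 + ‖x‖) ^ k) • iteratedFDeriv ℝ n f x + ((1 + ‖x‖) ^ k) • iteratedFDeriv ℝ n g x
      rw [this, smul_add])
    (fun c f => by
      ext1 x
      have : iteratedFDeriv ℝ n (c • f : 𝓢(V, ℂ)) x = c • iteratedFDeriv ℝ n f x :=
        iteratedFDeriv_const_smul_apply ((SchwartzMap.smooth _ n).contDiffAt)
      change ((1 + ‖x‖) ^ k) • iteratedFDeriv ℝ n (c • f : 𝓢(V, ℂ)) x =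
        c • (((1 + ‖x‖) ^ k) • iteratedFDeriv ℝ n f x)
      rw [this, smul_comm])
    ⟨Finset.Iic (k, n), 2 ^ k, by positivity, fun f => by
      refine (BoundedContinuousFunction.norm_le (by positivity)).2 fun x => ?_
      rw [BoundedContinuousFunction.coe_ofNormedAddCommGroup, norm_smul,
        Real.norm_of_nonneg (by positivity)]
      exact SchwartzMap.one_add_le_sup_seminorm_apply (𝕜 := ℂ) (m := (k, n)) le_rfl le_rfl f x⟩

lemma weightedDeriv_apply (k n : ℕ) (ψ : 𝓢(V, ℂ)) (x : V) :
    weightedDeriv k n ψ x = ((1 + ‖x‖) ^ k) • iteratedFDeriv ℝ n ψ x := rfl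

lemma seminorm_le_norm_weightedDeriv (k n : ℕ) (ψ : 𝓢(V, ℂ)) :
    SchwartzMap.seminorm ℂ k n ψ ≤ ‖weightedDeriv k n ψ‖ := by
  refine SchwartzMap.seminorm_le_bound ℂ k n ψ (norm_nonneg (weightedDeriv k n ψ)) fun x => ?_
  refine le_trans ?_ ((weightedDeriv k n ψ).norm_coe_le_norm x)
  rw [weightedDeriv_apply, norm_smul, Real.norm_of_nonneg (by positivity)]
  gcongr
  linarith

lemma norm_weightedDeriv_smul_compSubConstCLM_le (k n : ℕ) (ψ : 𝓢(V, ℂ)) (c : ℂ) (a : V) :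
    ‖weightedDeriv k n (c • SchwartzMap.compSubConstCLM ℂ a ψ)‖ ≤
      (1 + ‖a‖) ^ k * ‖c‖ * ‖weightedDeriv k n ψ‖ := by
  refine (BoundedContinuousFunction.norm_le (by positivity)).2 fun x => ?_
  have h1 := (weightedDeriv k n ψ).norm_coe_le_norm (x - a)
  have h2 : iteratedFDeriv ℝ n (c • SchwartzMap.compSubConstCLM ℂ a ψ : 𝓢(V, ℂ)) x =
      c • iteratedFDeriv ℝ n ψ (x - a) := by
    rw [← iteratedFDeriv_compSubConstCLM]
    exact iteratedFDeriv_const_smul_apply ((SchwartzMap.smooth _ n).contDiffAt)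
  rw [weightedDeriv_apply, norm_smul, Real.norm_of_nonneg (by positivity)] at h1 ⊢
  rw [h2, norm_smul]
  calc (1 + ‖x‖) ^ k * (‖c‖ * ‖iteratedFDeriv ℝ n ψ (x - a)‖)
      ≤ ((1 + ‖x - a‖) ^ k * (1 + ‖a‖) ^ k) * (‖c‖ * ‖iteratedFDeriv ℝ n ψ (x - a)‖) := by
        gcongr
        exact one_add_norm_pow_le k x a
    _ = (1 + ‖a‖) ^ k * ‖c‖ * ((1 + ‖x - a‖) ^ k * ‖iteratedFDeriv ℝ n ψ (x - a)‖) := by ring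
    _ ≤ _ := by gcongr

/-- The Banach space that holds finitely many weighted derivatives. -/
def DerivProduct (V : Type) [NormedAddCommGroup V] [NormedSpace ℝ V] (s : Finset (ℕ × ℕ)) : Type :=
  (i : s) → BoundedContinuousFunction V (V [×i.1.2]→L[ℝ] ℂ)

noncomputable instance (s : Finset (ℕ × ℕ)) : NormedAddCommGroup (DerivProduct V s) :=
  inferInstanceAs (NormedAddCommGroup
    ((i : s) → BoundedContinuousFunction V (V [×i.1.2]→L[ℝ] ℂ)))

noncomputable instance (s : Finset (ℕ × ℕ)) : NormedSpace ℂ (DerivProduct V s) :=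
  inferInstanceAs (NormedSpace ℂ ((i : s) → BoundedContinuousFunction V (V [×i.1.2]→L[ℝ] ℂ)))

instance (s : Finset (ℕ × ℕ)) : CompleteSpace (DerivProduct V s) :=
  inferInstanceAs (CompleteSpace ((i : s) → BoundedContinuousFunction V (V [×i.1.2]→L[ℝ] ℂ)))

/-- All weighted derivatives with indices in `s`. -/
noncomputable def weightedDerivs (s : Finset (ℕ × ℕ)) : 𝓢(V, ℂ) →L[ℂ] DerivProduct V s where
  toFun ψ := fun i => weightedDeriv i.1.1 i.1.2 ψ
  map_add' f g := by
    funext i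
    exact map_add (weightedDeriv i.1.1 i.1.2) f g
  map_smul' c f := by
    funext i
    exact map_smul (weightedDeriv i.1.1 i.1.2) c f
  cont := continuous_pi fun i => (weightedDeriv i.1.1 i.1.2).continuous

/-- The value at a point of a component of `DerivProduct`. -/
noncomputable def DerivProduct.evalPoint {s : Finset (ℕ × ℕ)} (i : s) (x : V) :
    DerivProduct V s →L[ℂ] (V [×i.1.2]→L[ℝ] ℂ) where
  toFun e := e i x
  map_add' _ _ := rfl
  map_smul' _ _ := rfl
  cont := (BoundedContinuousFunction.evalCLM ℂ x).continuous.comp (continuous_apply i)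

/-- A tempered distribution factors through finitely many weighted derivatives. -/
lemma exists_factor_weightedDeriv (T : 𝓢(V, ℂ) →L[ℂ] ℂ) :
    ∃ (s : Finset (ℕ × ℕ)) (L : DerivProduct V s →L[ℂ] ℂ), ∀ ψ, T ψ = L (weightedDerivs s ψ) := by
  obtain ⟨s, C, -, hC⟩ := Seminorm.bound_of_continuous (schwartz_withSeminorms ℂ V ℂ)
    ((normSeminorm ℂ ℂ).comp (T : 𝓢(V, ℂ) →ₗ[ℂ] ℂ)) (continuous_norm.comp T.continuous)
  let J : 𝓢(V, ℂ) →ₗ[ℂ] DerivProduct V s := (weightedDerivs s).toLinearMap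
  have hbound : ∀ ψ, ‖T ψ‖ ≤ C * ‖J ψ‖ := by
    intro ψ
    refine (hC ψ).trans ?_
    rw [_root_.smul_apply, NNReal.smul_def, smul_eq_mul]
    gcongr
    refine Seminorm.finset_sup_apply_le (norm_nonneg _) fun i hi => ?_
    refine (seminorm_le_norm_weightedDeriv i.1 i.2 ψ).trans ?_
    exact norm_le_pi_norm (f := fun i : s => weightedDeriv i.1.1 i.1.2 ψ) ⟨i, hi⟩
  have hker : LinearMap.ker J ≤ LinearMap.ker (T : 𝓢(V, ℂ) →ₗ[ℂ] ℂ) := by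
    intro ψ hψ
    rw [LinearMap.mem_ker] at hψ ⊢
    have := hbound ψ
    rw [hψ, norm_zero, mul_zero] at this
    exact norm_le_zero_iff.1 this
  let T₀ : LinearMap.range J →ₗ[ℂ] ℂ :=
    ((LinearMap.ker J).liftQ (T : 𝓢(V, ℂ) →ₗ[ℂ] ℂ) hker).comp
      (J.quotKerEquivRange.symm : LinearMap.range J →ₗ[ℂ] _)
  have hT₀ : ∀ ψ, T₀ ⟨J ψ, LinearMap.mem_range_self J ψ⟩ = T ψ := by
    intro ψ
    have : J.quotKerEquivRange.symm ⟨J ψ, LinearMap.mem_range_self J ψ⟩ =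
        (LinearMap.ker J).mkQ ψ := by
      rw [LinearEquiv.symm_apply_eq]
      rfl
    simp [T₀, this]
  obtain ⟨L, hL, -⟩ := exists_extension_norm_eq (LinearMap.range J)
    (T₀.mkContinuous C (by
      rintro ⟨_, ψ, rfl⟩
      rw [hT₀]
      exact hbound ψ))
  refine ⟨s, L, fun ψ => ?_⟩
  have := hL ⟨J ψ, LinearMap.mem_range_self J ψ⟩
  rw [LinearMap.mkContinuous_apply, hT₀] at this
  exact this.symm

variable [MeasurableSpace V] [BorelSpace V] [FiniteDimensional ℝ V] {μ : Measure V}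
  [hμ : μ.HasTemperateGrowth]

lemma integrable_one_add_pow_mul (K : 𝓢(V, ℂ)) (k : ℕ) :
    Integrable (fun y => (1 + ‖y‖) ^ k * ‖K y‖) μ := by
  have h1 : Integrable (fun y => 2 ^ k * (‖K y‖ + ‖y‖ ^ k * ‖K y‖)) μ :=
    (K.integrable.norm.add (K.integrable_pow_mul μ k)).const_mul _
  refine h1.mono' (by fun_prop) (Filter.Eventually.of_forall fun y => ?_)
  rw [Real.norm_of_nonneg (by positivity), ← one_add_mul, ← mul_assoc]
  gcongr
  calc (1 + ‖y‖) ^ k ≤ (2 * max 1 ‖y‖) ^ k := by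
        gcongr
        rw [two_mul]
        exact add_le_add (le_max_left _ _) (le_max_right _ _)
    _ = 2 ^ k * (max 1 ‖y‖) ^ k := mul_pow _ _ _
    _ ≤ 2 ^ k * (1 + ‖y‖ ^ k) := by
        gcongr
        rcases max_choice 1 ‖y‖ with h | h <;> rw [h]
        · simp
        · linarith

lemma integrable_smul_iteratedFDeriv_sub {F : Type} [NormedAddCommGroup F] [NormedSpace ℝ F]
    [NormedSpace ℂ F] [SMulCommClass ℝ ℂ F] (K : 𝓢(V, ℂ)) (ψ : 𝓢(V, F)) (n : ℕ) (x : V) :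
    Integrable (fun y => K y • iteratedFDeriv ℝ n ψ (x - y)) μ := by
  obtain ⟨M, hM0, hM⟩ := exists_one_add_pow_mul_le ψ 0 n
  refine (K.integrable.norm.const_mul M).mono' (K.continuous.smul
    (((ψ.smooth n).continuous_iteratedFDeriv le_rfl).comp
      (continuous_const.sub continuous_id))).aestronglyMeasurable
    (Filter.Eventually.of_forall fun y => ?_)
  rw [norm_smul, mul_comm]
  gcongr
  simpa using hM (x - y)

lemma iteratedFDeriv_integral_translate (n : ℕ) : ∀ {F : Type} [NormedAddCommGroup F]
    [NormedSpace ℝ F] [NormedSpace ℂ F] [SMulCommClass ℝ ℂ F] [CompleteSpace F]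
    (K : 𝓢(V, ℂ)) (ψ : 𝓢(V, F)) (x : V),
    iteratedFDeriv ℝ n (fun u => ∫ y, K y • ψ (u - y) ∂μ) x =
      ∫ y, K y • iteratedFDeriv ℝ n ψ (x - y) ∂μ := by
  induction n with
  | zero =>
    intro F _ _ _ _ _ K ψ x
    rw [iteratedFDeriv_zero_eq_comp, Function.comp_apply]
    refine ((continuousMultilinearCurryFin0 ℝ V F).symm.toContinuousLinearEquiv.integral_comp_comm
      _).symm.trans ?_
    refine integral_congr_ae (Filter.Eventually.of_forall fun y => ?_)
    beta_reduce
    rw [iteratedFDeriv_zero_eq_comp]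
    rfl
  | succ n ih =>
    intro F _ _ _ _ _ K ψ x
    have hfd : (fun u => fderiv ℝ (fun u => ∫ y, K y • ψ (u - y) ∂μ) u) =
        fun u => ∫ y, K y • (SchwartzMap.fderivCLM ℂ V F ψ) (u - y) ∂μ := by
      funext u
      refine HasFDerivAt.fderiv ?_
      obtain ⟨M, hM0, hM⟩ := exists_one_add_pow_mul_le ψ 0 1
      refine hasFDerivAt_integral_of_dominated_of_fderiv_le (𝕜 := ℝ) (bound := fun y => M * ‖K y‖)
        (F' := fun u y => K y • (SchwartzMap.fderivCLM ℂ V F ψ) (u - y)) Filter.univ_mem ?_ ?_ ?_ ?_ ?_ ?_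
      · exact Filter.Eventually.of_forall fun u => (K.continuous.smul
          (ψ.continuous.comp (continuous_const.sub continuous_id))).aestronglyMeasurable
      · obtain ⟨M, hM0, hM⟩ := exists_one_add_pow_mul_le ψ 0 0
        refine (K.integrable.norm.const_mul M).mono' (K.continuous.smul
          (ψ.continuous.comp (continuous_const.sub continuous_id))).aestronglyMeasurable
          (Filter.Eventually.of_forall fun y => ?_)
        rw [norm_smul, mul_comm]
        gcongr
        simpa using hM (u - y)
      · exact (K.continuous.smul ((SchwartzMap.continuous _).comp
          (continuous_const.sub continuous_id))).aestronglyMeasurable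
      · refine Filter.Eventually.of_forall fun y u _ => ?_
        rw [norm_smul, mul_comm]
        gcongr
        rw [SchwartzMap.fderivCLM_apply, ← norm_iteratedFDeriv_one]
        simpa using hM (u - y)
      · exact K.integrable.norm.const_mul M
      · refine Filter.Eventually.of_forall fun y u _ => ?_
        have h1 : HasFDerivAt (fun u => ψ (u - y)) (fderiv ℝ ψ (u - y)) u :=
          (ψ.hasFDerivAt (u - y)).comp u ((hasFDerivAt_id u).sub_const y)
        exact h1.const_smul (K y)
    have hI := integrable_smul_iteratedFDeriv_sub (μ := μ) K (SchwartzMap.fderivCLM ℂ V F ψ) n x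
    ext m
    have hI2 : Integrable (fun y => (K y • iteratedFDeriv ℝ n (SchwartzMap.fderivCLM ℂ V F ψ)
        (x - y)) (Fin.init m)) μ := (ContinuousMultilinearMap.apply ℝ (fun _ : Fin n => V)
      (V →L[ℝ] F) (Fin.init m)).integrable_comp hI
    rw [iteratedFDeriv_succ_apply_right, hfd, ih, ContinuousMultilinearMap.integral_apply hI,
      ContinuousLinearMap.integral_apply hI2,
      ContinuousMultilinearMap.integral_apply
        (integrable_smul_iteratedFDeriv_sub (μ := μ) K ψ (n + 1) x)]
    refine integral_congr_ae (Filter.Eventually.of_forall fun y => ?_)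
    beta_reduce
    change _ = K y • iteratedFDeriv ℝ (n + 1) ψ (x - y) m
    rw [iteratedFDeriv_succ_apply_right]
    rfl

/-- A tempered distribution can be exchanged with the integral that defines a convolution. -/
theorem apply_eq_integral_translate (T : 𝓢(V, ℂ) →L[ℂ] ℂ) (K ψ Γ : 𝓢(V, ℂ))
    (hΓ : ∀ u, Γ u = ∫ y, K y * ψ (u - y) ∂μ) :
    T Γ = ∫ y, K y * T (SchwartzMap.compSubConstCLM ℂ y ψ) ∂μ := by
  obtain ⟨s, L, hL⟩ := exists_factor_weightedDeriv T
  let J := weightedDerivs (V := V) s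
  have hLJ : ∀ ψ, T ψ = L (J ψ) := hL
  have hcont : Continuous fun y => J (K y • SchwartzMap.compSubConstCLM ℂ y ψ) :=
    J.continuous.comp (K.continuous.smul (continuous_compSubConstCLM ψ))
  have hInteg : Integrable (fun y => J (K y • SchwartzMap.compSubConstCLM ℂ y ψ)) μ := by
    have hb : Integrable (fun y => ∑ i : s, ((1 + ‖y‖) ^ i.1.1 * ‖K y‖) *
        ‖weightedDeriv i.1.1 i.1.2 ψ‖) μ :=
      integrable_finsetSum _ fun i _ => (integrable_one_add_pow_mul K i.1.1).mul_const _
    refine hb.mono' hcont.aestronglyMeasurable (Filter.Eventually.of_forall fun y => ?_)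
    refine (pi_norm_le_iff_of_nonneg (by positivity)).2 fun i => ?_
    refine le_trans ?_ (Finset.single_le_sum (f := fun i : s => ((1 + ‖y‖) ^ i.1.1 * ‖K y‖) *
        ‖weightedDeriv i.1.1 i.1.2 ψ‖) (fun i _ => by positivity) (Finset.mem_univ i))
    exact norm_weightedDeriv_smul_compSubConstCLM_le _ _ _ _ _
  have hJ : J Γ = ∫ y, J (K y • SchwartzMap.compSubConstCLM ℂ y ψ) ∂μ := by
    funext i
    ext1 x
    let ev := DerivProduct.evalPoint (s := s) i x
    have hev := ev.integral_comp_comm hInteg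
    change _ = ev _
    rw [← hev]
    have hΓ' : (Γ : V → ℂ) = fun u => ∫ y, K y • ψ (u - y) ∂μ := by
      funext u
      simpa using hΓ u
    change weightedDeriv i.1.1 i.1.2 Γ x = _
    rw [weightedDeriv_apply, hΓ', iteratedFDeriv_integral_translate, ← integral_smul]
    refine integral_congr_ae (Filter.Eventually.of_forall fun y => ?_)
    change _ = weightedDeriv i.1.1 i.1.2 (K y • SchwartzMap.compSubConstCLM ℂ y ψ) x
    beta_reduce
    rw [weightedDeriv_apply, ← iteratedFDeriv_compSubConstCLM]
    congr 1
    exact (iteratedFDeriv_const_smul_apply ((SchwartzMap.smooth _ _).contDiffAt)).symm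
  rw [hLJ, hJ, ← L.integral_comp_comm hInteg]
  refine integral_congr_ae (Filter.Eventually.of_forall fun y => ?_)
  beta_reduce
  rw [← hLJ, map_smul, smul_eq_mul]

end WeakIntegral

end LizorkinTriebel


namespace LizorkinTriebel

/-! ### Fourier multipliers as convolutions -/

section Multiplier

variable {d : ℕ}

lemma Symbol.wave_apply (m : Symbol d) (x η : Rd d) :
    m.wave x η = Complex.exp (((2 * Real.pi * inner ℝ x η : ℝ) : ℂ) * Complex.I) *
        m.toFun ((2 * Real.pi) • η) := rfl

/-- The convolution kernel of a Fourier multiplier, reflected at the origin. -/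
noncomputable def Symbol.kernel (m : Symbol d) : 𝓢(Rd d, ℂ) := 𝓕 (m.wave 0)

lemma Symbol.fourier_wave (m : Symbol d) (x : Rd d) :
    𝓕 (m.wave x) = SchwartzMap.compSubConstCLM ℂ x m.kernel := by
  ext u
  rw [SchwartzMap.compSubConstCLM_apply, Symbol.kernel, SchwartzMap.fourier_coe,
    SchwartzMap.fourier_coe, Real.fourier_eq', Real.fourier_eq']
  refine integral_congr_ae (Filter.Eventually.of_forall fun v => ?_)
  simp only [Symbol.wave_apply, smul_eq_mul, ← mul_assoc, ← Complex.exp_add, inner_zero_left,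
    mul_zero, Complex.ofReal_zero, zero_mul, add_zero]
  congr 2
  rw [inner_sub_right, real_inner_comm x v]
  push_cast
  ring

lemma multiplier_eq (m : Symbol d) (f : 𝓢'(Rd d, ℂ)) (x : Rd d) :
    multiplier m f x = f (SchwartzMap.compSubConstCLM ℂ x m.kernel) := by
  rw [multiplier, TemperedDistribution.fourier_apply, Symbol.fourier_wave]

lemma continuous_multiplier (m : Symbol d) (f : 𝓢'(Rd d, ℂ)) : Continuous (multiplier m f) := by
  have : multiplier m f = fun x => f (SchwartzMap.compSubConstCLM ℂ x m.kernel) :=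
    funext (multiplier_eq m f)
  rw [this]
  let T : 𝓢(Rd d, ℂ) →L[ℂ] ℂ := f
  exact T.continuous.comp (continuous_compSubConstCLM m.kernel)

lemma fourier_fourier_apply (a : 𝓢(Rd d, ℂ)) (u : Rd d) : 𝓕 (𝓕 a) (-u) = a u := by
  have h : 𝓕⁻ (𝓕 a) = a := FourierTransform.fourierInv_fourier_eq a
  conv_rhs => rw [← h]
  rw [SchwartzMap.fourierInv_coe, SchwartzMap.fourier_coe (𝓕 a), Real.fourierInv_eq_fourier_neg]

lemma Symbol.kernel_mul {m₁ m₂ m₃ : Symbol d} (h : ∀ ξ, m₁.toFun ξ = m₂.toFun ξ * m₃.toFun ξ)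
    (u : Rd d) : m₁.kernel u = ∫ y, m₂.kernel y * m₃.kernel (u - y) := by
  have hconv : m₁.kernel =
      SchwartzMap.convolution (ContinuousLinearMap.mul ℂ ℂ) m₂.kernel m₃.kernel := by
    have hinj : 𝓕 m₁.kernel =
        𝓕 (SchwartzMap.convolution (ContinuousLinearMap.mul ℂ ℂ) m₂.kernel m₃.kernel) := by
      rw [SchwartzMap.fourier_convolution]
      ext v
      rw [SchwartzMap.pairing_apply_apply, ← neg_neg v]
      simp only [Symbol.kernel, fourier_fourier_apply, ContinuousLinearMap.mul_apply',
        Symbol.wave_apply, h, inner_zero_left, mul_zero, Complex.ofReal_zero, zero_mul,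
        Complex.exp_zero, one_mul]
    have := congrArg (fun g : 𝓢(Rd d, ℂ) => 𝓕⁻ g) hinj
    simpa using this
  rw [hconv, SchwartzMap.convolution_apply]
  rfl

lemma multiplier_mul {m₁ m₂ m₃ : Symbol d} (h : ∀ ξ, m₁.toFun ξ = m₂.toFun ξ * m₃.toFun ξ)
    (f : 𝓢'(Rd d, ℂ)) (x : Rd d) :
    multiplier m₁ f x = ∫ y, m₂.kernel y * multiplier m₃ f (x + y) := by
  rw [multiplier_eq]
  let T : 𝓢(Rd d, ℂ) →L[ℂ] ℂ := f
  refine (apply_eq_integral_translate (μ := volume) T m₂.kernel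
    (SchwartzMap.compSubConstCLM ℂ x m₃.kernel) _ fun u => ?_).trans ?_
  · rw [SchwartzMap.compSubConstCLM_apply, Symbol.kernel_mul h]
    refine integral_congr_ae (Filter.Eventually.of_forall fun y => ?_)
    simp [sub_right_comm]
  · refine integral_congr_ae (Filter.Eventually.of_forall fun y => ?_)
    beta_reduce
    rw [multiplier_eq]
    congr 2
    ext u
    simp

/-- The sum of finitely many symbols. -/
def Symbol.sum {ι : Type*} (s : Finset ι) (m : ι → Symbol d) : Symbol d where
  toFun ξ := ∑ i ∈ s, (m i).toFun ξ
  smooth := ContDiff.sum fun i _ => (m i).smooth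
  compactSupport := by
    classical
    induction s using Finset.induction_on with
    | empty =>
      simp only [Finset.sum_empty]
      exact HasCompactSupport.zero
    | insert i s hi ih =>
      simp_rw [Finset.sum_insert hi]
      exact (m i).compactSupport.add ih

lemma multiplier_sum {ι : Type*} (s : Finset ι) (m : ι → Symbol d) (f : 𝓢'(Rd d, ℂ)) (x : Rd d) :
    multiplier (Symbol.sum s m) f x = ∑ i ∈ s, multiplier (m i) f x := by
  have h : (Symbol.sum s m).wave x = ∑ i ∈ s, (m i).wave x := by
    ext η
    rw [_root_.sum_apply]
    simp only [Symbol.wave_apply, Symbol.sum, Finset.mul_sum]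
  simp only [multiplier]
  rw [h, map_sum]

lemma enorm_multiplier_le {m₁ m₂ m₃ : Symbol d} (h : ∀ ξ, m₁.toFun ξ = m₂.toFun ξ * m₃.toFun ξ)
    (f : 𝓢'(Rd d, ℂ)) (x : Rd d) :
    ‖multiplier m₁ f x‖ₑ ≤ ∫⁻ y, ‖m₂.kernel y‖ₑ * ‖multiplier m₃ f (x + y)‖ₑ := by
  rw [multiplier_mul h]
  refine (enorm_integral_le_lintegral_enorm _).trans_eq ?_
  simp_rw [enorm_mul]

end Multiplier

/-! ### Kernels of the mixed decomposition -/

section MixedKernel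

/-- The univariate kernels of the mixed decomposition. -/
noncomputable def MixedGenerator.kernel₁ (Ψ : MixedGenerator) (k : ℕ) : ℝ → ℂ :=
  𝓕 fun η : ℝ => dyadic Ψ.φ₀ k (2 * Real.pi * η)

lemma fourier_comp_mul_left (g : ℝ → ℂ) {a : ℝ} (ha : 0 < a) (s : ℝ) :
    𝓕 (fun η => g (a⁻¹ * η)) s = (a : ℂ) * 𝓕 g (a * s) := by
  rw [Real.fourier_eq', Real.fourier_eq']
  have := Measure.integral_comp_inv_mul_left
    (fun η => Complex.exp (↑(-2 * Real.pi * inner ℝ η (a * s)) * Complex.I) • g η) a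
  rw [abs_of_pos ha, Complex.real_smul] at this
  rw [← this]
  refine integral_congr_ae (Filter.Eventually.of_forall fun η => ?_)
  simp only [RCLike.inner_apply, conj_trivial]
  congr 4
  field_simp

lemma MixedGenerator.exists_kernel₁_le (Ψ : MixedGenerator) :
    ∃ C : ℝ, 0 ≤ C ∧ ∀ k s, ‖Ψ.kernel₁ k s‖ ≤ C * (2 ^ k / (1 + (2 ^ k * s) ^ 2)) := by
  let θ : 𝓢(ℝ, ℂ) := HasCompactSupport.toSchwartzMap (f := fun η : ℝ => Ψ.φ₀ (2 * Real.pi * η))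
    (Ψ.compactSupport.comp_smul (c := 2 * Real.pi) (by positivity))
    (Ψ.smooth.comp (contDiff_const.mul contDiff_id))
  have hθ : ∀ η, θ η = Ψ.φ₀ (2 * Real.pi * η) := fun η => rfl
  obtain ⟨M, hM0, hM⟩ := exists_one_add_pow_mul_le (𝓕 θ) 2 0
  have h0 : ∀ s, ‖𝓕 (θ : ℝ → ℂ) s‖ ≤ M / (1 + s ^ 2) := by
    intro s
    rw [le_div_iff₀ (by positivity), mul_comm]
    have := hM s
    rw [norm_iteratedFDeriv_zero, Real.norm_eq_abs] at this
    refine le_trans ?_ this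
    rw [SchwartzMap.fourier_coe]
    gcongr
    nlinarith [sq_abs s, abs_nonneg s]
  have hθF : ∀ k : ℕ, ∀ s, ‖𝓕 (fun η => θ (((2 : ℝ) ^ k)⁻¹ * η)) s‖ ≤
      M * (2 ^ k / (1 + (2 ^ k * s) ^ 2)) := by
    intro k s
    rw [fourier_comp_mul_left θ (by positivity), norm_mul]
    have h2 : ‖(((2 : ℝ) ^ k : ℝ) : ℂ)‖ = 2 ^ k := by
      rw [Complex.norm_real, Real.norm_of_nonneg (by positivity)]
    rw [h2]
    calc (2 : ℝ) ^ k * ‖𝓕 (θ : ℝ → ℂ) (2 ^ k * s)‖ ≤ 2 ^ k * (M / (1 + (2 ^ k * s) ^ 2)) := by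
          gcongr
          exact h0 _
      _ = _ := by ring
  refine ⟨3 * M, by positivity, fun k s => ?_⟩
  cases k with
  | zero =>
    have : Ψ.kernel₁ 0 s = 𝓕 (θ : ℝ → ℂ) s := rfl
    rw [this]
    refine (h0 s).trans ?_
    simp only [pow_zero, one_mul]
    rw [mul_one_div]
    gcongr
    linarith
  | succ k =>
    have hInteg : ∀ k : ℕ, Integrable (fun η => θ (((2 : ℝ) ^ k)⁻¹ * η)) := fun k =>
      θ.integrable.comp_mul_left' (by positivity)
    have hk : Ψ.kernel₁ (k + 1) s = 𝓕 (fun η => θ (((2 : ℝ) ^ (k + 1))⁻¹ * η)) s -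
        𝓕 (fun η => θ (((2 : ℝ) ^ k)⁻¹ * η)) s := by
      have hfun : (fun η : ℝ => dyadic Ψ.φ₀ (k + 1) (2 * Real.pi * η)) =
          (fun η => θ (((2 : ℝ) ^ (k + 1))⁻¹ * η)) - fun η => θ (((2 : ℝ) ^ k)⁻¹ * η) := by
        funext η
        simp only [dyadic, hθ, Pi.sub_apply, smul_eq_mul]
        congr 2 <;> ring
      rw [MixedGenerator.kernel₁, hfun, Real.fourier_eq, Real.fourier_eq, Real.fourier_eq]
      rw [← integral_sub]
      · refine integral_congr_ae (Filter.Eventually.of_forall fun v => ?_)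
        simp only [Pi.sub_apply, smul_sub]
      · exact (Real.fourierIntegral_convergent_iff s).2 (hInteg (k + 1))
      · exact (Real.fourierIntegral_convergent_iff s).2 (hInteg k)
    rw [hk]
    refine (norm_sub_le _ _).trans ?_
    have h1 := hθF (k + 1) s
    have h2 := hθF k s
    have h3 : M * ((2 : ℝ) ^ k / (1 + (2 ^ k * s) ^ 2)) ≤
        2 * (M * (2 ^ (k + 1) / (1 + (2 ^ (k + 1) * s) ^ 2))) := by
      rw [mul_left_comm]
      gcongr
      rw [mul_div_assoc', div_le_div_iff₀ (by positivity) (by positivity), pow_succ' (2 : ℝ) k]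
      have hk0 : (0 : ℝ) < 2 ^ k := by positivity
      nlinarith [sq_nonneg (2 ^ k * s)]
    linarith

lemma MixedGenerator.kernel_symbol {d : ℕ} (Ψ : MixedGenerator) (k : Fin d → ℕ) (y : Rd d) :
    (Ψ.symbol k).kernel y = ∏ i, Ψ.kernel₁ (k i) (y i) := by
  rw [Symbol.kernel, SchwartzMap.fourier_coe, Real.fourier_eq']
  simp only [MixedGenerator.kernel₁, Real.fourier_eq']
  rw [← integral_fintype_prod_volume_eq_prod, ← (PiLp.volume_preserving_toLp (Fin d)).integral_comp
    (MeasurableEquiv.toLp 2 (Fin d → ℝ)).measurableEmbedding]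
  refine integral_congr_ae (Filter.Eventually.of_forall fun v => ?_)
  simp only [smul_eq_mul, Symbol.wave_apply, inner_zero_left, mul_zero, Complex.ofReal_zero,
    zero_mul, Complex.exp_zero, one_mul, Finset.prod_mul_distrib, ← Complex.exp_sum]
  congr 1
  congr 1
  rw [PiLp.inner_apply, ← Finset.sum_mul, Finset.mul_sum]
  push_cast
  rfl

lemma MixedGenerator.exists_kernel_le {d : ℕ} (Ψ : MixedGenerator) :
    ∃ C : ℝ≥0, ∀ (k : Fin d → ℕ) (y : Rd d),
      ‖(Ψ.symbol k).kernel y‖ₑ ≤ C * ∏ i, bellKernel (k i) (y i) := by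
  obtain ⟨C, hC0, hC⟩ := Ψ.exists_kernel₁_le
  refine ⟨C.toNNReal ^ d, fun k y => ?_⟩
  rw [Ψ.kernel_symbol, ← ofReal_norm, norm_prod]
  have h1 : ∏ i, ‖Ψ.kernel₁ (k i) (y i)‖ ≤
      ∏ i, C * (2 ^ (k i) / (1 + (2 ^ (k i) * y i) ^ 2)) :=
    Finset.prod_le_prod (fun i _ => norm_nonneg _) fun i _ => hC _ _
  refine (ENNReal.ofReal_le_ofReal h1).trans_eq ?_
  rw [ENNReal.ofReal_prod_of_nonneg fun i _ => by positivity]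
  simp_rw [ENNReal.ofReal_mul hC0, Finset.prod_mul_distrib, bellKernel]
  simp [ENNReal.ofReal]

end MixedKernel

end LizorkinTriebel


namespace LizorkinTriebel

/-! ### Supports of the dyadic decompositions -/

section Supports

lemma MixedGenerator.φ₀_eq_zero (Ψ : MixedGenerator) {s : ℝ} (hs : 3 / 2 < |s|) : Ψ.φ₀ s = 0 := by
  by_contra h
  have := Ψ.tsupport_subset (subset_tsupport _ h)
  exact absurd (abs_le.2 this) (not_le.2 hs)

lemma MixedGenerator.φ₀_eq_one (Ψ : MixedGenerator) {s : ℝ} (hs : |s| ≤ 1) : Ψ.φ₀ s = 1 :=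
  Ψ.eq_one s (abs_le.1 hs)

lemma abs_inv_two_pow_smul (n : ℕ) (s : ℝ) : |((2 : ℝ) ^ n)⁻¹ • s| = |s| / 2 ^ n := by
  rw [smul_eq_mul, abs_mul, abs_inv, abs_of_pos (by positivity : (0 : ℝ) < 2 ^ n)]
  ring

lemma MixedGenerator.dyadic_eq_zero_of_lt (Ψ : MixedGenerator) (k : ℕ) {s : ℝ}
    (hs : 3 / 2 * 2 ^ k < |s|) : dyadic Ψ.φ₀ k s = 0 := by
  cases k with
  | zero => exact Ψ.φ₀_eq_zero (by simpa using hs)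
  | succ k =>
    have h2 : (0 : ℝ) < 2 ^ k := by positivity
    have h1 : Ψ.φ₀ (((2 : ℝ) ^ (k + 1))⁻¹ • s) = 0 := by
      apply Ψ.φ₀_eq_zero
      rw [abs_inv_two_pow_smul, lt_div_iff₀ (by positivity)]
      exact hs
    have h0 : Ψ.φ₀ (((2 : ℝ) ^ k)⁻¹ • s) = 0 := by
      apply Ψ.φ₀_eq_zero
      rw [abs_inv_two_pow_smul, lt_div_iff₀ (by positivity)]
      rw [pow_succ] at hs
      linarith
    simp only [dyadic, h1, h0, sub_self]

lemma MixedGenerator.dyadic_succ_eq_zero_of_le (Ψ : MixedGenerator) (k : ℕ) {s : ℝ}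
    (hs : |s| ≤ 2 ^ k) : dyadic Ψ.φ₀ (k + 1) s = 0 := by
  have h2 : (0 : ℝ) < 2 ^ k := by positivity
  have h1 : Ψ.φ₀ (((2 : ℝ) ^ (k + 1))⁻¹ • s) = 1 := by
    apply Ψ.φ₀_eq_one
    rw [abs_inv_two_pow_smul, div_le_one (by positivity), pow_succ]
    linarith
  have h0 : Ψ.φ₀ (((2 : ℝ) ^ k)⁻¹ • s) = 1 := by
    apply Ψ.φ₀_eq_one
    rw [abs_inv_two_pow_smul, div_le_one (by positivity)]
    exact hs
  simp only [dyadic, h1, h0, sub_self]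

variable {d : ℕ}

lemma IsoGenerator.sum_range_symbol (Φ : IsoGenerator d) (n : ℕ) (ξ : Rd d) :
    ∑ j ∈ Finset.range (n + 1), (Φ.symbol j).toFun ξ = (Φ.φ₀ (((2 : ℝ) ^ n)⁻¹ • ξ) : ℂ) := by
  induction n with
  | zero => simp [IsoGenerator.symbol, dyadic]
  | succ n ih =>
    rw [Finset.sum_range_succ, ih]
    simp [IsoGenerator.symbol, dyadic]

lemma norm_inv_two_pow_smul (n : ℕ) (ξ : Rd d) : ‖((2 : ℝ) ^ n)⁻¹ • ξ‖ = ‖ξ‖ / 2 ^ n := by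
  rw [norm_smul, norm_inv, Real.norm_of_nonneg (by positivity)]
  ring

/-- The largest entry of a multi-index. -/
def maxIndex (k : Fin d → ℕ) : ℕ := Finset.univ.sup k

lemma le_maxIndex (k : Fin d → ℕ) (i : Fin d) : k i ≤ maxIndex k :=
  Finset.le_sup (Finset.mem_univ i)

lemma exists_eq_maxIndex [NeZero d] (k : Fin d → ℕ) : ∃ i, k i = maxIndex k := by
  obtain ⟨i, -, hi⟩ := Finset.exists_mem_eq_sup Finset.univ Finset.univ_nonempty k
  exact ⟨i, hi.symm⟩

lemma norm_le_sum_abs (ξ : Rd d) : ‖ξ‖ ≤ ∑ i, |ξ i| := by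
  rw [EuclideanSpace.norm_eq]
  refine Real.sqrt_le_iff.2 ⟨by positivity, ?_⟩
  simp only [Real.norm_eq_abs]
  exact Finset.sum_sq_le_sq_sum_of_nonneg fun i _ => abs_nonneg _

/-- The isotropic blocks that meet a block of the mixed decomposition. -/
def window (d M : ℕ) : Finset ℕ := Finset.Ico (M - 1) (M + (d + 1) + 1)

lemma symbol_eq_symbol_mul_sum [NeZero d] (Φ : IsoGenerator d) (Ψ : MixedGenerator)
    (k : Fin d → ℕ) (ξ : Rd d) :
    (Ψ.symbol k).toFun ξ = (Ψ.symbol k).toFun ξ *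
      (Symbol.sum (window d (maxIndex k)) Φ.symbol).toFun ξ := by
  by_cases h : (Ψ.symbol k).toFun ξ = 0
  · rw [h, zero_mul]
  have hne : ∀ i, dyadic Ψ.φ₀ (k i) (ξ i) ≠ 0 := fun i =>
    Finset.prod_ne_zero_iff.1 (show ∏ i, dyadic Ψ.φ₀ (k i) (ξ i) ≠ 0 from h) i (Finset.mem_univ i)
  set M := maxIndex k with hM
  have hub : ‖ξ‖ ≤ 2 ^ (M + (d + 1)) := by
    have h1 : ∀ i, |ξ i| ≤ 3 / 2 * 2 ^ M := by
      intro i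
      have := not_lt.1 (mt (Ψ.dyadic_eq_zero_of_lt (k i)) (hne i))
      refine this.trans ?_
      gcongr
      · norm_num
      · exact le_maxIndex k i
    calc ‖ξ‖ ≤ ∑ i, |ξ i| := norm_le_sum_abs ξ
      _ ≤ ∑ _i : Fin d, (3 / 2 * 2 ^ M : ℝ) := Finset.sum_le_sum fun i _ => h1 i
      _ = d * (3 / 2 * 2 ^ M) := by simp
      _ ≤ 2 ^ (M + (d + 1)) := by
          have h2 : (d : ℝ) ≤ 2 ^ d := by exact_mod_cast Nat.lt_two_pow_self.le
          rw [pow_add, pow_succ]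
          have h3 : (0 : ℝ) < 2 ^ M := by positivity
          nlinarith
  have hsum : (Symbol.sum (window d M) Φ.symbol).toFun ξ = 1 := by
    have h1 : ∑ j ∈ Finset.range (M + (d + 1) + 1), (Φ.symbol j).toFun ξ = 1 := by
      rw [Φ.sum_range_symbol, Φ.eq_one, Complex.ofReal_one]
      rw [norm_inv_two_pow_smul, div_le_one (by positivity)]
      exact hub
    have h2 : ∑ j ∈ Finset.range (M - 1), (Φ.symbol j).toFun ξ = 0 := by
      rcases Nat.lt_or_ge M 2 with hlt | hge
      · have : M - 1 = 0 := by omega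
        simp [this]
      · obtain ⟨n, hn⟩ : ∃ n, M = n + 2 := ⟨M - 2, by omega⟩
        obtain ⟨i, hi⟩ := exists_eq_maxIndex k
        have hi' : k i = (n + 1) + 1 := by rw [hi, ← hM, hn]
        have hlow : 2 ^ (n + 1) < |ξ i| := by
          have := hne i
          rw [hi'] at this
          exact not_le.1 (mt (Ψ.dyadic_succ_eq_zero_of_le (n + 1)) this)
        have hn1 : M - 1 = n + 1 := by omega
        rw [hn1, Φ.sum_range_symbol, Φ.eq_zero, Complex.ofReal_zero]
        rw [norm_inv_two_pow_smul, le_div_iff₀ (by positivity)]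
        have hle : |ξ i| ≤ ‖ξ‖ := by simpa using PiLp.norm_apply_le ξ i
        have h0 : (0 : ℝ) < 2 ^ n := by positivity
        rw [pow_succ] at hlow
        linarith
    change ∑ j ∈ window d M, (Φ.symbol j).toFun ξ = 1
    rw [window, Finset.sum_Ico_eq_sub _ (by omega), h1, h2, sub_zero]
  rw [hsum, mul_one]

end Supports

/-! ### Sequence norms -/

section SequenceNorm

/-- The `ℓ_q` quasi-norm of a family of extended nonnegative numbers. -/
noncomputable def lq {ι : Type*} (q : ℝ≥0∞) (a : ι → ℝ≥0∞) : ℝ≥0∞ :=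
  if q = ⊤ then ⨆ i, a i else (∑' i, a i ^ q.toReal) ^ (1 / q.toReal)

lemma lq_mono {ι : Type*} (q : ℝ≥0∞) {a b : ι → ℝ≥0∞} (h : ∀ i, a i ≤ b i) :
    lq q a ≤ lq q b := by
  unfold lq
  split_ifs
  · exact iSup_mono h
  · have h0 : 0 ≤ q.toReal := ENNReal.toReal_nonneg
    exact ENNReal.rpow_le_rpow (ENNReal.tsum_le_tsum fun i => ENNReal.rpow_le_rpow (h i) h0)
      (by positivity)

lemma lq_const_mul {ι : Type*} {q : ℝ≥0∞} (hq : q ≠ 0) (c : ℝ≥0∞) (a : ι → ℝ≥0∞) :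
    lq q (fun i => c * a i) = c * lq q a := by
  unfold lq
  split_ifs with h
  · rw [ENNReal.mul_iSup]
  · have h0 : 0 < q.toReal := ENNReal.toReal_pos hq h
    simp_rw [ENNReal.mul_rpow_of_nonneg _ _ h0.le]
    rw [ENNReal.tsum_mul_left, ENNReal.mul_rpow_of_nonneg _ _ (by positivity), ← ENNReal.rpow_mul,
      mul_one_div_cancel h0.ne', ENNReal.rpow_one]

lemma LpLqNorm_eq {d : ℕ} {ι : Type*} {p : ℝ≥0∞} (hp : p ≠ 0) (hp' : p ≠ ⊤) (q : ℝ≥0∞)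
    (g : ι → Rd d → ℂ) :
    LpLqNorm p q g = (∫⁻ x : Fin d → ℝ,
      lq q (fun i => ‖g i (WithLp.toLp 2 x)‖ₑ) ^ p.toReal) ^ (1 / p.toReal) := by
  rw [LpLqNorm, eLpNorm_eq_lintegral_rpow_enorm_toReal hp hp',
    ← (PiLp.volume_preserving_toLp (Fin d)).lintegral_comp_emb
    (MeasurableEquiv.toLp 2 (Fin d → ℝ)).measurableEmbedding]
  rfl

lemma tsum_pow_sum_eq (r : ℝ≥0∞) (d : ℕ) :
    ∑' k : Fin d → ℕ, r ^ (∑ i, k i) = (∑' n : ℕ, r ^ n) ^ d := by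
  induction d with
  | zero => simp
  | succ d ih =>
    rw [← (Fin.consEquiv fun _ => ℕ).tsum_eq, ENNReal.tsum_prod', pow_succ', ← ih,
      ← ENNReal.tsum_mul_right]
    refine tsum_congr fun n => ?_
    rw [← ENNReal.tsum_mul_left]
    refine tsum_congr fun k => ?_
    rw [← pow_add]
    congr 1
    simp [Fin.consEquiv, Fin.sum_univ_succ]

lemma tsum_pow_sub_maxIndex_le {d : ℕ} [NeZero d] (r : ℝ≥0∞) (h : ℕ → ℝ≥0∞) :
    ∑' k : Fin d → ℕ, r ^ ((∑ i, k i) - maxIndex k) * h (maxIndex k) ≤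
      d * (∑' n : ℕ, r ^ n) ^ d * ∑' j, h j := by
  choose m hm using exists_eq_maxIndex (d := d)
  have hsum : ∀ k : Fin d → ℕ, (∑ i, k i) - maxIndex k = ∑ i, Function.update k (m k) 0 i := by
    intro k
    have h1 := Finset.add_sum_erase Finset.univ k (Finset.mem_univ (m k))
    rw [hm k] at h1
    rw [← h1, Nat.add_sub_cancel_left, Finset.sum_update_of_mem (Finset.mem_univ _), zero_add,
      Finset.sdiff_singleton_eq_erase]
  let e : (Fin d → ℕ) → Fin d × (Fin d → ℕ) × ℕ := fun k => (m k, Function.update k (m k) 0, k (m k))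
  have he : Function.Injective e := by
    intro k k' hkk
    have h1 : m k = m k' := congrArg Prod.fst hkk
    have h2 : Function.update k (m k) 0 = Function.update k' (m k') 0 :=
      congrArg (fun z => z.2.1) hkk
    have h3 : k (m k) = k' (m k') := congrArg (fun z => z.2.2) hkk
    funext i
    by_cases hi : i = m k
    · rw [hi, h3, h1]
    · have := congrFun h2 i
      rwa [Function.update_of_ne hi, Function.update_of_ne (h1 ▸ hi)] at this
  calc ∑' k : Fin d → ℕ, r ^ ((∑ i, k i) - maxIndex k) * h (maxIndex k)
      = ∑' k, (fun z : Fin d × (Fin d → ℕ) × ℕ => r ^ (∑ i, z.2.1 i) * h z.2.2) (e k) := by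
        refine tsum_congr fun k => ?_
        rw [hsum]
        simp only [e, hm]
    _ ≤ ∑' z : Fin d × (Fin d → ℕ) × ℕ, r ^ (∑ i, z.2.1 i) * h z.2.2 :=
        ENNReal.tsum_comp_le_tsum_of_injective he _
    _ = _ := by
        rw [ENNReal.tsum_prod']
        simp only [tsum_fintype, Finset.sum_const, Finset.card_univ, Fintype.card_fin,
          nsmul_eq_mul]
        rw [ENNReal.tsum_prod']
        simp_rw [ENNReal.tsum_mul_left]
        rw [ENNReal.tsum_mul_right, tsum_pow_sum_eq, mul_assoc]

lemma tsum_shift_le (b : ℕ) (h : ℕ → ℝ≥0∞) : ∑' j, h (j + b - 1) ≤ 2 * ∑' j, h j := by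
  rw [tsum_eq_zero_add' ENNReal.summable, two_mul]
  refine add_le_add (ENNReal.le_tsum _) ?_
  refine ENNReal.tsum_comp_le_tsum_of_injective (f := fun j => j + 1 + b - 1) (fun i j hij => ?_) h
  simp only at hij
  omega

/-- Families indexed by multi-indices, with geometric weights off the largest entry, are
controlled in `ℓ_q` by the underlying sequence. -/
lemma exists_lq_weighted_le {d : ℕ} [NeZero d] {q : ℝ≥0∞} (hq : 1 ≤ q) {r : ℝ≥0∞} (hr : r < 1)
    (D : ℕ) : ∃ C : ℝ≥0, ∀ a : ℕ → ℝ≥0∞,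
      lq q (fun k : Fin d → ℕ => r ^ ((∑ i, k i) - maxIndex k) *
        ∑ b ∈ Finset.range D, a (maxIndex k + b - 1)) ≤ C * lq q a := by
  by_cases hqt : q = ⊤
  · refine ⟨D, fun a => ?_⟩
    simp only [lq, if_pos hqt]
    refine iSup_le fun k => ?_
    calc r ^ ((∑ i, k i) - maxIndex k) * ∑ b ∈ Finset.range D, a (maxIndex k + b - 1)
        ≤ 1 * ∑ b ∈ Finset.range D, ⨆ i, a i := by
          gcongr
          · exact pow_le_one₀ zero_le hr.le
          · exact le_iSup a _
      _ = _ := by simp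
  have hq1 : 1 ≤ q.toReal := by
    rw [← ENNReal.toReal_one]
    exact ENNReal.toReal_mono hqt hq
  have hq0 : 0 < q.toReal := by linarith
  set s := q.toReal with hs
  set A : ℝ≥0∞ := d * (∑' n : ℕ, (r ^ s) ^ n) ^ d * ((D : ℝ≥0∞) ^ (s - 1) * (D * 2)) with hA
  have hrs : r ^ s < 1 := ENNReal.rpow_lt_one hr hq0
  have hAtop : A ≠ ⊤ := by
    refine ENNReal.mul_ne_top (ENNReal.mul_ne_top (by simp) (ENNReal.pow_ne_top ?_))
      (ENNReal.mul_ne_top (ENNReal.rpow_ne_top_of_nonneg (by linarith) (by simp))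
        (ENNReal.mul_ne_top (by simp) (by simp)))
    rw [ENNReal.tsum_geometric]
    exact ENNReal.inv_ne_top.2 (tsub_pos_of_lt hrs).ne'
  refine ⟨(A ^ (1 / s)).toNNReal, fun a => ?_⟩
  rw [ENNReal.coe_toNNReal (ENNReal.rpow_ne_top_of_nonneg (by positivity) hAtop)]
  simp only [lq, if_neg hqt]
  rw [← hs, ← ENNReal.mul_rpow_of_nonneg _ _ (by positivity)]
  refine ENNReal.rpow_le_rpow ?_ (by positivity)
  calc ∑' k : Fin d → ℕ, (r ^ ((∑ i, k i) - maxIndex k) *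
        ∑ b ∈ Finset.range D, a (maxIndex k + b - 1)) ^ s
      = ∑' k : Fin d → ℕ, (r ^ s) ^ ((∑ i, k i) - maxIndex k) *
        (fun j => (∑ b ∈ Finset.range D, a (j + b - 1)) ^ s) (maxIndex k) := by
        refine tsum_congr fun k => ?_
        rw [ENNReal.mul_rpow_of_nonneg _ _ hq0.le, ← ENNReal.rpow_natCast, ← ENNReal.rpow_natCast,
          ← ENNReal.rpow_mul, ← ENNReal.rpow_mul, mul_comm s]
    _ ≤ d * (∑' n : ℕ, (r ^ s) ^ n) ^ d * ∑' j, (∑ b ∈ Finset.range D, a (j + b - 1)) ^ s :=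
        tsum_pow_sub_maxIndex_le _ _
    _ ≤ d * (∑' n : ℕ, (r ^ s) ^ n) ^ d *
        ∑' j, ((D : ℝ≥0∞) ^ (s - 1) * ∑ b ∈ Finset.range D, a (j + b - 1) ^ s) := by
        gcongr with j
        simpa using ENNReal.rpow_sum_le_const_mul_sum_rpow (Finset.range D)
          (fun b => a (j + b - 1)) hq1
    _ ≤ A * ∑' i, a i ^ s := by
        rw [hA, ENNReal.tsum_mul_left, Summable.tsum_finsetSum fun _ _ => ENNReal.summable,
          mul_assoc, mul_assoc, mul_assoc]
        have hle : ∑ b ∈ Finset.range D, ∑' j, a (j + b - 1) ^ s ≤ D * 2 * ∑' j, a j ^ s := by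
          refine (Finset.sum_le_sum fun b _ => tsum_shift_le b fun j => a j ^ s).trans_eq ?_
          simp [mul_assoc]
        simp only [mul_assoc] at hle ⊢
        gcongr

end SequenceNorm

end LizorkinTriebel


namespace LizorkinTriebel

/-! ### The embedding for `1 < p < ∞` and `1 ≤ q ≤ ∞` -/

section VectorValued

variable {X : Type*} [MeasurableSpace X] {μ : Measure X} {I : Type*}
  {κ : I → X → X → ℝ≥0∞} {N : (X → ℝ≥0∞) → X → ℝ≥0∞} {C : ℝ → ℝ≥0∞}

/-- The vector-valued inequality in `L_p(ℓ_q)` for `1 ≤ q ≤ ∞`. -/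
lemma IsDominated.exists_lintegral_lq_rpow_le [SigmaFinite μ] [Countable I]
    (H : IsDominated μ κ N C) (hC : ∀ p, 1 < p → C p ≠ ⊤) {p : ℝ} (hp : 1 < p) {q : ℝ≥0∞}
    (hq : 1 ≤ q) : ∃ A : ℝ≥0, ∀ G : I → X → ℝ≥0∞, (∀ j, Measurable (G j)) →
      ∫⁻ x, lq q (fun j => G j x) ^ p ∂μ ≠ ⊤ →
      ∫⁻ x, lq q (fun j => kernelOp μ (κ j) (G j) x) ^ p ∂μ ≤
        A * ∫⁻ x, lq q (fun j => G j x) ^ p ∂μ := by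
  have hp0 : 0 < p := by linarith
  have hpp := Real.HolderConjugate.conjExponent hp
  by_cases hqt : q = ⊤
  · refine ⟨(C p).toNNReal, fun G hG _ => ?_⟩
    rw [ENNReal.coe_toNNReal (hC p hp)]
    simp only [lq, if_pos hqt]
    refine le_trans (lintegral_mono fun x => ENNReal.rpow_le_rpow (iSup_le fun j => ?_) hp0.le)
      (H.bound p hp (fun x => ⨆ j, G j x) (Measurable.iSup hG))
    refine le_trans ?_ (H.le_op j _ (Measurable.iSup hG) x)
    exact lintegral_mono fun z => mul_le_mul_right (le_iSup (fun j => G j z) j) _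
  rcases hq.eq_or_lt with h1 | h1
  · refine ⟨(C p.conjExponent ^ (p - 1)).toNNReal, fun G hG _ => ?_⟩
    rw [ENNReal.coe_toNNReal
      (ENNReal.rpow_ne_top_of_nonneg (by linarith) (hC _ hpp.symm.lt))]
    simpa [lq, ← h1] using H.lintegral_tsum_rpow_le hpp hG
  · have hq1 : 1 < q.toReal := by
      rw [← ENNReal.toReal_one]
      exact (ENNReal.toReal_lt_toReal ENNReal.one_ne_top hqt).2 h1
    have hqq := Real.HolderConjugate.conjExponent hq1
    have hq0 := hqq.pos
    have hq0' := hqq.symm.pos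
    refine ⟨(C p ^ (1 / q.toReal.conjExponent) *
      (C p.conjExponent ^ (p - 1)) ^ (1 / q.toReal)).toNNReal, fun G hG hfin => ?_⟩
    rw [ENNReal.coe_toNNReal]
    · simp only [lq, if_neg hqt, ← ENNReal.rpow_mul, one_div_mul_eq_div] at hfin ⊢
      simpa only [← ENNReal.rpow_mul] using H.lintegral_tsum_rpow_rpow_le hpp hqq hG hfin
    · exact ENNReal.mul_ne_top (ENNReal.rpow_ne_top_of_nonneg (by positivity) (hC p hp))
        (ENNReal.rpow_ne_top_of_nonneg (by positivity)
          (ENNReal.rpow_ne_top_of_nonneg (by linarith) (hC _ hpp.symm.lt)))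

end VectorValued

variable {d : ℕ}

/-- The product kernels on `ℝ^d`. -/
noncomputable def productKernel (k : Fin d → ℕ) (x z : Fin d → ℝ) : ℝ≥0∞ :=
  ∏ i, bellKernel (k i) (x i - z i)

lemma exists_isDominated_productKernel (d : ℕ) :
    ∃ N, IsDominated volume (productKernel (d := d)) N fun p => bellMaxConst p ^ d := by
  obtain ⟨N, hNm, hNp, hNk⟩ := exists_strongMax (Finset.univ : Finset (Fin d))
  refine ⟨N, fun k => ?_, fun k x z => ?_, hNm, fun k h hh x => ?_, fun p hp h hh => ?_⟩
  · have h : Measurable fun w : (Fin d → ℝ) × (Fin d → ℝ) =>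
        ∏ i, bellKernel (k i) (w.1 i - w.2 i) :=
      Finset.measurable_prod _ fun i _ => (measurable_bellKernel _).comp
        (((measurable_pi_apply i).comp measurable_fst).sub
          ((measurable_pi_apply i).comp measurable_snd))
    exact h
  · refine Finset.prod_congr rfl fun i _ => ?_
    rw [← bellKernel_neg, neg_sub]
  · have := hNk k h hh x
    rwa [lmarginal_univ] at this
  · simpa using hNp p hp h hh

lemma lintegral_bellKernel_mul_add {k : Fin d → ℕ} {h : Rd d → ℝ≥0∞} (x : Fin d → ℝ) :
    ∫⁻ y : Rd d, (∏ i, bellKernel (k i) (y i)) * h (WithLp.toLp 2 x + y) =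
      kernelOp volume (productKernel k) (fun z => h (WithLp.toLp 2 z)) x := by
  rw [← (PiLp.volume_preserving_toLp (Fin d)).lintegral_comp_emb
    (MeasurableEquiv.toLp 2 (Fin d → ℝ)).measurableEmbedding]
  rw [kernelOp]
  refine Eq.trans ?_ (lintegral_add_left_eq_self
    (fun z => productKernel k x z * h (WithLp.toLp 2 z)) x)
  refine lintegral_congr fun z => ?_
  rw [WithLp.toLp_add]
  congr 1
  refine Finset.prod_congr rfl fun i _ => ?_
  rw [← bellKernel_neg]
  simp

lemma exists_enorm_multiplier_symbol_le [NeZero d] {t : ℝ} (ht : t < 0) (Φ : IsoGenerator d)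
    (Ψ : MixedGenerator) : ∃ C : ℝ≥0, ∀ (f : 𝓢'(Rd d, ℂ)) (k : Fin d → ℕ) (x : Fin d → ℝ),
      ‖(((2 : ℝ) ^ (((∑ i, k i : ℕ) : ℝ) * t) : ℝ) : ℂ) *
        multiplier (Ψ.symbol k) f (WithLp.toLp 2 x)‖ₑ ≤
      C * kernelOp volume (productKernel k) (fun z =>
        ENNReal.ofReal (2 ^ t) ^ ((∑ i, k i) - maxIndex k) * ∑ b ∈ Finset.range (d + 3),
          ‖(((2 : ℝ) ^ (((maxIndex k + b - 1 : ℕ) : ℝ) * t) : ℝ) : ℂ) *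
            multiplier (Φ.symbol (maxIndex k + b - 1)) f (WithLp.toLp 2 z)‖ₑ) x := by
  obtain ⟨C, hC⟩ := Ψ.exists_kernel_le (d := d)
  refine ⟨C * ((2 : ℝ) ^ (-(((d + 1 : ℕ) : ℝ) * t))).toNNReal, fun f k x => ?_⟩
  set M := maxIndex k with hM
  have hMle : M ≤ ∑ i, k i := by
    obtain ⟨i, hi⟩ := exists_eq_maxIndex k
    rw [hM, ← hi]
    exact Finset.single_le_sum (fun _ _ => Nat.zero_le _) (Finset.mem_univ i)
  have hw : ∀ s : ℝ, ‖(((2 : ℝ) ^ s : ℝ) : ℂ)‖ₑ = ENNReal.ofReal (2 ^ s) := by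
    intro s
    rw [← ofReal_norm, Complex.norm_real, Real.norm_of_nonneg (by positivity)]
  set S : Rd d → ℝ≥0∞ := fun z => ∑ j ∈ window d M, ‖multiplier (Φ.symbol j) f z‖ₑ with hS
  have h1 : ‖multiplier (Ψ.symbol k) f (WithLp.toLp 2 x)‖ₑ ≤
      C * kernelOp volume (productKernel k) (fun z => S (WithLp.toLp 2 z)) x := by
    refine (enorm_multiplier_le (symbol_eq_symbol_mul_sum Φ Ψ k) f _).trans ?_
    rw [← lintegral_bellKernel_mul_add, ← lintegral_const_mul' _ _ ENNReal.coe_ne_top]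
    refine lintegral_mono fun y => ?_
    rw [← mul_assoc]
    refine mul_le_mul' (hC k y) ?_
    rw [multiplier_sum]
    exact enorm_sum_le _ _
  have h2 : ∀ z : Rd d, ENNReal.ofReal (2 ^ (((∑ i, k i : ℕ) : ℝ) * t)) * S z ≤
      ENNReal.ofReal ((2 : ℝ) ^ (-(((d + 1 : ℕ) : ℝ) * t))) *
        (ENNReal.ofReal (2 ^ t) ^ ((∑ i, k i) - M) * ∑ b ∈ Finset.range (d + 3),
          ‖(((2 : ℝ) ^ (((M + b - 1 : ℕ) : ℝ) * t) : ℝ) : ℂ) *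
            multiplier (Φ.symbol (M + b - 1)) f z‖ₑ) := by
    intro z
    have h3 : ∀ j ∈ window d M, ENNReal.ofReal (2 ^ (((∑ i, k i : ℕ) : ℝ) * t)) *
        ‖multiplier (Φ.symbol j) f z‖ₑ ≤ ENNReal.ofReal ((2 : ℝ) ^ (-(((d + 1 : ℕ) : ℝ) * t))) *
          ENNReal.ofReal (2 ^ t) ^ ((∑ i, k i) - M) *
          ‖(((2 : ℝ) ^ ((j : ℝ) * t) : ℝ) : ℂ) * multiplier (Φ.symbol j) f z‖ₑ := by
      intro j hj
      rw [enorm_mul, hw, ← mul_assoc]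
      gcongr
      rw [← ENNReal.ofReal_pow (by positivity), ← ENNReal.ofReal_mul (by positivity),
        ← ENNReal.ofReal_mul (by positivity), ← Real.rpow_natCast, ← Real.rpow_mul (by norm_num),
        ← Real.rpow_add (by norm_num), ← Real.rpow_add (by norm_num)]
      refine ENNReal.ofReal_le_ofReal (Real.rpow_le_rpow_of_exponent_le (by norm_num) ?_)
      rw [window, Finset.mem_Ico] at hj
      have hj2 : (j : ℝ) ≤ M + (d + 1 : ℕ) := by exact_mod_cast Nat.lt_succ_iff.1 hj.2
      rw [Nat.cast_sub hMle]
      nlinarith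
    rw [hS, Finset.mul_sum]
    refine (Finset.sum_le_sum h3).trans ?_
    rw [← Finset.mul_sum, mul_assoc]
    gcongr
    have himg : window d M ⊆ (Finset.range (d + 3)).image fun b => M + b - 1 := by
      intro j hj
      rw [window, Finset.mem_Ico] at hj
      rw [Finset.mem_image]
      exact ⟨j + 1 - M, Finset.mem_range.2 (by omega), by omega⟩
    refine (Finset.sum_le_sum_of_subset himg).trans ?_
    exact Finset.sum_image_le_of_nonneg (fun _ _ => zero_le)
  rw [enorm_mul, hw]
  have hcoe : ((C * ((2 : ℝ) ^ (-(((d + 1 : ℕ) : ℝ) * t))).toNNReal : ℝ≥0) : ℝ≥0∞) =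
      C * ENNReal.ofReal ((2 : ℝ) ^ (-(((d + 1 : ℕ) : ℝ) * t))) := by
    rw [ENNReal.coe_mul]
    rfl
  rw [hcoe]
  calc ENNReal.ofReal (2 ^ (((∑ i, k i : ℕ) : ℝ) * t)) *
        ‖multiplier (Ψ.symbol k) f (WithLp.toLp 2 x)‖ₑ
      ≤ ENNReal.ofReal (2 ^ (((∑ i, k i : ℕ) : ℝ) * t)) *
        (C * kernelOp volume (productKernel k) (fun z => S (WithLp.toLp 2 z)) x) := by gcongr
    _ = C * kernelOp volume (productKernel k) (fun z =>
        ENNReal.ofReal (2 ^ (((∑ i, k i : ℕ) : ℝ) * t)) * S (WithLp.toLp 2 z)) x := by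
        rw [mul_left_comm, kernelOp, kernelOp, ← lintegral_const_mul' _ _ ENNReal.ofReal_ne_top]
        congr 2
        funext z
        ring
    _ ≤ C * kernelOp volume (productKernel k) (fun z =>
        ENNReal.ofReal ((2 : ℝ) ^ (-(((d + 1 : ℕ) : ℝ) * t))) *
        (ENNReal.ofReal (2 ^ t) ^ ((∑ i, k i) - M) * ∑ b ∈ Finset.range (d + 3),
          ‖(((2 : ℝ) ^ (((M + b - 1 : ℕ) : ℝ) * t) : ℝ) : ℂ) *
            multiplier (Φ.symbol (M + b - 1)) f (WithLp.toLp 2 z)‖ₑ)) x := by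
        refine mul_le_mul_right (lintegral_mono fun z => ?_) _
        exact mul_le_mul_right (h2 _) _
    _ = _ := by
        rw [mul_assoc]
        congr 1
        rw [kernelOp, kernelOp, ← lintegral_const_mul' _ _ ENNReal.ofReal_ne_top]
        congr 1
        funext z
        ring

lemma measurable_enorm_mul_multiplier (m : Symbol d) (f : 𝓢'(Rd d, ℂ)) (c : ℂ) :
    Measurable fun z : Fin d → ℝ => ‖c * multiplier m f (WithLp.toLp 2 z)‖ₑ := by
  have h := (continuous_multiplier m f).comp (PiLp.continuous_toLp 2 (fun _ : Fin d => ℝ))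
  exact (continuous_const.mul h).enorm.measurable

theorem embeds_isoNorm_mixedNorm [NeZero d] {t : ℝ} (ht : t < 0) (Φ : IsoGenerator d)
    (Ψ : MixedGenerator) {p q : ℝ≥0∞} (hp : 1 < p) (hp' : p < ⊤) (hq : 1 ≤ q) :
    Embeds (isoNorm Φ t p q) (mixedNorm (d := d) Ψ t p q) := by
  have hp1 : 1 < p.toReal := by
    rw [← ENNReal.toReal_one]
    exact (ENNReal.toReal_lt_toReal ENNReal.one_ne_top hp'.ne).2 hp
  have hpos : 0 < p.toReal := by linarith
  have hpne : p ≠ 0 := (zero_lt_one.trans hp).ne'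
  have hqne : q ≠ 0 := (zero_lt_one.trans_le hq).ne'
  have hr : ENNReal.ofReal ((2 : ℝ) ^ t) < 1 := by
    rw [ENNReal.ofReal_lt_one]
    exact Real.rpow_lt_one_of_one_lt_of_neg (by norm_num) ht
  obtain ⟨C₁, h₁⟩ := exists_enorm_multiplier_symbol_le ht Φ Ψ
  obtain ⟨C₂, h₂⟩ := exists_lq_weighted_le (d := d) hq hr (d + 3)
  obtain ⟨N, hN⟩ := exists_isDominated_productKernel d
  obtain ⟨C₃, h₃⟩ := hN.exists_lintegral_lq_rpow_le
    (fun p hp => ENNReal.pow_ne_top (bellMaxConst_ne_top hp)) hp1 hq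
  have key : ∀ f ∈ finiteSpace (isoNorm Φ t p q), mixedNorm Ψ t p q f ≤
      ((C₁ * (C₃ ^ (1 / p.toReal) * C₂) : ℝ≥0) : ℝ≥0∞) * isoNorm Φ t p q f := by
    intro f hf
    rw [finiteSpace, mem_ofPred_eq] at hf
    rw [isoNorm, LpLqNorm_eq hpne hp'.ne] at hf ⊢
    rw [mixedNorm, LpLqNorm_eq hpne hp'.ne]
    set a : ℕ → (Fin d → ℝ) → ℝ≥0∞ := fun j x =>
      ‖(((2 : ℝ) ^ ((j : ℝ) * t) : ℝ) : ℂ) * multiplier (Φ.symbol j) f (WithLp.toLp 2 x)‖ₑ with ha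
    have ham : ∀ j, Measurable (a j) := fun j => measurable_enorm_mul_multiplier _ _ _
    set G : (Fin d → ℕ) → (Fin d → ℝ) → ℝ≥0∞ := fun k x =>
      ENNReal.ofReal (2 ^ t) ^ ((∑ i, k i) - maxIndex k) *
        ∑ b ∈ Finset.range (d + 3), a (maxIndex k + b - 1) x with hG
    have hGm : ∀ k, Measurable (G k) := fun k =>
      (Finset.measurable_sum _ fun b _ => ham _).const_mul _
    have hfin : ∫⁻ x, lq q (fun j => a j x) ^ p.toReal ≠ ⊤ := by
      intro h
      rw [h, ENNReal.top_rpow_of_pos (by positivity)] at hf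
      exact lt_irrefl _ hf
    have hGle : ∫⁻ x, lq q (fun k => G k x) ^ p.toReal ≤
        C₂ ^ p.toReal * ∫⁻ x, lq q (fun j => a j x) ^ p.toReal := by
      rw [← lintegral_const_mul' _ _ (ENNReal.rpow_ne_top_of_nonneg hpos.le ENNReal.coe_ne_top)]
      refine lintegral_mono fun x => ?_
      rw [← ENNReal.mul_rpow_of_nonneg _ _ hpos.le]
      exact ENNReal.rpow_le_rpow (h₂ fun j => a j x) hpos.le
    have hGfin : ∫⁻ x, lq q (fun k => G k x) ^ p.toReal ≠ ⊤ :=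
      ne_top_of_le_ne_top (ENNReal.mul_ne_top
        (ENNReal.rpow_ne_top_of_nonneg hpos.le ENNReal.coe_ne_top) hfin) hGle
    have hmain : ∫⁻ x : Fin d → ℝ, lq q (fun k : Fin d → ℕ =>
        ‖(((2 : ℝ) ^ (((∑ i, k i : ℕ) : ℝ) * t) : ℝ) : ℂ) *
          multiplier (Ψ.symbol k) f (WithLp.toLp 2 x)‖ₑ) ^ p.toReal ≤
        C₁ ^ p.toReal * (C₃ * (C₂ ^ p.toReal * ∫⁻ x, lq q (fun j => a j x) ^ p.toReal)) := by
      calc _ ≤ ∫⁻ x : Fin d → ℝ, C₁ ^ p.toReal *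
            lq q (fun k => kernelOp volume (productKernel k) (G k) x) ^ p.toReal := by
            refine lintegral_mono fun x => ?_
            rw [← ENNReal.mul_rpow_of_nonneg _ _ hpos.le, ← lq_const_mul hqne]
            exact ENNReal.rpow_le_rpow (lq_mono q fun k => h₁ f k x) hpos.le
        _ = C₁ ^ p.toReal * ∫⁻ x : Fin d → ℝ,
            lq q (fun k => kernelOp volume (productKernel k) (G k) x) ^ p.toReal :=
            lintegral_const_mul' _ _ (ENNReal.rpow_ne_top_of_nonneg hpos.le ENNReal.coe_ne_top)
        _ ≤ _ := by
            gcongr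
            refine (h₃ G hGm hGfin).trans ?_
            gcongr
    refine (ENNReal.rpow_le_rpow hmain (by positivity)).trans_eq ?_
    have h0 : 0 ≤ 1 / p.toReal := by positivity
    have hinv : ∀ c : ℝ≥0∞, (c ^ p.toReal) ^ (1 / p.toReal) = c := by
      intro c
      rw [← ENNReal.rpow_mul, mul_one_div_cancel hpos.ne', ENNReal.rpow_one]
    rw [ENNReal.mul_rpow_of_nonneg _ _ h0, ENNReal.mul_rpow_of_nonneg _ _ h0,
      ENNReal.mul_rpow_of_nonneg _ _ h0, hinv, hinv, ENNReal.coe_mul, ENNReal.coe_mul,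
      ENNReal.coe_rpow_of_nonneg _ h0]
    ring
  refine ⟨fun f hf => ?_, _, key⟩
  rw [finiteSpace, mem_ofPred_eq]
  exact (key f hf).trans_lt (ENNReal.mul_lt_top ENNReal.coe_lt_top hf)

end LizorkinTriebel


namespace LizorkinTriebel

/-! ### Functions with prescribed spectrum -/

section Synthesis

variable {V : Type*} [NormedAddCommGroup V] [InnerProductSpace ℝ V] [FiniteDimensional ℝ V]
  [MeasurableSpace V] [BorelSpace V]

/-- The inverse Fourier transform `(2π)^{-n} ∫ e^{i x·ξ} u(ξ) dξ`, after the substitution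
`ξ = 2πη`. -/
noncomputable def synth (u : V → ℂ) : V → ℂ := 𝓕⁻ fun η => u ((2 * Real.pi) • η)

lemma synth_apply (u : V → ℂ) (x : V) :
    synth u x = ∫ η, Complex.exp (((2 * Real.pi * inner ℝ x η : ℝ) : ℂ) * Complex.I) *
      u ((2 * Real.pi) • η) := by
  rw [synth, Real.fourierInv_eq']
  simp_rw [real_inner_comm x, smul_eq_mul]

lemma enorm_synth_comp_sub (u : V → ℂ) (b x : V) :
    ‖synth (fun ξ => u (ξ - b)) x‖ₑ = ‖synth u x‖ₑ := by
  have hpi : (2 * Real.pi) ≠ 0 := by positivity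
  have h : synth (fun ξ => u (ξ - b)) x =
      Complex.exp (((inner ℝ x b : ℝ) : ℂ) * Complex.I) * synth u x := by
    rw [synth_apply, synth_apply, ← integral_const_mul,
      ← integral_add_right_eq_self _ ((2 * Real.pi)⁻¹ • b)]
    refine integral_congr_ae (Filter.Eventually.of_forall fun η => ?_)
    simp only []
    rw [smul_add, smul_inv_smul₀ hpi, add_sub_cancel_right, ← mul_assoc, ← Complex.exp_add,
      inner_add_right, inner_smul_right]
    congr 2
    have hpi' : (Real.pi : ℂ) ≠ 0 := by exact_mod_cast Real.pi_ne_zero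
    push_cast
    field_simp
    ring
  rw [h, enorm_mul, ← ofReal_norm, Complex.norm_exp_ofReal_mul_I]
  simp

lemma synth_comp_inv_smul (u : V → ℂ) {a : ℝ} (ha : 0 < a) (x : V) :
    synth (fun ξ => u (a⁻¹ • ξ)) x = (a : ℂ) ^ Module.finrank ℝ V * synth u (a • x) := by
  rw [synth_apply, synth_apply]
  have := Measure.integral_comp_inv_smul_of_nonneg (volume : Measure V) (fun η : V =>
    Complex.exp (((2 * Real.pi * inner ℝ (a • x) η : ℝ) : ℂ) * Complex.I) *
      u ((2 * Real.pi) • η)) ha.le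
  rw [Complex.real_smul] at this
  push_cast at this
  push_cast
  rw [← this]
  refine integral_congr_ae (Filter.Eventually.of_forall fun η => ?_)
  simp only [inner_smul_left, inner_smul_right, smul_comm (2 * Real.pi) a⁻¹ η]
  congr 5
  have ha' : (a : ℂ) ≠ 0 := by exact_mod_cast ha.ne'
  simp
  field_simp

/-- The Schwartz function `synth u` for a test function `u`. -/
lemma exists_schwartz_eq_synth {u : V → ℂ} (hu : ContDiff ℝ ∞ u) (hc : HasCompactSupport u) :
    ∃ θ : 𝓢(V, ℂ), ∀ x, θ x = synth u x := by
  refine ⟨𝓕⁻ (HasCompactSupport.toSchwartzMap (f := fun η : V => u ((2 * Real.pi) • η))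
    (hc.comp_smul (by positivity)) (hu.comp (contDiff_const_smul _))), fun x => ?_⟩
  rw [SchwartzMap.fourierInv_coe]
  rfl

lemma continuous_synth {u : V → ℂ} (hu : ContDiff ℝ ∞ u) (hc : HasCompactSupport u) :
    Continuous (synth u) := by
  obtain ⟨θ, hθ⟩ := exists_schwartz_eq_synth hu hc
  rw [← funext hθ]
  exact θ.continuous

lemma lintegral_synth_rpow_lt_top {u : V → ℂ} (hu : ContDiff ℝ ∞ u) (hc : HasCompactSupport u)
    {p : ℝ} (hp : 0 < p) : ∫⁻ x, ‖synth u x‖ₑ ^ p < ⊤ := by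
  obtain ⟨θ, hθ⟩ := exists_schwartz_eq_synth hu hc
  have h := lintegral_rpow_enorm_lt_top_of_eLpNorm_lt_top (f := θ) (p := ENNReal.ofReal p)
    (by simpa using hp) ENNReal.ofReal_ne_top (θ.eLpNorm_lt_top _ volume)
  rw [ENNReal.toReal_ofReal hp.le] at h
  simpa only [hθ] using h

lemma exists_synth_ne_zero {u : V → ℂ} (hu : ContDiff ℝ ∞ u) (hc : HasCompactSupport u)
    {ξ : V} (hξ : u ξ ≠ 0) : ∃ x, synth u x ≠ 0 := by
  by_contra! h
  set θ : 𝓢(V, ℂ) := HasCompactSupport.toSchwartzMap (f := fun η : V => u ((2 * Real.pi) • η))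
    (hc.comp_smul (by positivity)) (hu.comp (contDiff_const_smul _)) with hθ
  have h0 : 𝓕⁻ θ = 0 := by
    ext x
    rw [SchwartzMap.fourierInv_coe]
    exact h x
  have h1 : θ = 0 := by
    have h : 𝓕 (𝓕⁻ θ) = θ := FourierTransform.fourier_fourierInv_eq θ
    rw [← h, h0]
    exact (FourierTransform.fourierCLE ℂ 𝓢(V, ℂ)).map_zero
  apply hξ
  have h2 : θ ((2 * Real.pi)⁻¹ • ξ) = u ξ := by
    change u ((2 * Real.pi) • (2 * Real.pi)⁻¹ • ξ) = u ξ
    rw [smul_inv_smul₀ (by positivity)]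
  rw [← h2, h1]
  rfl

end Synthesis

lemma synth_prod {d : ℕ} (u : Fin d → ℝ → ℂ) (x : Rd d) :
    synth (fun ξ : Rd d => ∏ i, u i (ξ i)) x = ∏ i, synth (u i) (x i) := by
  rw [synth_apply]
  simp only [synth_apply]
  rw [← integral_fintype_prod_volume_eq_prod, ← (PiLp.volume_preserving_toLp (Fin d)).integral_comp
    (MeasurableEquiv.toLp 2 (Fin d → ℝ)).measurableEmbedding]
  refine integral_congr_ae (Filter.Eventually.of_forall fun v => ?_)
  simp only [Finset.prod_mul_distrib, ← Complex.exp_sum]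
  congr 2
  rw [← Finset.sum_mul, PiLp.inner_apply]
  push_cast
  rw [Finset.mul_sum]

section Lacunary

variable {d : ℕ}

/-- Distributions whose Fourier transform is a sum of bumps in disjoint dyadic annuli. -/
lemma exists_lacunary {g : ℕ → Rd d → ℝ} (hgc : ∀ j, Continuous (g j)) (hg0 : ∀ j ξ, 0 ≤ g j ξ)
    (hg1 : ∀ j ξ, g j ξ ≤ 1) {a : ℕ}
    (hgs : ∀ j ξ, g j ξ ≠ 0 → 3 / 4 * 2 ^ (j + a) < ‖ξ‖ ∧ ‖ξ‖ ≤ 2 ^ (j + a)) (σ : ℝ) :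
    ∃ f : 𝓢'(Rd d, ℂ), ∀ (m : Symbol d) (l : ℕ),
      (∀ j, j ≠ l → ∀ ξ, g j ξ ≠ 0 → m.toFun ξ = 0) → ∀ x,
        multiplier m f x = ((2 : ℝ) ^ (σ * l) : ℝ) * synth (fun ξ => g l ξ * m.toFun ξ) x := by
  have huniq : ∀ j k ξ, g j ξ ≠ 0 → g k ξ ≠ 0 → j = k := by
    have haux : ∀ j k ξ, g j ξ ≠ 0 → g k ξ ≠ 0 → ¬ j < k := by
      intro j k ξ hj hk hjk
      have h1 := (hgs j ξ hj).2
      have h2 := (hgs k ξ hk).1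
      have h3 : (2 : ℝ) ^ (j + a + 1) ≤ 2 ^ (k + a) := pow_le_pow_right₀ (by norm_num) (by omega)
      rw [pow_succ] at h3
      have h4 : (0 : ℝ) < 2 ^ (j + a) := by positivity
      linarith
    intro j k ξ hj hk
    exact le_antisymm (not_lt.1 (haux k j ξ hk hj)) (not_lt.1 (haux j k ξ hj hk))
  set c : ℕ → ℝ := fun j => (2 : ℝ) ^ (σ * j) with hc
  have hc0 : ∀ j, 0 ≤ c j := fun j => by positivity
  set A : Rd d → ℝ≥0∞ := fun η => ∑' j, ENNReal.ofReal (c j * g j ((2 * Real.pi) • η)) with hA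
  have hAm : Measurable A := Measurable.tsum fun j =>
    (continuous_const.mul ((hgc j).comp (continuous_const_smul _))).measurable.ennreal_ofReal
  have hA1 : ∀ η j, g j ((2 * Real.pi) • η) ≠ 0 →
      A η = ENNReal.ofReal (c j * g j ((2 * Real.pi) • η)) := by
    intro η j hj
    refine tsum_eq_single j fun k hk => ?_
    have : g k ((2 * Real.pi) • η) = 0 := by
      by_contra h
      exact hk (huniq k j _ h hj)
    simp [this]
  have hA0 : ∀ η, (∀ j, g j ((2 * Real.pi) • η) = 0) → A η = 0 := by
    intro η h
    simp [hA, h]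
  obtain ⟨n, hn⟩ := exists_nat_ge σ
  have hAle : ∀ η, A η ≤ ENNReal.ofReal (10 ^ n * (1 + ‖η‖) ^ n) := by
    intro η
    by_cases h : ∀ j, g j ((2 * Real.pi) • η) = 0
    · rw [hA0 η h]
      exact zero_le
    · push Not at h
      obtain ⟨j, hj⟩ := h
      rw [hA1 η j hj]
      refine ENNReal.ofReal_le_ofReal ((mul_le_of_le_one_right (hc0 j) (hg1 _ _)).trans ?_)
      have h1 := (hgs j _ hj).1
      rw [norm_smul, Real.norm_of_nonneg (by positivity)] at h1
      have h2 : (2 : ℝ) ^ j ≤ 2 ^ (j + a) := pow_le_pow_right₀ (by norm_num) (by omega)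
      have h3 : (2 : ℝ) ^ j ≤ 10 * (1 + ‖η‖) := by
        have := Real.pi_lt_d2
        nlinarith [norm_nonneg η]
      rw [← mul_pow]
      refine le_trans ?_ (pow_le_pow_left₀ (by positivity) h3 n)
      rw [hc, ← pow_mul, ← Real.rpow_natCast]
      refine Real.rpow_le_rpow_of_exponent_le (by norm_num) ?_
      push_cast
      rw [mul_comm]
      gcongr
  have hAlt : ∀ η, A η < ⊤ := fun η => (hAle η).trans_lt ENNReal.ofReal_lt_top
  have : (volume.withDensity A).HasTemperateGrowth := by
    obtain ⟨N, hN⟩ := (inferInstance : (volume : Measure (Rd d)).HasTemperateGrowth)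
    refine ⟨⟨N + n, ?_⟩⟩
    rw [integrable_withDensity_iff hAm (Filter.Eventually.of_forall hAlt)]
    refine (hN.const_mul (10 ^ n)).mono' ?_ (Filter.Eventually.of_forall fun η => ?_)
    · refine (Measurable.mul ?_ hAm.ennreal_toReal).aestronglyMeasurable
      exact (measurable_const.add measurable_norm).pow_const _
    · have h1 : (A η).toReal ≤ 10 ^ n * (1 + ‖η‖) ^ n :=
        ENNReal.toReal_le_of_le_ofReal (by positivity) (hAle η)
      rw [Real.norm_of_nonneg (by positivity)]
      have h0 : 0 < 1 + ‖η‖ := by positivity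
      calc (1 + ‖η‖) ^ (-((N + n : ℕ) : ℝ)) * (A η).toReal
          ≤ (1 + ‖η‖) ^ (-((N + n : ℕ) : ℝ)) * (10 ^ n * (1 + ‖η‖) ^ n) := by gcongr
        _ = 10 ^ n * ((1 + ‖η‖) ^ (-((N + n : ℕ) : ℝ)) * (1 + ‖η‖) ^ (n : ℝ)) := by
            rw [Real.rpow_natCast]
            ring
        _ = 10 ^ n * (1 + ‖η‖) ^ (-(N : ℝ)) := by
            rw [← Real.rpow_add h0]
            congr 2
            push_cast
            ring
  refine ⟨𝓕⁻ ((volume.withDensity A).toTemperedDistribution), fun m l hm x => ?_⟩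
  rw [multiplier, FourierTransform.fourier_fourierInv_eq]
  refine (Measure.toTemperedDistribution_apply (volume.withDensity A) (m.wave x)).trans ?_
  rw [integral_withDensity_eq_integral_toReal_smul hAm (Filter.Eventually.of_forall hAlt),
    synth_apply, ← integral_const_mul]
  refine integral_congr_ae (Filter.Eventually.of_forall fun η => ?_)
  simp only [Symbol.wave_apply]
  by_cases h : m.toFun ((2 * Real.pi) • η) = 0
  · simp [h]
  · have hz : ∀ j, j ≠ l → g j ((2 * Real.pi) • η) = 0 := by
      intro j hj
      by_contra h'
      exact h (hm j hj _ h')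
    have hAη : (A η).toReal = c l * g l ((2 * Real.pi) • η) := by
      have : A η = ENNReal.ofReal (c l * g l ((2 * Real.pi) • η)) :=
        tsum_eq_single l fun k hk => by simp [hz k hk]
      rw [this, ENNReal.toReal_ofReal (mul_nonneg (hc0 l) (hg0 _ _))]
    rw [hAη, Complex.real_smul, hc]
    push_cast
    ring

end Lacunary

end LizorkinTriebel


namespace LizorkinTriebel

/-! ### Dyadic decompositions and `ℓ_q` quasi-norms of lacunary families -/

lemma dyadic_eq_ite {V : Type*} [NormedAddCommGroup V] [NormedSpace ℝ V] {φ₀ : V → ℂ}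
    (h₁ : ∀ x, ‖x‖ ≤ 1 → φ₀ x = 1) (h₀ : ∀ x, 3 / 2 < ‖x‖ → φ₀ x = 0) {j : ℕ} {x : V}
    (hx : j = 0 ∨ 3 / 4 * 2 ^ j < ‖x‖) (hx' : ‖x‖ ≤ 2 ^ j) (k : ℕ) :
    dyadic φ₀ k x = if k = j then 1 else 0 := by
  have h : ∀ n : ℕ, φ₀ (((2 : ℝ) ^ n)⁻¹ • x) = if j ≤ n then 1 else 0 := by
    intro n
    have hn : ‖((2 : ℝ) ^ n)⁻¹ • x‖ = ‖x‖ / 2 ^ n := by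
      rw [norm_smul, norm_inv, Real.norm_of_nonneg (by positivity)]
      ring
    split_ifs with hjn
    · refine h₁ _ ?_
      rw [hn, div_le_one (by positivity)]
      exact hx'.trans (pow_le_pow_right₀ (by norm_num) hjn)
    · refine h₀ _ ?_
      have h2 : (2 : ℝ) ^ (n + 1) ≤ 2 ^ j := pow_le_pow_right₀ (by norm_num) (by omega)
      rw [pow_succ] at h2
      have h3 := hx.resolve_left (by omega)
      rw [hn, lt_div_iff₀ (by positivity)]
      linarith
  cases k with
  | zero =>
    have := h 0
    rw [pow_zero, inv_one, one_smul] at this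
    rw [dyadic, this]
    exact if_congr (by omega) rfl rfl
  | succ k =>
    simp only [dyadic, h]
    by_cases h1 : j ≤ k
    · simp [h1, show j ≤ k + 1 by omega, show k + 1 ≠ j by omega]
    · by_cases h2 : k + 1 = j
      · simp [h1, h2]
      · simp [h1, h2, show ¬ j ≤ k + 1 by omega]

lemma IsoGenerator.symbol_eq_ite {d : ℕ} (Φ : IsoGenerator d) {j : ℕ} {ξ : Rd d}
    (hξ : 3 / 4 * 2 ^ j < ‖ξ‖) (hξ' : ‖ξ‖ ≤ 2 ^ j) (k : ℕ) :
    (Φ.symbol k).toFun ξ = if k = j then 1 else 0 :=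
  dyadic_eq_ite (fun x hx => by simp [Φ.eq_one x hx]) (fun x hx => by simp [Φ.eq_zero x hx.le])
    (Or.inr hξ) hξ' k

lemma MixedGenerator.dyadic_eq_ite (Ψ : MixedGenerator) {j : ℕ} {s : ℝ}
    (hs : j = 0 ∨ 3 / 4 * 2 ^ j < |s|) (hs' : |s| ≤ 2 ^ j) (k : ℕ) :
    dyadic Ψ.φ₀ k s = if k = j then 1 else 0 :=
  LizorkinTriebel.dyadic_eq_ite (fun _ hx => Ψ.φ₀_eq_one hx) (fun _ hx => Ψ.φ₀_eq_zero hx) hs hs' k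

lemma MixedGenerator.symbol_eq_ite {d : ℕ} (Ψ : MixedGenerator) {j : Fin d → ℕ} {ξ : Rd d}
    (hξ : ∀ i, j i = 0 ∨ 3 / 4 * 2 ^ (j i) < |ξ i|) (hξ' : ∀ i, |ξ i| ≤ 2 ^ (j i))
    (k : Fin d → ℕ) : (Ψ.symbol k).toFun ξ = if k = j then 1 else 0 := by
  have h : (Ψ.symbol k).toFun ξ = ∏ i, if k i = j i then 1 else 0 := by
    change ∏ i, dyadic Ψ.φ₀ (k i) (ξ i) = _
    exact Finset.prod_congr rfl fun i _ => Ψ.dyadic_eq_ite (hξ i) (hξ' i) (k i)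
  rw [h]
  split_ifs with hk
  · simp [hk]
  · obtain ⟨i, hi⟩ := Function.ne_iff.1 hk
    exact Finset.prod_eq_zero (Finset.mem_univ i) (if_neg hi)

lemma le_lq {ι : Type*} {q : ℝ≥0∞} (hq : q ≠ 0) (a : ι → ℝ≥0∞) (i : ι) : a i ≤ lq q a := by
  unfold lq
  split_ifs with h
  · exact le_iSup a i
  · have h0 : 0 < q.toReal := ENNReal.toReal_pos hq h
    calc a i = (a i ^ q.toReal) ^ (1 / q.toReal) := by
          rw [← ENNReal.rpow_mul, mul_one_div_cancel h0.ne', ENNReal.rpow_one]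
      _ ≤ _ := ENNReal.rpow_le_rpow (ENNReal.le_tsum i) (by positivity)

lemma lq_comp_of_injective {ι ι' : Type*} {q : ℝ≥0∞} (hq : q ≠ 0) {κ : ι' → ι}
    (hκ : Function.Injective κ) {a : ι → ℝ≥0∞} (ha : ∀ i, i ∉ range κ → a i = 0) :
    lq q a = lq q fun j => a (κ j) := by
  unfold lq
  split_ifs with h
  · refine le_antisymm (iSup_le fun i => ?_) (iSup_comp_le a κ)
    by_cases hi : i ∈ range κ
    · obtain ⟨j, rfl⟩ := hi
      exact le_iSup (fun j => a (κ j)) j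
    · rw [ha i hi]
      exact zero_le
  · have h0 : 0 < q.toReal := ENNReal.toReal_pos hq h
    congr 1
    refine (hκ.tsum_eq (f := fun i => a i ^ q.toReal) fun i hi => ?_).symm
    by_contra hi'
    exact hi (by simp [ha i hi', h0])

lemma ofReal_two_rpow_add_mul (α β : ℝ) (j : ℕ) :
    ENNReal.ofReal ((2 : ℝ) ^ (α + β * j)) =
      ENNReal.ofReal (2 ^ α) * ENNReal.ofReal (2 ^ β) ^ j := by
  rw [← ENNReal.ofReal_pow (by positivity), ← ENNReal.ofReal_mul (by positivity),
    Real.rpow_add (by norm_num), ← Real.rpow_natCast, ← Real.rpow_mul (by norm_num)]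

lemma ofReal_two_rpow_rpow (α : ℝ) {p : ℝ} (hp : 0 ≤ p) :
    ENNReal.ofReal ((2 : ℝ) ^ α) ^ p = ENNReal.ofReal (2 ^ (α * p)) := by
  rw [ENNReal.ofReal_rpow_of_nonneg (by positivity) hp, ← Real.rpow_mul (by norm_num)]

lemma tsum_ofReal_two_rpow_lt_top (α : ℝ) {β : ℝ} (hβ : β < 0) :
    ∑' j : ℕ, ENNReal.ofReal ((2 : ℝ) ^ (α + β * j)) < ⊤ := by
  simp_rw [ofReal_two_rpow_add_mul, ENNReal.tsum_mul_left, ENNReal.tsum_geometric]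
  refine ENNReal.mul_lt_top ENNReal.ofReal_lt_top ?_
  rw [ENNReal.inv_lt_top, tsub_pos_iff_lt, ENNReal.ofReal_lt_one]
  exact Real.rpow_lt_one_of_one_lt_of_neg (by norm_num) hβ

lemma eq_top_of_forall_two_rpow_mul_le {α β : ℝ} (hβ : 0 < β) {c M : ℝ≥0∞} (hc : c ≠ 0) {n : ℕ}
    (h : ∀ j : ℕ, n ≤ j → ENNReal.ofReal ((2 : ℝ) ^ (α + β * j)) * c ≤ M) : M = ⊤ := by
  have h1 : Filter.Tendsto (fun j : ℕ => ENNReal.ofReal ((2 : ℝ) ^ β) ^ j) Filter.atTop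
      (nhds ⊤) := by
    rw [ENNReal.tendsto_pow_atTop_nhds_top_iff, ENNReal.one_lt_ofReal]
    exact Real.one_lt_rpow (by norm_num) hβ
  have h2 : Filter.Tendsto (fun j : ℕ => ENNReal.ofReal ((2 : ℝ) ^ (α + β * j)) * c) Filter.atTop
      (nhds ⊤) := by
    simp_rw [ofReal_two_rpow_add_mul]
    have h3 := ENNReal.Tendsto.const_mul (a := ENNReal.ofReal (2 ^ α)) h1
      (Or.inl ENNReal.top_ne_zero)
    rw [ENNReal.mul_top (by positivity)] at h3
    have h4 := ENNReal.Tendsto.mul_const (b := c) h3 (Or.inl ENNReal.top_ne_zero)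
    rwa [ENNReal.top_mul hc] at h4
  exact top_le_iff.1 (le_of_tendsto h2 (Filter.eventually_atTop.2 ⟨n, h⟩))

/-- A weighted comparison of `ℓ_q` with `ℓ_p`. -/
lemma exists_lq_rpow_le {q : ℝ≥0∞} (hq : q ≠ 0) {p : ℝ} (hp : 0 < p) {ε : ℝ} (hε : 0 < ε) :
    ∃ C : ℝ≥0∞, C ≠ ⊤ ∧ ∀ a : ℕ → ℝ≥0∞,
      lq q a ^ p ≤ C * ∑' j : ℕ, (ENNReal.ofReal ((2 : ℝ) ^ (ε * j)) * a j) ^ p := by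
  suffices H : ∃ C : ℝ≥0∞, C ≠ ⊤ ∧ ∀ (a : ℕ → ℝ≥0∞) (S : ℝ≥0∞),
      (∀ j : ℕ, ENNReal.ofReal ((2 : ℝ) ^ (ε * j)) * a j ≤ S) → lq q a ≤ C * S by
    obtain ⟨C, hC, H⟩ := H
    refine ⟨C ^ p, ENNReal.rpow_ne_top_of_nonneg hp.le hC, fun a => ?_⟩
    have hS : ∀ j : ℕ, ENNReal.ofReal ((2 : ℝ) ^ (ε * j)) * a j ≤
        (∑' j : ℕ, (ENNReal.ofReal ((2 : ℝ) ^ (ε * j)) * a j) ^ p) ^ (1 / p) := by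
      intro j
      calc _ = ((ENNReal.ofReal ((2 : ℝ) ^ (ε * j)) * a j) ^ p) ^ (1 / p) := by
            rw [← ENNReal.rpow_mul, mul_one_div_cancel hp.ne', ENNReal.rpow_one]
        _ ≤ _ := ENNReal.rpow_le_rpow (ENNReal.le_tsum j) (by positivity)
    refine (ENNReal.rpow_le_rpow (H a _ hS) hp.le).trans_eq ?_
    rw [ENNReal.mul_rpow_of_nonneg _ _ hp.le, ← ENNReal.rpow_mul, one_div_mul_cancel hp.ne',
      ENNReal.rpow_one]
  have hle : ∀ (a : ℕ → ℝ≥0∞) (S : ℝ≥0∞),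
      (∀ j : ℕ, ENNReal.ofReal ((2 : ℝ) ^ (ε * j)) * a j ≤ S) →
      ∀ j : ℕ, a j ≤ ENNReal.ofReal ((2 : ℝ) ^ (0 + -ε * j)) * S := by
    intro a S h j
    calc a j = ENNReal.ofReal ((2 : ℝ) ^ (0 + -ε * j)) *
          (ENNReal.ofReal ((2 : ℝ) ^ (ε * j)) * a j) := by
          rw [← mul_assoc, ← ENNReal.ofReal_mul (by positivity), ← Real.rpow_add (by norm_num)]
          simp
      _ ≤ _ := by gcongr; exact h j
  by_cases hqt : q = ⊤
  · refine ⟨1, ENNReal.one_ne_top, fun a S h => ?_⟩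
    rw [lq, if_pos hqt, one_mul]
    refine iSup_le fun j => (hle a S h j).trans ?_
    refine mul_le_of_le_one_left zero_le ?_
    rw [ENNReal.ofReal_le_one]
    refine Real.rpow_le_one_of_one_le_of_nonpos (by norm_num) ?_
    have : 0 ≤ ε * j := by positivity
    linarith
  · have h0 : 0 < q.toReal := ENNReal.toReal_pos hq hqt
    refine ⟨(∑' j : ℕ, ENNReal.ofReal ((2 : ℝ) ^ (0 + -(ε * q.toReal) * j))) ^ (1 / q.toReal),
      ENNReal.rpow_ne_top_of_nonneg (by positivity)
        (tsum_ofReal_two_rpow_lt_top 0 (neg_lt_zero.2 (by positivity))).ne, fun a S h => ?_⟩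
    rw [lq, if_neg hqt]
    calc _ ≤ (∑' j : ℕ, ENNReal.ofReal ((2 : ℝ) ^ (0 + -(ε * q.toReal) * j)) * S ^ q.toReal) ^
          (1 / q.toReal) := by
          refine ENNReal.rpow_le_rpow (ENNReal.tsum_le_tsum fun j => ?_) (by positivity)
          refine (ENNReal.rpow_le_rpow (hle a S h j) h0.le).trans_eq ?_
          rw [ENNReal.mul_rpow_of_nonneg _ _ h0.le, ofReal_two_rpow_rpow _ h0.le]
          congr 3
          ring
      _ = _ := by
          rw [ENNReal.tsum_mul_right, ENNReal.mul_rpow_of_nonneg _ _ (by positivity),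
            ← ENNReal.rpow_mul, mul_one_div_cancel h0.ne', ENNReal.rpow_one]

lemma LpLqNorm_lt_top_iff {d : ℕ} {ι : Type*} {p : ℝ≥0∞} (hp : p ≠ 0) (hp' : p ≠ ⊤) (q : ℝ≥0∞)
    (g : ι → Rd d → ℂ) :
    LpLqNorm p q g < ⊤ ↔ ∫⁻ x, lq q (fun i => ‖g i x‖ₑ) ^ p.toReal < ⊤ := by
  have h0 : 0 < p.toReal := ENNReal.toReal_pos hp hp'
  rw [LpLqNorm, eLpNorm_eq_lintegral_rpow_enorm_toReal hp hp',
    ENNReal.rpow_lt_top_iff_of_pos (by positivity)]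
  rfl

lemma enorm_ofReal_two_rpow (s : ℝ) : ‖(((2 : ℝ) ^ s : ℝ) : ℂ)‖ₑ = ENNReal.ofReal (2 ^ s) := by
  rw [← ofReal_norm, Complex.norm_real, Real.norm_of_nonneg (by positivity)]

/-! ### The mixed space is not contained in the isotropic one -/

theorem not_finiteSpace_mixedNorm_subset {d : ℕ} (hd : 2 ≤ d) {t : ℝ} (ht : t < 0)
    (Φ : IsoGenerator d) (Ψ : MixedGenerator) {p q : ℝ≥0∞} (hp : p ≠ 0) (hp' : p ≠ ⊤)
    (hq : q ≠ 0) :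
    ¬ finiteSpace (mixedNorm (d := d) Ψ t p q) ⊆ finiteSpace (isoNorm Φ t p q) := by
  have hp0 : 0 < p.toReal := ENNReal.toReal_pos hp hp'
  obtain ⟨i₀, i₁, hi⟩ : ∃ i₀ i₁ : Fin d, i₀ ≠ i₁ :=
    ⟨⟨0, by omega⟩, ⟨1, by omega⟩, by simp⟩
  let B : ContDiffBump (0 : Rd d) := ⟨1 / 32, 1 / 16, by norm_num, by norm_num⟩
  let b : ℕ → Rd d := fun j => EuclideanSpace.single i₀ (7 / 8 * 2 ^ (j + 5) : ℝ) +
    EuclideanSpace.single i₁ (7 / 8 * 2 ^ j : ℝ)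
  let κ : ℕ → Fin d → ℕ := fun j => Pi.single i₀ (j + 5) + Pi.single i₁ j
  have hκsum : ∀ j, ∑ i, κ j i = 2 * j + 5 := by
    intro j
    simp only [κ, Pi.add_apply, Finset.sum_add_distrib, Finset.sum_pi_single', Finset.mem_univ,
      if_true]
    omega
  have hκinj : Function.Injective κ := by
    intro j k hjk
    have := congrFun hjk i₀
    simpa [κ, Pi.single_eq_of_ne hi] using this
  have hpow : ∀ j : ℕ, (1 : ℝ) ≤ 2 ^ j := fun j => one_le_pow₀ (by norm_num)
  have hnear : ∀ j ξ, B (ξ - b j) ≠ 0 → ‖ξ - b j‖ < 1 / 16 := by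
    intro j ξ h
    have : ξ - b j ∈ Function.support B := h
    rw [B.support_eq, mem_ball_zero_iff] at this
    exact this
  have hcoord : ∀ j ξ, B (ξ - b j) ≠ 0 → ∀ i, |ξ i - b j i| < 1 / 16 := fun j ξ h i =>
    (PiLp.norm_apply_le (ξ - b j) i).trans_lt (hnear j ξ h)
  have hmix : ∀ j ξ, B (ξ - b j) ≠ 0 → ∀ i, (κ j i = 0 ∨ 3 / 4 * 2 ^ (κ j i) < |ξ i|) ∧
      |ξ i| ≤ 2 ^ (κ j i) := by
    intro j ξ h i
    have h1 := abs_lt.1 (hcoord j ξ h i)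
    have h2 := hpow j
    by_cases hi0 : i = i₀
    · subst hi0
      have e1 : κ j i = j + 5 := by simp [κ, Pi.single_eq_of_ne hi]
      have e2 : b j i = 7 / 8 * 2 ^ (j + 5) := by simp [b, hi]
      rw [e2] at h1
      have h3 := hpow (j + 5)
      have h4 : 0 ≤ ξ i := by linarith
      rw [e1, abs_of_nonneg h4]
      exact ⟨Or.inr (by linarith), by linarith⟩
    · by_cases hi1 : i = i₁
      · subst hi1
        have e1 : κ j i = j := by simp [κ, Pi.single_eq_of_ne hi.symm]
        have e2 : b j i = 7 / 8 * 2 ^ j := by simp [b, hi0]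
        rw [e2] at h1
        have h4 : 0 ≤ ξ i := by linarith
        rw [e1, abs_of_nonneg h4]
        exact ⟨Or.inr (by linarith), by linarith⟩
      · have e1 : κ j i = 0 := by simp [κ, Pi.single_eq_of_ne hi0, Pi.single_eq_of_ne hi1]
        have e2 : b j i = 0 := by simp [b, hi0, hi1]
        rw [e2] at h1
        rw [e1]
        refine ⟨Or.inl rfl, abs_le.2 ⟨?_, ?_⟩⟩ <;> rw [pow_zero] <;> linarith
  have hiso : ∀ j ξ, B (ξ - b j) ≠ 0 → 3 / 4 * 2 ^ (j + 5) < ‖ξ‖ ∧ ‖ξ‖ ≤ 2 ^ (j + 5) := by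
    intro j ξ h
    constructor
    · have h1 := (hmix j ξ h i₀).1
      have e1 : κ j i₀ = j + 5 := by simp [κ, Pi.single_eq_of_ne hi]
      rw [e1] at h1
      exact (h1.resolve_left (by omega)).trans_le (PiLp.norm_apply_le ξ i₀)
    · have h1 : ‖ξ‖ ≤ ‖ξ - b j‖ + ‖b j‖ := by simpa using norm_add_le (ξ - b j) (b j)
      have h2 : ‖b j‖ ≤ 7 / 8 * 2 ^ (j + 5) + 7 / 8 * 2 ^ j := by
        refine (norm_add_le _ _).trans_eq ?_
        rw [PiLp.norm_single, PiLp.norm_single,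
          Real.norm_of_nonneg (by positivity), Real.norm_of_nonneg (by positivity)]
      have h3 := hnear j ξ h
      have h4 := hpow j
      rw [pow_add] at h2 ⊢
      norm_num at h2 ⊢
      linarith
  obtain ⟨f, hf⟩ := exists_lacunary (g := fun j ξ => B (ξ - b j))
    (fun j => B.continuous.comp (continuous_id.sub continuous_const)) (fun j ξ => B.nonneg)
    (fun j ξ => B.le_one) hiso (-(3 / 2) * t)
  let u : Rd d → ℂ := fun ξ => (B ξ : ℂ)
  have hu : ContDiff ℝ ∞ u := Complex.ofRealCLM.contDiff.comp B.contDiff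
  have huc : HasCompactSupport u := B.hasCompactSupport.comp_left Complex.ofReal_zero
  have hblock : ∀ (m : Symbol d) (j : ℕ), (∀ k ξ, B (ξ - b k) ≠ 0 →
      m.toFun ξ = if k = j then 1 else 0) → ∀ x,
      ‖multiplier m f x‖ₑ = ENNReal.ofReal (2 ^ (-(3 / 2) * t * j)) * ‖synth u x‖ₑ := by
    intro m j hm x
    rw [hf m j (fun k hk ξ hξ => by rw [hm k ξ hξ, if_neg hk]), enorm_mul, enorm_ofReal_two_rpow]
    congr 1
    rw [← enorm_synth_comp_sub u (b j) x]
    congr 2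
    funext ξ
    by_cases h : B (ξ - b j) = 0
    · simp [u, h]
    · rw [hm j ξ h]
      simp [u]
  have hmz : ∀ k, k ∉ range κ → ∀ x, multiplier (Ψ.symbol k) f x = 0 := by
    intro k hk x
    have hz : ∀ j ξ, B (ξ - b j) ≠ 0 → (Ψ.symbol k).toFun ξ = 0 := by
      intro j ξ h
      rw [Ψ.symbol_eq_ite (fun i => (hmix j ξ h i).1) (fun i => (hmix j ξ h i).2), if_neg]
      rintro rfl
      exact hk ⟨j, rfl⟩
    rw [hf _ 0 (fun j _ => hz j)]
    have : (fun ξ => ((B (ξ - b 0) : ℝ) : ℂ) * (Ψ.symbol k).toFun ξ) = fun _ => 0 := by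
      funext ξ
      by_cases h : B (ξ - b 0) = 0
      · simp [h]
      · simp [hz 0 ξ h]
    rw [this, synth_apply]
    simp
  intro hsub
  have hmem : f ∈ finiteSpace (mixedNorm (d := d) Ψ t p q) := by
    rw [finiteSpace, mem_ofPred_eq, mixedNorm, LpLqNorm_lt_top_iff hp hp']
    obtain ⟨C, hC, hle⟩ := exists_lq_rpow_le hq hp0 (ε := -t / 4) (by linarith)
    have hpt : ∀ x, lq q (fun k : Fin d → ℕ => ‖(((2 : ℝ) ^ (((∑ i, k i : ℕ) : ℝ) * t) : ℝ) : ℂ) *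
        multiplier (Ψ.symbol k) f x‖ₑ) ^ p.toReal ≤
        C * (∑' j : ℕ, ENNReal.ofReal ((2 : ℝ) ^ (5 * t * p.toReal + t / 4 * p.toReal * j))) *
          ‖synth u x‖ₑ ^ p.toReal := by
      intro x
      rw [lq_comp_of_injective hq hκinj fun k hk => by rw [hmz k hk, mul_zero, enorm_zero]]
      refine (hle _).trans_eq ?_
      rw [mul_assoc, ← ENNReal.tsum_mul_right]
      congr 2
      funext j
      rw [enorm_mul, enorm_ofReal_two_rpow, hκsum, hblock (Ψ.symbol (κ j)) j, ← mul_assoc,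
        ← mul_assoc, ENNReal.mul_rpow_of_nonneg _ _ hp0.le, ← ENNReal.ofReal_mul (by positivity),
        ← ENNReal.ofReal_mul (by positivity), ← Real.rpow_add (by norm_num),
        ← Real.rpow_add (by norm_num), ofReal_two_rpow_rpow _ hp0.le]
      · congr 3
        push_cast
        ring
      · intro k ξ h
        rw [Ψ.symbol_eq_ite (fun i => (hmix k ξ h i).1) (fun i => (hmix k ξ h i).2)]
        exact if_congr ⟨fun e => (hκinj e).symm, fun e => by rw [e]⟩ rfl rfl
    refine (lintegral_mono hpt).trans_lt ?_
    have hsum := tsum_ofReal_two_rpow_lt_top (5 * t * p.toReal) (β := t / 4 * p.toReal)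
      (by nlinarith)
    rw [lintegral_const_mul' _ _ (ENNReal.mul_ne_top hC hsum.ne)]
    exact ENNReal.mul_lt_top (ENNReal.mul_lt_top hC.lt_top hsum)
      (lintegral_synth_rpow_lt_top hu huc hp0)
  have hfin := hsub hmem
  rw [finiteSpace, mem_ofPred_eq, isoNorm, LpLqNorm_lt_top_iff hp hp'] at hfin
  obtain ⟨x₀, hx₀⟩ := exists_synth_ne_zero hu huc (ξ := 0) (by
    have : B 0 = 1 := B.one_of_mem_closedBall (by simp [B.rIn_pos.le])
    simp [u, this])
  have hopen : IsOpen {x | synth u x ≠ 0} :=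
    isOpen_ne_fun (continuous_synth hu huc) continuous_const
  have htop : ∀ x ∈ {x | synth u x ≠ 0}, lq q (fun j : ℕ =>
      ‖(((2 : ℝ) ^ ((j : ℝ) * t) : ℝ) : ℂ) * multiplier (Φ.symbol j) f x‖ₑ) ^ p.toReal = ⊤ := by
    intro x hx
    have : lq q (fun j : ℕ =>
      ‖(((2 : ℝ) ^ ((j : ℝ) * t) : ℝ) : ℂ) * multiplier (Φ.symbol j) f x‖ₑ) = ⊤ := by
      refine eq_top_of_forall_two_rpow_mul_le (α := 5 * t) (β := -t / 2) (by linarith)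
        (c := ‖synth u x‖ₑ) (enorm_ne_zero.2 hx) (n := 0) fun j _ => ?_
      refine le_trans (le_of_eq ?_) (le_lq hq _ (j + 5))
      rw [enorm_mul, enorm_ofReal_two_rpow, hblock (Φ.symbol (j + 5)) j, ← mul_assoc,
        ← ENNReal.ofReal_mul (by positivity), ← Real.rpow_add (by norm_num)]
      · congr 3
        push_cast
        ring
      · intro k ξ h
        rw [Φ.symbol_eq_ite (hiso k ξ h).1 (hiso k ξ h).2]
        exact if_congr (by omega) rfl rfl
    rw [this, ENNReal.top_rpow_of_pos hp0]
  refine hfin.ne (top_le_iff.1 ?_)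
  calc (⊤ : ℝ≥0∞) = ∫⁻ x in {x | synth u x ≠ 0}, ⊤ := by
        rw [setLIntegral_const, ENNReal.top_mul (hopen.measure_pos volume ⟨x₀, hx₀⟩).ne']
    _ = ∫⁻ x in {x | synth u x ≠ 0}, _ :=
        (setLIntegral_congr_fun hopen.measurableSet htop).symm
    _ ≤ _ := setLIntegral_le_lintegral _ _

end LizorkinTriebel


namespace LizorkinTriebel

/-! ### The isotropic space is not contained in the mixed one -/

lemma exists_isOpen_le_enorm_synth {u : ℝ → ℂ} (hu : ContDiff ℝ ∞ u) (hc : HasCompactSupport u)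
    {ξ : ℝ} (hξ : u ξ ≠ 0) : ∃ (r : ℝ≥0∞) (U : Set ℝ), r ≠ 0 ∧ IsOpen U ∧ U.Nonempty ∧
      ∀ s ∈ U, r ≤ ‖synth u s‖ₑ := by
  obtain ⟨s₀, hs₀⟩ := exists_synth_ne_zero hu hc hξ
  have hpos : 0 < ‖synth u s₀‖ₑ := enorm_pos.2 hs₀
  obtain ⟨r, hr0, hr⟩ := exists_between hpos
  exact ⟨r, {s | r < ‖synth u s‖ₑ}, hr0.ne',
    isOpen_lt continuous_const (continuous_synth hu hc).enorm, ⟨s₀, hr⟩, fun s hs => le_of_lt hs⟩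

lemma enorm_prod_eq {ι : Type*} (s : Finset ι) (z : ι → ℂ) : ‖∏ i ∈ s, z i‖ₑ = ∏ i ∈ s, ‖z i‖ₑ := by
  rw [← ofReal_norm, norm_prod, ENNReal.ofReal_prod_of_nonneg fun i _ => norm_nonneg _]
  exact Finset.prod_congr rfl fun i _ => ofReal_norm _

lemma lintegral_comp_two_pow_smul {d : ℕ} {h : Rd d → ℝ≥0∞} (hh : Measurable h) (j : ℕ) :
    ∫⁻ x, h ((2 : ℝ) ^ j • x) = ENNReal.ofReal (2 ^ (0 + -(d : ℝ) * j)) * ∫⁻ x, h x := by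
  have h2 : (2 : ℝ) ^ j ≠ 0 := by positivity
  rw [← lintegral_map (μ := volume) hh (measurable_const_smul ((2 : ℝ) ^ j)),
    Measure.map_addHaar_smul volume h2, lintegral_smul_measure, finrank_euclideanSpace_fin,
    abs_of_nonneg (by positivity), smul_eq_mul]
  congr 2
  rw [zero_add, neg_mul, Real.rpow_neg (by norm_num), mul_comm, Real.rpow_mul (by norm_num),
    Real.rpow_natCast, Real.rpow_natCast]

theorem not_finiteSpace_isoNorm_subset {d : ℕ} (hd : 2 ≤ d) (t : ℝ)
    (Φ : IsoGenerator d) (Ψ : MixedGenerator) {p q : ℝ≥0∞} (hp : p ≠ 0) (hp' : p < 1)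
    (hq : q ≠ 0) :
    ¬ finiteSpace (isoNorm Φ t p q) ⊆ finiteSpace (mixedNorm (d := d) Ψ t p q) := by
  have hpt : p ≠ ⊤ := (hp'.trans ENNReal.one_lt_top).ne
  have hp0 : 0 < p.toReal := ENNReal.toReal_pos hp hpt
  have hp1 : p.toReal < 1 := by
    rw [← ENNReal.toReal_one]
    exact (ENNReal.toReal_lt_toReal hpt ENNReal.one_ne_top).2 hp'
  set P := p.toReal with hP
  have hd0 : (0 : ℝ) < d := by exact_mod_cast (by omega : 0 < d)
  have hd1 : (1 : ℝ) < d := by exact_mod_cast (by omega : 1 < d)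
  have hPinv : 1 < 1 / P := (one_lt_div hp0).2 hp1
  set δ : ℝ := (d - 1) * (1 / P - 1) with hδ
  have hδ0 : 0 < δ := mul_pos (by linarith) (by linarith)
  set σ : ℝ := d / P - d - δ / 2 - t with hσ
  let i₀ : Fin d := ⟨0, by omega⟩
  let a : ContDiffBump (7 / 8 : ℝ) := ⟨1 / 32, 1 / 16, by norm_num, by norm_num⟩
  let b : ContDiffBump (0 : ℝ) := ⟨1 / (32 * d), 1 / (16 * d), by positivity, by
    rw [div_lt_div_iff₀ (by positivity) (by positivity)]
    linarith⟩
  let v : Fin d → ℝ → ℝ := fun i s => if i = i₀ then a s else b s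
  have hv0 : ∀ i s, 0 ≤ v i s := fun i s => by
    simp only [v]
    split_ifs
    exacts [a.nonneg, b.nonneg]
  have hv1 : ∀ i s, v i s ≤ 1 := fun i s => by
    simp only [v]
    split_ifs
    exacts [a.le_one, b.le_one]
  have hvsm : ∀ i, ContDiff ℝ ∞ (v i) := fun i => by
    simp only [v]
    split_ifs
    exacts [a.contDiff, b.contDiff]
  have ha : ∀ s, a s ≠ 0 → |s - 7 / 8| < 1 / 16 := by
    intro s hs
    have : s ∈ Function.support a := hs
    rwa [a.support_eq, Metric.mem_ball, Real.dist_eq] at this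
  have hb : ∀ s, b s ≠ 0 → |s| < 1 / (16 * d) := by
    intro s hs
    have : s ∈ Function.support b := hs
    rwa [b.support_eq, mem_ball_zero_iff, Real.norm_eq_abs] at this
  have hb1 : ∀ s : ℝ, |s| ≤ 1 / (32 * d) → b s = 1 := fun s hs =>
    b.one_of_mem_closedBall (by rwa [mem_closedBall_zero_iff, Real.norm_eq_abs])
  let G : Rd d → ℝ := fun ξ => ∏ i, v i (ξ i)
  have hGsm : ContDiff ℝ ∞ G :=
    contDiff_prod fun i _ => (hvsm i).comp (EuclideanSpace.proj (𝕜 := ℝ) i).contDiff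
  have hG0 : ∀ ξ, 0 ≤ G ξ := fun ξ => Finset.prod_nonneg fun i _ => hv0 i _
  have hG1 : ∀ ξ, G ξ ≤ 1 := fun ξ => Finset.prod_le_one (fun i _ => hv0 i _) fun i _ => hv1 i _
  have hGv : ∀ ξ, G ξ ≠ 0 → ∀ i, v i (ξ i) ≠ 0 := fun ξ h i =>
    Finset.prod_ne_zero_iff.1 h i (Finset.mem_univ i)
  have hGa : ∀ ξ, G ξ ≠ 0 → 3 / 4 < |ξ i₀| ∧ |ξ i₀| ≤ 1 := by
    intro ξ h
    have h1 := hGv ξ h i₀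
    simp only [v, if_true] at h1
    have h2 := abs_lt.1 (ha _ h1)
    rw [abs_of_nonneg (by linarith)]
    exact ⟨by linarith, by linarith⟩
  have hGn : ∀ ξ, G ξ ≠ 0 → 3 / 4 < ‖ξ‖ ∧ ‖ξ‖ ≤ 1 := by
    intro ξ h
    refine ⟨(hGa ξ h).1.trans_le (PiLp.norm_apply_le ξ i₀), ?_⟩
    have h1 : ∀ i, |ξ i| ≤ (if i = i₀ then 15 / 16 else 0) + 1 / (16 * (d : ℝ)) := by
      intro i
      have h2 := hGv ξ h i
      have h3 : 0 < 1 / (16 * (d : ℝ)) := by positivity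
      simp only [v] at h2
      split_ifs at h2 ⊢ with hi
      · have h4 := abs_lt.1 (ha _ h2)
        exact abs_le.2 ⟨by linarith, by linarith⟩
      · linarith [hb _ h2]
    refine (norm_le_sum_abs ξ).trans ((Finset.sum_le_sum fun i _ => h1 i).trans ?_)
    rw [Finset.sum_add_distrib, Finset.sum_ite_eq' Finset.univ i₀]
    simp only [Finset.mem_univ, if_true, Finset.sum_const, Finset.card_univ, Fintype.card_fin,
      nsmul_eq_mul]
    have : (d : ℝ) * (1 / (16 * d)) = 1 / 16 := by field_simp
    rw [this]
    norm_num
  let g : ℕ → Rd d → ℝ := fun j ξ => G (((2 : ℝ) ^ j)⁻¹ • ξ)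
  have hga : ∀ j ξ, g j ξ ≠ 0 → 3 / 4 * 2 ^ j < |ξ i₀| ∧ |ξ i₀| ≤ 2 ^ j := by
    intro j ξ h
    have h1 := hGa _ h
    have h2 : (((2 : ℝ) ^ j)⁻¹ • ξ) i₀ = ((2 : ℝ) ^ j)⁻¹ • ξ i₀ := rfl
    rwa [h2, abs_inv_two_pow_smul, lt_div_iff₀ (by positivity), div_le_one (by positivity)] at h1
  have hgn : ∀ j ξ, g j ξ ≠ 0 → 3 / 4 * 2 ^ j < ‖ξ‖ ∧ ‖ξ‖ ≤ 2 ^ j := by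
    intro j ξ h
    have h1 := hGn _ h
    rwa [norm_inv_two_pow_smul, lt_div_iff₀ (by positivity), div_le_one (by positivity)] at h1
  obtain ⟨f, hf⟩ := exists_lacunary (g := g)
    (fun j => hGsm.continuous.comp (continuous_const_smul _)) (fun j ξ => hG0 _)
    (fun j ξ => hG1 _) (a := 0) hgn σ
  let u : Rd d → ℂ := fun ξ => (G ξ : ℂ)
  have hu : ContDiff ℝ ∞ u := Complex.ofRealCLM.contDiff.comp hGsm
  have huc : HasCompactSupport u := by
    refine HasCompactSupport.intro (isCompact_closedBall (0 : Rd d) 1) fun ξ hξ => ?_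
    by_contra h
    refine hξ (mem_closedBall_zero_iff.2 (hGn ξ fun h' => h ?_).2)
    simp [u, h']
  intro hsub
  have hmem : f ∈ finiteSpace (isoNorm Φ t p q) := by
    rw [finiteSpace, mem_ofPred_eq, isoNorm, LpLqNorm_lt_top_iff hp hpt]
    obtain ⟨C, hC, hle⟩ := exists_lq_rpow_le hq hp0 (ε := δ / 4) (by linarith)
    have hblock : ∀ (j : ℕ) x, ‖multiplier (Φ.symbol j) f x‖ₑ =
        ENNReal.ofReal (2 ^ ((σ + d) * j)) * ‖synth u ((2 : ℝ) ^ j • x)‖ₑ := by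
      intro j x
      rw [hf (Φ.symbol j) j fun k hk ξ hξ => by
        rw [Φ.symbol_eq_ite (hgn k ξ hξ).1 (hgn k ξ hξ).2, if_neg hk.symm]]
      have h1 : (fun ξ => (g j ξ : ℂ) * (Φ.symbol j).toFun ξ) =
          fun ξ => u (((2 : ℝ) ^ j)⁻¹ • ξ) := by
        funext ξ
        by_cases h : g j ξ = 0
        · rw [h, Complex.ofReal_zero, zero_mul]
          simp only [u]
          rw [← Complex.ofReal_zero]
          exact congrArg _ h.symm
        · rw [Φ.symbol_eq_ite (hgn j ξ h).1 (hgn j ξ h).2, if_pos rfl, mul_one]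
      rw [h1, synth_comp_inv_smul u (by positivity), finrank_euclideanSpace_fin, ← mul_assoc,
        enorm_mul, ← Complex.ofReal_pow, ← Complex.ofReal_mul]
      congr 1
      rw [← Real.rpow_natCast, ← Real.rpow_natCast, ← Real.rpow_mul (by norm_num),
        ← Real.rpow_add (by norm_num), enorm_ofReal_two_rpow]
      congr 2
      ring
    have hpt : ∀ x, lq q (fun j : ℕ => ‖(((2 : ℝ) ^ ((j : ℝ) * t) : ℝ) : ℂ) *
        multiplier (Φ.symbol j) f x‖ₑ) ^ P ≤
        C * ∑' j : ℕ, ENNReal.ofReal ((2 : ℝ) ^ (0 + (d - δ / 4 * P) * j)) *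
          ‖synth u ((2 : ℝ) ^ j • x)‖ₑ ^ P := by
      intro x
      refine (hle _).trans_eq ?_
      congr 2
      funext j
      rw [enorm_mul, enorm_ofReal_two_rpow, hblock, ← mul_assoc, ← mul_assoc,
        ENNReal.mul_rpow_of_nonneg _ _ hp0.le, ← ENNReal.ofReal_mul (by positivity),
        ← ENNReal.ofReal_mul (by positivity), ← Real.rpow_add (by norm_num),
        ← Real.rpow_add (by norm_num), ofReal_two_rpow_rpow _ hp0.le]
      congr 3
      rw [hσ]
      field_simp
      ring
    have hum : Measurable fun x => ‖synth u x‖ₑ ^ P :=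
      (continuous_synth hu huc).enorm.measurable.pow_const _
    have hsum := tsum_ofReal_two_rpow_lt_top 0 (β := -(δ / 4 * P)) (by
      have : 0 < δ / 4 * P := by positivity
      linarith)
    refine (lintegral_mono hpt).trans_lt ?_
    have hum' : ∀ j : ℕ, Measurable fun x => ‖synth u ((2 : ℝ) ^ j • x)‖ₑ ^ P := fun j =>
      hum.comp (measurable_const_smul ((2 : ℝ) ^ j))
    rw [lintegral_const_mul' _ _ hC, lintegral_tsum fun j => ((hum' j).const_mul _).aemeasurable]
    refine ENNReal.mul_lt_top hC.lt_top ?_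
    calc _ = ∑' j : ℕ, ENNReal.ofReal ((2 : ℝ) ^ (0 + -(δ / 4 * P) * j)) *
          ∫⁻ x, ‖synth u x‖ₑ ^ P := by
          congr 1
          funext j
          rw [lintegral_const_mul' _ _ ENNReal.ofReal_ne_top,
            lintegral_comp_two_pow_smul (h := fun x => ‖synth u x‖ₑ ^ P) hum, ← mul_assoc,
            ← ENNReal.ofReal_mul (by positivity), ← Real.rpow_add (by norm_num)]
          congr 3
          ring
      _ < ⊤ := by
          rw [ENNReal.tsum_mul_right]
          exact ENNReal.mul_lt_top hsum (lintegral_synth_rpow_lt_top hu huc hp0)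
  have hfin := hsub hmem
  rw [finiteSpace, mem_ofPred_eq, mixedNorm, LpLqNorm_eq hp hpt,
    ENNReal.rpow_lt_top_iff_of_pos (by positivity)] at hfin
  refine hfin.ne ?_
  let w : Fin d → ℝ → ℂ := fun i s => if i = i₀ then (a s : ℂ) else Ψ.φ₀ s
  have hw : ∀ i, ∃ (r : ℝ≥0∞) (U : Set ℝ), r ≠ 0 ∧ IsOpen U ∧ U.Nonempty ∧
      ∀ s ∈ U, r ≤ ‖synth (w i) s‖ₑ := by
    intro i
    by_cases hi : i = i₀
    · have : w i = fun s => (a s : ℂ) := by simp [w, hi]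
      rw [this]
      refine exists_isOpen_le_enorm_synth (Complex.ofRealCLM.contDiff.comp a.contDiff)
        (a.hasCompactSupport.comp_left Complex.ofReal_zero) (ξ := 7 / 8) ?_
      have : a (7 / 8) = 1 := a.one_of_mem_closedBall (by simp [a.rIn_pos.le])
      simp [this]
    · have : w i = Ψ.φ₀ := by
        funext s
        simp [w, hi]
      rw [this]
      exact exists_isOpen_le_enorm_synth Ψ.smooth Ψ.compactSupport (ξ := 0)
        (by rw [Ψ.φ₀_eq_one (by simp)]; exact one_ne_zero)
  choose r U hr hUo hUn hrU using hw
  let T : ℕ → Fin d → Set ℝ := fun l i => if i = i₀ then ((2 : ℝ) ^ l * ·) ⁻¹' U i else U i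
  have hTm : ∀ l, MeasurableSet (Set.pi univ (T l)) := by
    intro l
    refine MeasurableSet.univ_pi fun i => ?_
    simp only [T]
    split_ifs
    · exact (measurable_const_mul _) (hUo i).measurableSet
    · exact (hUo i).measurableSet
  have hTvol : ∀ l : ℕ, volume (Set.pi univ (T l)) =
      ENNReal.ofReal (2 ^ (-(l : ℝ))) * ∏ i, volume (U i) := by
    intro l
    rw [volume_pi_pi, ← Finset.mul_prod_erase _ _ (Finset.mem_univ i₀),
      ← Finset.mul_prod_erase _ (fun i => volume (U i)) (Finset.mem_univ i₀), ← mul_assoc]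
    congr 1
    · simp only [T, if_true]
      rw [Real.volume_preimage_mul_left (by positivity), abs_of_nonneg (by positivity),
        Real.rpow_neg (by norm_num), Real.rpow_natCast]
    · refine Finset.prod_congr rfl fun i hi => ?_
      simp only [T, if_neg (Finset.ne_of_mem_erase hi)]
  obtain ⟨n, hn⟩ := pow_unbounded_of_one_lt (48 * d : ℝ) (one_lt_two)
  have hmixed : ∀ l : ℕ, n ≤ l → ∀ x : Rd d, ‖multiplier (Ψ.symbol (Pi.single i₀ l)) f x‖ₑ =
      ENNReal.ofReal (2 ^ ((σ + 1) * l)) *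
        ∏ i, ‖synth (w i) (if i = i₀ then 2 ^ l * x i else x i)‖ₑ := by
    intro l hl x
    rw [hf _ l fun k hk ξ hξ => Finset.prod_eq_zero (Finset.mem_univ i₀) (by
      rw [Pi.single_eq_same, Ψ.dyadic_eq_ite (Or.inr (hga k ξ hξ).1) (hga k ξ hξ).2,
        if_neg hk.symm])]
    have hpow : 48 * (d : ℝ) ≤ 2 ^ l := hn.le.trans (pow_le_pow_right₀ (by norm_num) hl)
    let w' : Fin d → ℝ → ℂ := fun i s => if i = i₀ then w i (((2 : ℝ) ^ l)⁻¹ • s) else w i s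
    have h1 : (fun ξ : Rd d => (g l ξ : ℂ) * (Ψ.symbol (Pi.single i₀ l)).toFun ξ) =
        fun ξ => ∏ i, w' i (ξ i) := by
      funext ξ
      simp only [w', g, G, MixedGenerator.symbol]
      rw [Complex.ofReal_prod, ← Finset.prod_mul_distrib]
      refine Finset.prod_congr rfl fun i _ => ?_
      have h2 : (((2 : ℝ) ^ l)⁻¹ • ξ) i = ((2 : ℝ) ^ l)⁻¹ • ξ i := rfl
      rw [h2]
      by_cases hi : i = i₀
      · subst hi
        simp only [v, w, if_true, Pi.single_eq_same]
        by_cases h : a (((2 : ℝ) ^ l)⁻¹ • ξ i₀) = 0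
        · rw [h, Complex.ofReal_zero, zero_mul]
        · have h3 := abs_lt.1 (ha _ h)
          have h4 := abs_inv_two_pow_smul l (ξ i₀)
          rw [abs_of_nonneg (by linarith)] at h4
          rw [Ψ.dyadic_eq_ite (j := l), if_pos rfl, mul_one]
          · right
            rw [← lt_div_iff₀ (by positivity), ← h4]
            linarith
          · rw [← div_le_one (by positivity), ← h4]
            linarith
      · simp only [v, w, if_neg hi, Pi.single_eq_of_ne hi, dyadic]
        by_cases h : Ψ.φ₀ (ξ i) = 0
        · rw [h, mul_zero]
        · have h3 : |ξ i| ≤ 3 / 2 := by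
            by_contra h'
            exact h (Ψ.φ₀_eq_zero (not_le.1 h'))
          rw [hb1, Complex.ofReal_one, one_mul]
          rw [abs_inv_two_pow_smul, div_le_div_iff₀ (by positivity) (by positivity)]
          nlinarith
    rw [h1, synth_prod, enorm_mul, enorm_ofReal_two_rpow, enorm_prod_eq,
      ← Finset.mul_prod_erase _ _ (Finset.mem_univ i₀),
      ← Finset.mul_prod_erase _ (fun i => ‖synth (w i) (if i = i₀ then 2 ^ l * x i else x i)‖ₑ)
        (Finset.mem_univ i₀), ← mul_assoc, ← mul_assoc]
    congr 1
    · have h2 : w' i₀ = fun s => w i₀ (((2 : ℝ) ^ l)⁻¹ • s) := by simp [w']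
      simp only [if_true]
      rw [h2, synth_comp_inv_smul (w i₀) (by positivity), Module.finrank_self, pow_one, enorm_mul,
        ← mul_assoc, smul_eq_mul]
      congr 1
      rw [← Real.rpow_natCast, enorm_ofReal_two_rpow, ← ENNReal.ofReal_mul (by positivity),
        ← Real.rpow_add (by norm_num)]
      congr 2
      ring
    · refine Finset.prod_congr rfl fun i hi => ?_
      have h2 : w' i = w i := by simp [w', Finset.ne_of_mem_erase hi]
      rw [h2, if_neg (Finset.ne_of_mem_erase hi)]
  have hexp : 0 < δ / 2 * P := by positivity
  refine eq_top_of_forall_two_rpow_mul_le (α := 0) (β := δ / 2 * P) hexp (n := n)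
    (c := (∏ i, r i) ^ P * ∏ i, volume (U i)) (mul_ne_zero ?_ ?_) fun l hl => ?_
  · rw [Ne, ENNReal.rpow_eq_zero_iff_of_pos hp0]
    exact Finset.prod_ne_zero_iff.2 fun i _ => hr i
  · exact Finset.prod_ne_zero_iff.2 fun i _ => ((hUo i).measure_pos volume (hUn i)).ne'
  calc ENNReal.ofReal (2 ^ (0 + δ / 2 * P * l)) * ((∏ i, r i) ^ P * ∏ i, volume (U i))
      = ∫⁻ x in Set.pi univ (T l),
          (ENNReal.ofReal (2 ^ ((t + σ + 1) * l)) * ∏ i, r i) ^ P := by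
        rw [setLIntegral_const, hTvol, ENNReal.mul_rpow_of_nonneg _ _ hp0.le,
          ofReal_two_rpow_rpow _ hp0.le]
        have : ENNReal.ofReal (2 ^ (0 + δ / 2 * P * l)) =
            ENNReal.ofReal (2 ^ ((t + σ + 1) * l * P)) * ENNReal.ofReal (2 ^ (-(l : ℝ))) := by
          rw [← ENNReal.ofReal_mul (by positivity), ← Real.rpow_add (by norm_num)]
          congr 2
          rw [hσ, hδ]
          field_simp
          ring
        rw [this]
        ring
    _ ≤ ∫⁻ x in Set.pi univ (T l), lq q (fun k : Fin d → ℕ =>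
          ‖(((2 : ℝ) ^ (((∑ i, k i : ℕ) : ℝ) * t) : ℝ) : ℂ) *
            multiplier (Ψ.symbol k) f (WithLp.toLp 2 x)‖ₑ) ^ P := by
        refine setLIntegral_mono' (hTm l) fun x hx => ENNReal.rpow_le_rpow ?_ hp0.le
        refine le_trans ?_ (le_lq hq _ (Pi.single i₀ l))
        rw [enorm_mul, enorm_ofReal_two_rpow, hmixed l hl, ← mul_assoc,
          ← ENNReal.ofReal_mul (by positivity), ← Real.rpow_add (by norm_num)]
        refine mul_le_mul' (le_of_eq ?_) (Finset.prod_le_prod' fun i _ => hrU i _ ?_)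
        · congr 2
          rw [Finset.sum_pi_single', if_pos (Finset.mem_univ _)]
          ring
        · have h1 := hx i (mem_univ i)
          simp only [T] at h1
          split_ifs at h1 ⊢ with hi
          · exact h1
          · exact h1
    _ ≤ _ := setLIntegral_le_lintegral _ _

end LizorkinTriebel

theorem proposition3p4 {d : ℕ} (hd : 2 ≤ d) {t : ℝ} (ht : t < 0)
    (Φ : LizorkinTriebel.IsoGenerator d) (Ψ : LizorkinTriebel.MixedGenerator) :
    (∀ p q : ℝ≥0∞, 1 < p → p < ⊤ → 1 ≤ q →
      LizorkinTriebel.Embeds (LizorkinTriebel.isoNorm Φ t p q)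
        (LizorkinTriebel.mixedNorm (d := d) Ψ t p q)) ∧
    (∀ p q : ℝ≥0∞, 0 < p → p < 1 → 0 < q →
      LizorkinTriebel.NotComparable (LizorkinTriebel.isoNorm Φ t p q)
        (LizorkinTriebel.mixedNorm (d := d) Ψ t p q)) := by
  have : NeZero d := ⟨by omega⟩
  refine ⟨fun p q hp hp' hq => LizorkinTriebel.embeds_isoNorm_mixedNorm ht Φ Ψ hp hp' hq,
    fun p q hp hp' hq => ⟨?_, ?_⟩⟩
  · exact LizorkinTriebel.not_finiteSpace_isoNorm_subset hd t Φ Ψ hp.ne' hp' hq.ne'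
  · exact LizorkinTriebel.not_finiteSpace_mixedNorm_subset hd ht Φ Ψ hp.ne'
      (hp'.trans ENNReal.one_lt_top).ne hq.ne'
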